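/- Call a smooth 3-manifold $\Sigma$ (Hausdorff, second countable, without boundary) asymptotically flat if there is a compact $C\subset\Sigma$ such that $\Sigma\setminus C$ consists of finitely many components, each diffeomorphic to $\mathbb R^3$ minus a closed ball. (No metric is involved in this definition.) Theorem. Every asymptotically flat 3-manifold $\Sigma$ carries a physically reasonable, asymptotically null initial data set whose mean curvature is a nonzero constant. In detail, there are a nonzero constant $H$, a smooth Riemannian metric $g_{ab}$, a smooth symmetric tensor $p_{ab}$, a smooth function $\rho$ and a smooth vector field $J^a$ on $\Sigma$ such that: (i) with $p=g^{ab}p_{ab}$, $R$ the scalar curvature and $D$ the Levi-Civita connection of $g$, the constraints $R-p_{ab}p^{ab}+p^2=16\pi\rho$ and $D_b(p^{ab}-p\,g^{ab})=8\pi J^a$ hold on $\Sigma$; (ii) $g$ is geodesically complete, and $\rho\ge\sqrt{J_aJ^a}$; (iii) $p=H$ on all of $\Sigma$; (iv) outside a compact set, the data on each end are equal to the data of a CMC hypersurface in a Schwarzschild spacetime. Precisely, there is a compact $K\subset\Sigma$ such that $\Sigma\setminus K$ is a disjoint union of finitely many open sets, and for each of them there are $M>0$, $R_0>2M$, a diffeomorphism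 from it onto $\{x\in\mathbb R^3:|x|>R_0\}$, and a smooth function $f$ on $(R_0,\infty)$ such that $t=f(r)$ is a spacelike hypersurface of constant mean curvature $H$ in the exterior region $r>2M$ of the Schwarzschild spacetime $$-\Bigl(1-\tfrac{2M}{r}\Bigr)dt^2+\Bigl(1-\tfrac{2M}{r}\Bigr)^{-1}dr^2+r^2\,d\Omega^2 ,$$ and the diffeomorphism carries $g_{ab}$ and $p_{ab}$ to the induced metric and the extrinsic curvature ($p_{ab}=-\tfrac12\mathcal L_n g_{ab}$, $n$ the future unit normal) of this hypersurface. Moreover this hypersurface is totally umbilic, $p_{ab}=\tfrac H3 g_{ab}$, and it reaches null infinity: with $r_*=r+2M\log\bigl(\tfrac{r}{2M}-1\bigr)$, one of $f(r)-r_*$ and $f(r)+r_*$ has a finite limit as $r\to\infty$. -/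

import Mathlib

open Set Filter Topology Bundle
open scoped Manifold ContDiff

noncomputable section

/-! ## Tensor calculus in coordinates

A metric on an open subset of `ℝⁿ` is given by its matrix of components, as a function of the point.
The same formulas serve Riemannian (`n = 3`) and Lorentzian (`n = 4`) metrics. -/

/-- Coordinate space `ℝⁿ`. -/
abbrev Coord (n : ℕ) : Type := EuclideanSpace ℝ (Fin n)

/-- The partial derivative `∂ᵢ f` at `x`. -/
def pderiv {n : ℕ} (i : Fin n) (f : Coord n → ℝ) (x : Coord n) : ℝ :=
  fderiv ℝ f x (EuclideanSpace.single i 1)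

/-- Christoffel symbols
`Γᵏᵢⱼ = ½ gᵏˡ (∂ᵢ gₗⱼ + ∂ⱼ gₗᵢ - ∂ₗ gᵢⱼ)`. -/
def christoffel {n : ℕ} (G : Coord n → Matrix (Fin n) (Fin n) ℝ) (k i j : Fin n)
    (x : Coord n) : ℝ :=
  (1 / 2) * ∑ l, (G x)⁻¹ k l *
    (pderiv i (fun y => G y l j) x + pderiv j (fun y => G y l i) x
      - pderiv l (fun y => G y i j) x)

/-- Ricci curvature
`Rᵢⱼ = ∂ₖ Γᵏᵢⱼ - ∂ⱼ Γᵏₖᵢ + Γᵏₖₗ Γˡᵢⱼ - Γᵏⱼₗ Γˡₖᵢ`. -/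
def ricciCoord {n : ℕ} (G : Coord n → Matrix (Fin n) (Fin n) ℝ) (i j : Fin n)
    (x : Coord n) : ℝ :=
  ∑ k, (pderiv k (christoffel G k i j) x - pderiv j (christoffel G k k i) x
    + ∑ l, (christoffel G k k l x * christoffel G l i j x
      - christoffel G k j l x * christoffel G l k i x))

/-- Scalar curvature `R = gⁱʲ Rᵢⱼ`. -/
def scalarCoord {n : ℕ} (G : Coord n → Matrix (Fin n) (Fin n) ℝ) (x : Coord n) : ℝ :=
  ∑ i, ∑ j, (G x)⁻¹ i j * ricciCoord G i j x

/-- The trace `gᵃᵇ pₐᵦ`. -/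
def traceCoord {n : ℕ} (G P : Coord n → Matrix (Fin n) (Fin n) ℝ) (x : Coord n) : ℝ :=
  ∑ a, ∑ b, (G x)⁻¹ a b * P x a b

/-- `pᵃᵇ`, both indices raised with `g`. -/
def raiseCoord {n : ℕ} (G P : Coord n → Matrix (Fin n) (Fin n) ℝ) (a b : Fin n)
    (x : Coord n) : ℝ :=
  ∑ c, ∑ d, (G x)⁻¹ a c * (G x)⁻¹ b d * P x c d

/-- The squared norm `pₐᵦ pᵃᵇ`. -/
def normSqCoord {n : ℕ} (G P : Coord n → Matrix (Fin n) (Fin n) ℝ) (x : Coord n) : ℝ :=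
  ∑ a, ∑ b, P x a b * raiseCoord G P a b x

/-- `πᵃᵇ = pᵃᵇ - p gᵃᵇ`. -/
def momentumTensor {n : ℕ} (G P : Coord n → Matrix (Fin n) (Fin n) ℝ) (a b : Fin n)
    (x : Coord n) : ℝ :=
  raiseCoord G P a b x - traceCoord G P x * (G x)⁻¹ a b

/-- The covariant divergence `D_b πᵃᵇ = ∂_b πᵃᵇ + Γᵃ_{bc} πᶜᵇ + Γᵇ_{bc} πᵃᶜ`. -/
def momentumDiv {n : ℕ} (G P : Coord n → Matrix (Fin n) (Fin n) ℝ) (a : Fin n)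
    (x : Coord n) : ℝ :=
  ∑ b, (pderiv b (momentumTensor G P a b) x
    + ∑ c, (christoffel G a b c x * momentumTensor G P c b x
      + christoffel G b b c x * momentumTensor G P a c x))

/-! ## Hypersurfaces of a four-dimensional Lorentzian coordinate domain -/

/-- The induced metric (first fundamental form) of `φ : ℝ³ → ℝ⁴`. -/
def inducedMetric (G : Coord 4 → Matrix (Fin 4) (Fin 4) ℝ) (φ : Coord 3 → Coord 4)
    (x : Coord 3) : Matrix (Fin 3) (Fin 3) ℝ :=
  Matrix.of fun i j => ∑ μ, ∑ ν,
    G (φ x) μ ν * pderiv i (fun y => φ y μ) x * pderiv j (fun y => φ y ν) x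

/-- `N` is the future-directed unit normal of `φ` at `x`; the time coordinate is the one
with index `0`. -/
def IsFutureUnitNormal (G : Coord 4 → Matrix (Fin 4) (Fin 4) ℝ) (φ : Coord 3 → Coord 4)
    (x : Coord 3) (N : Coord 4) : Prop :=
  (∑ μ, ∑ ν, G (φ x) μ ν * N μ * N ν = -1) ∧
  (∀ i : Fin 3, ∑ μ, ∑ ν, G (φ x) μ ν * N μ * pderiv i (fun y => φ y ν) x = 0) ∧
  0 < N 0

/-- The extrinsic curvature `p(X, Y) = ⟨N, ∇_X Y⟩ = -⟨∇_X N, Y⟩` of `φ` with respect to the unit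
normal field `N`; that is, `p = -½ ℒ_N g`. -/
def extrinsicCurvature (G : Coord 4 → Matrix (Fin 4) (Fin 4) ℝ) (φ N : Coord 3 → Coord 4)
    (x : Coord 3) : Matrix (Fin 3) (Fin 3) ℝ :=
  Matrix.of fun i j => ∑ μ, ∑ ν, G (φ x) μ ν * N x μ *
    (pderiv i (fun z => pderiv j (fun y => φ y ν) z) x
      + ∑ α, ∑ β, christoffel G ν α β (φ x) *
          pderiv i (fun y => φ y α) x * pderiv j (fun y => φ y β) x)

/-- The area radius `r` at the point `(t, x)`: the Euclidean norm of the three space coordinates. -/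
def areaRadius (y : Coord 4) : ℝ :=
  Real.sqrt (∑ i : Fin 3, y i.succ ^ 2)

/-- The Schwarzschild metric of mass `M`,
`-(1 - 2M/r) dt² + (1 - 2M/r)⁻¹ dr² + r² dΩ²`,
in the coordinates `(t, x)`, where `x ∈ ℝ³` has polar coordinates `(r, ω)`; so the space part is
`δᵢⱼ + ((1 - 2M/r)⁻¹ - 1) xᵢ xⱼ / r²`. It is used on the exterior `r > 2M`. -/
def schwarzschild (M : ℝ) (y : Coord 4) : Matrix (Fin 4) (Fin 4) ℝ :=
  Matrix.of fun μ ν =>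
    Fin.cases
      (Fin.cases (-(1 - 2 * M / areaRadius y)) (fun _ => 0) ν)
      (fun i => Fin.cases 0
        (fun j => (if i = j then 1 else 0)
          + ((1 - 2 * M / areaRadius y)⁻¹ - 1) * (y i.succ * y j.succ / areaRadius y ^ 2)) ν)
      μ

/-- The spherically symmetric hypersurface `t = f(r)`, parametrized by `x ↦ (f(|x|), x)`. -/
def radialGraph (f : ℝ → ℝ) (x : Coord 3) : Coord 4 :=
  WithLp.toLp 2 (Fin.cons (f ‖x‖) (fun i => x i))

/-- On the region `U ⊆ ℝ³`, the map `φ` with normal field `N` is a spacelike hypersurface of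
constant mean curvature `H` in the exterior Schwarzschild spacetime of mass `M`. -/
structure IsCMCHypersurface (M H : ℝ) (U : Set (Coord 3)) (φ N : Coord 3 → Coord 4) : Prop where
  mass_pos : 0 < M
  smooth : ContDiffOn ℝ ∞ φ U
  injective : InjOn φ U
  exterior : ∀ x ∈ U, 2 * M < areaRadius (φ x)
  spacelike : ∀ x ∈ U, (inducedMetric (schwarzschild M) φ x).PosDef
  normal : ∀ x ∈ U, IsFutureUnitNormal (schwarzschild M) φ x (N x)
  cmc : ∀ x ∈ U, traceCoord (inducedMetric (schwarzschild M) φ)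
    (extrinsicCurvature (schwarzschild M) φ N) x = H

/-- The hypersurface `t = f(r)` reaches null infinity: as `r → ∞`, the retarded time `t - r*`
(future null infinity, `ε = 1`) or the advanced time `t + r*` (past null infinity, `ε = -1`) tends
to a finite limit, where `r* = r + 2M log (r/(2M) - 1)`. -/
def ReachesNullInfinity (M : ℝ) (f : ℝ → ℝ) : Prop :=
  ∃ ε u : ℝ, (ε = 1 ∨ ε = -1) ∧
    Tendsto (fun r => f r - ε * (r + 2 * M * Real.log (r / (2 * M) - 1))) atTop (𝓝 u)

/-! ## Asymptotically flat 3-manifolds and initial data -/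

section Manifold

variable (S : Type*) [TopologicalSpace S] [ChartedSpace (Coord 3) S]

/-- The charts `e i` are diffeomorphisms from finitely many pairwise disjoint open subsets of `S`,
which together make up the complement of the compact set `C`, onto open subsets of `ℝ³`. -/
structure IsEndSystem (C : Set S) {n : ℕ} (e : Fin n → OpenPartialHomeomorph S (Coord 3)) :
    Prop where
  compact : IsCompact C
  smooth : ∀ i, e i ∈ IsManifold.maximalAtlas (𝓡 3) ∞ S
  disjoint : Pairwise fun i j => Disjoint (e i).source (e j).source
  cover : ⋃ i, (e i).source = Cᶜ

/-- For some compact `C`, the complement of `C` has finitely many components, each of which is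
diffeomorphic to `ℝ³` minus a ball. -/
def IsAsymptoticallyFlat : Prop :=
  ∃ (C : Set S) (n : ℕ) (e : Fin n → OpenPartialHomeomorph S (Coord 3)),
    IsEndSystem S C e ∧ ∀ i, (e i).target = (Metric.closedBall 0 1)ᶜ

/-- A smooth Riemannian metric on `S`. -/
abbrev SmoothMetric [IsManifold (𝓡 3) ∞ S] :=
  ContMDiffRiemannianMetric (𝓡 3) ∞ (Coord 3) (fun x : S => TangentSpace (𝓡 3) x)

variable {S}

/-- The components `b(∂ᵢ, ∂ⱼ)` of a field of bilinear forms in the chart `e`, as functions on the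
target of `e`. -/
def chartComponents (b : ∀ x : S, TangentSpace (𝓡 3) x →L[ℝ] TangentSpace (𝓡 3) x →L[ℝ] ℝ)
    (e : OpenPartialHomeomorph S (Coord 3)) (y : Coord 3) : Matrix (Fin 3) (Fin 3) ℝ :=
  Matrix.of fun i j => b (e.symm y)
    (mfderiv (𝓡 3) (𝓡 3) e.symm y (EuclideanSpace.single i (1 : ℝ) : Coord 3))
    (mfderiv (𝓡 3) (𝓡 3) e.symm y (EuclideanSpace.single j (1 : ℝ) : Coord 3))

/-- The components `vᵃ` of a vector field in the chart `e`. -/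
def chartVector (v : ∀ x : S, TangentSpace (𝓡 3) x)
    (e : OpenPartialHomeomorph S (Coord 3)) (y : Coord 3) : Coord 3 :=
  mfderiv (𝓡 3) (𝓡 3) e (e.symm y) (v (e.symm y))

/-- `γ : ℝ → S` is a geodesic of `g` (defined for all times, affinely parametrized): in every smooth
chart, `c̈ᵏ + Γᵏᵢⱼ ċⁱ ċʲ = 0`. -/
def IsGeodesic [IsManifold (𝓡 3) ∞ S] (g : SmoothMetric S) (γ : ℝ → S) : Prop :=
  ContMDiff 𝓘(ℝ, ℝ) (𝓡 3) ∞ γ ∧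
  ∀ e ∈ IsManifold.maximalAtlas (𝓡 3) ∞ S, ∀ t : ℝ, γ t ∈ e.source → ∀ k : Fin 3,
    deriv (fun s => deriv (fun r => e (γ r) k) s) t
      + ∑ i, ∑ j, christoffel (chartComponents g.inner e) k i j (e (γ t))
          * deriv (fun r => e (γ r) i) t * deriv (fun r => e (γ r) j) t = 0

/-- Geodesic completeness: for every tangent vector `w` there is a geodesic defined on all of `ℝ`
whose velocity at time `0` is `w`. -/
def IsGeodesicallyComplete [IsManifold (𝓡 3) ∞ S] (g : SmoothMetric S) : Prop :=
  ∀ w : TangentBundle (𝓡 3) S, ∃ γ : ℝ → S, IsGeodesic g γ ∧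
    (⟨γ 0, mfderiv 𝓘(ℝ, ℝ) (𝓡 3) γ 0 (1 : ℝ)⟩ : TangentBundle (𝓡 3) S) = w

variable (S)

/-- A smooth initial data set for the Einstein equations on `S`: a Riemannian metric `g`, a
symmetric tensor `p`, an energy density `ρ` and a momentum density `J` satisfying the Hamiltonian
and the momentum constraint (in every smooth chart). -/
structure InitialData [IsManifold (𝓡 3) ∞ S] where
  /-- The metric. -/
  g : SmoothMetric S
  /-- The extrinsic curvature. -/
  p : ∀ x : S, TangentSpace (𝓡 3) x →L[ℝ] TangentSpace (𝓡 3) x →L[ℝ] ℝ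
  /-- The energy density. -/
  ρ : S → ℝ
  /-- The momentum density. -/
  J : ∀ x : S, TangentSpace (𝓡 3) x
  p_symm : ∀ (x : S) (v w : TangentSpace (𝓡 3) x), p x v w = p x w v
  p_smooth : ContMDiff (𝓡 3) ((𝓡 3).prod 𝓘(ℝ, Coord 3 →L[ℝ] Coord 3 →L[ℝ] ℝ)) ∞
    (fun x => TotalSpace.mk' (Coord 3 →L[ℝ] Coord 3 →L[ℝ] ℝ)
      (E := fun x : S => TangentSpace (𝓡 3) x →L[ℝ] TangentSpace (𝓡 3) x →L[ℝ] ℝ) x (p x))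
  ρ_smooth : ContMDiff (𝓡 3) 𝓘(ℝ, ℝ) ∞ ρ
  J_smooth : ContMDiff (𝓡 3) (𝓡 3).tangent ∞ (fun x => (⟨x, J x⟩ : TangentBundle (𝓡 3) S))
  hamiltonian : ∀ e ∈ IsManifold.maximalAtlas (𝓡 3) ∞ S, ∀ y ∈ e.target,
    scalarCoord (chartComponents g.inner e) y
      - normSqCoord (chartComponents g.inner e) (chartComponents p e) y
      + traceCoord (chartComponents g.inner e) (chartComponents p e) y ^ 2
      = 16 * Real.pi * ρ (e.symm y)
  momentum : ∀ e ∈ IsManifold.maximalAtlas (𝓡 3) ∞ S, ∀ y ∈ e.target, ∀ a : Fin 3,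
    momentumDiv (chartComponents g.inner e) (chartComponents p e) a y
      = 8 * Real.pi * chartVector J e y a

variable {S} [IsManifold (𝓡 3) ∞ S]

/-- The data are physically reasonable: smooth (part of `InitialData`), geodesically complete, and
subject to the local energy condition `ρ ≥ √(Jₐ Jᵃ)`. -/
structure InitialData.IsPhysicallyReasonable (d : InitialData S) : Prop where
  complete : IsGeodesicallyComplete d.g
  energy : ∀ x : S, Real.sqrt (d.g.inner x (d.J x) (d.J x)) ≤ d.ρ x

/-- The mean curvature `p = pₐᵃ` is equal to `H` everywhere. -/
def InitialData.HasMeanCurvature (d : InitialData S) (H : ℝ) : Prop :=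
  ∀ e ∈ IsManifold.maximalAtlas (𝓡 3) ∞ S, ∀ y ∈ e.target,
    traceCoord (chartComponents d.g.inner e) (chartComponents d.p e) y = H

/-- On the domain of the chart `e`, which is mapped onto `{|x| > R}`, the data `(g, p)` are those of
a spherically symmetric, totally umbilic hypersurface `t = f(r)`, `r > R`, with constant mean
curvature `H` in a Schwarzschild spacetime of positive mass, and this hypersurface reaches null
infinity. -/
def InitialData.IsSchwarzschildCMCEnd (d : InitialData S) (H : ℝ)
    (e : OpenPartialHomeomorph S (Coord 3)) : Prop :=
  ∃ (M R : ℝ) (f : ℝ → ℝ) (N : Coord 3 → Coord 4),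
    e.target = {x | R < ‖x‖} ∧ 2 * M < R ∧
    IsCMCHypersurface M H {x | R < ‖x‖} (radialGraph f) N ∧
    ReachesNullInfinity M f ∧
    ∀ x : Coord 3, R < ‖x‖ →
      chartComponents d.g.inner e x = inducedMetric (schwarzschild M) (radialGraph f) x ∧
      chartComponents d.p e x = extrinsicCurvature (schwarzschild M) (radialGraph f) N x ∧
      chartComponents d.p e x = (H / 3) • chartComponents d.g.inner e x

/-- Asymptotically null data with constant mean curvature `H`: outside a compact set the manifold
consists of finitely many ends on each of which the data are those of a hypersurface of constant
mean curvature `H` in a Schwarzschild spacetime that reaches null infinity. -/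
def InitialData.IsAsymptoticallyNull (d : InitialData S) (H : ℝ) : Prop :=
  ∃ (C : Set S) (n : ℕ) (e : Fin n → OpenPartialHomeomorph S (Coord 3)),
    IsEndSystem S C e ∧ ∀ i, d.IsSchwarzschildCMCEnd H (e i)

end Manifold

end

/-!
The data are totally umbilic with vanishing momentum density: `p = -κ g` and `J = 0`, for a large
constant `κ > 0`, so that the mean curvature is `H = -3κ`. Since `g` is parallel, the momentum
constraint holds for every metric `g` (`IsMetricOn.momentumDiv_smul`). The Hamiltonian constraint
merely defines `16πρ = R + 6κ²`, and the energy condition becomes `R ≥ -6κ²`. It remains to find a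
complete metric `g` with this lower bound on its scalar curvature, equal on each end to the metric
induced on an umbilic hypersurface of a Schwarzschild spacetime.

Such a hypersurface is `t = f(r)` with `f' = κ r / (V λ)`, `V = 1 - 2M/r`, `λ² = V + κ² r²`. Its
induced metric is `λ⁻² dr² + r² dΩ²`, its second fundamental form is `-κ` times that metric, and
`f' - 1/V = -1 / (λ (λ + κ r))` is integrable, so that the retarded time `f - r*` converges
(`umbilic_isCMCHypersurface`, `umbilicHeight_reachesNullInfinity`). A metric
`(1 - β(r²) r²)⁻¹ dr² + r² dΩ²` has scalar curvature `6β + 4 r² β'`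
(`IsProfileOn.scalar_radial`). On each end this is interpolated between `β = 0` (flat space, `r ≤ 2`)
and `β = 2M/r³ - κ²` (`r ≥ 3`) by `r³ β = κ² (θ(r³) - r³)`, where `θ` is nondecreasing,
`θ(u) = u` for `u ≤ 8` and `θ` is constant for `u ≥ 9`. Then `R = -6κ² + 6κ² θ' ≥ -6κ²`
(`endProfile_scalar`), and the mass at infinity is positive. In the interior a partition of unity
gives a metric which is flat on the inner parts of the ends
(`IsProperEndSystem.exists_flat_metric`); its scalar curvature is bounded below on a compact set,
by `-6κ²` if `κ` is chosen large.

The definition of asymptotic flatness does not say which side of a spherical shell is at infinity: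
an end may close up in the manifold as `|x| → ∞` (as for the sphere), or have infinity on the side of
the inner sphere too (as for `S² × ℝ`). Therefore both sides of every shell are first treated as
possible ends, and those that close up are discarded (`exists_weakEndSystem`,
`IsWeakEndSystem.exists_proper`).

Completeness follows from a function with compact sublevel sets and bounded gradient
(`isGeodesicallyComplete_of_gradientBound`): geodesics have constant speed, so they remain in a
compact set during any bounded time, and there they can be continued by steps of uniform length. On
the ends `log (1 + (r² - 4)²)` is such a function, as the radial part of the metric is at least
`(1 + κ² r²)⁻¹ dr²`. As the definitions are in terms of charts, the scalar curvature and the geodesic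
equation are shown to be invariant under changes of coordinates (`IsIsometryOn.scalarCoord_eq`,
`SolvesGeodesic.transform`).
-/

/-! ### Tensor calculus in coordinates -/

section CoordCalculus

open scoped Matrix

variable {n : ℕ}

lemma sum_single_coord (v : Coord n) :
    ∑ i, v i • (EuclideanSpace.single i (1 : ℝ) : Coord n) = v := by
  ext j
  simp [Pi.single_apply]

lemma fderiv_eq_sum_pderiv (f : Coord n → ℝ) (x v : Coord n) :
    fderiv ℝ f x v = ∑ i, v i * pderiv i f x := by
  conv_lhs => rw [← sum_single_coord v]
  simp [pderiv]

lemma pderiv_congr {f g : Coord n → ℝ} {x : Coord n} (h : f =ᶠ[𝓝 x] g) (i : Fin n) :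
    pderiv i f x = pderiv i g x := by
  simp only [pderiv, h.fderiv_eq]

lemma ContDiffOn.pderiv {f : Coord n → ℝ} {U : Set (Coord n)} (hU : IsOpen U)
    (hf : ContDiffOn ℝ ∞ f U) (i : Fin n) : ContDiffOn ℝ ∞ (pderiv i f) U :=
  (hf.fderiv_of_isOpen hU (by simp)).clm_apply contDiffOn_const

lemma ContDiffOn.differentiableAt_of_isOpen {f : Coord n → ℝ} {U : Set (Coord n)} (hU : IsOpen U)
    (hf : ContDiffOn ℝ ∞ f U) {x : Coord n} (hx : x ∈ U) : DifferentiableAt ℝ f x :=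
  (hf.contDiffAt (hU.mem_nhds hx)).differentiableAt (by simp)

lemma pderiv_const (i : Fin n) (c : ℝ) (x : Coord n) : pderiv i (fun _ => c) x = 0 := by
  simp [pderiv]

lemma pderiv_coord (i j : Fin n) (x : Coord n) :
    pderiv i (fun y : Coord n => y j) x = if i = j then 1 else 0 := by
  have h := (PiLp.hasFDerivAt_apply (𝕜 := ℝ) (E := fun _ : Fin n => ℝ) 2 x j).fderiv
  simp [pderiv, h, eq_comm]

lemma pderiv_add {f g : Coord n → ℝ} {x : Coord n} (hf : DifferentiableAt ℝ f x)
    (hg : DifferentiableAt ℝ g x) (i : Fin n) :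
    pderiv i (fun y => f y + g y) x = pderiv i f x + pderiv i g x := by
  simp only [pderiv, fderiv_fun_add hf hg, _root_.add_apply]

lemma pderiv_mul {f g : Coord n → ℝ} {x : Coord n} (hf : DifferentiableAt ℝ f x)
    (hg : DifferentiableAt ℝ g x) (i : Fin n) :
    pderiv i (fun y => f y * g y) x = pderiv i f x * g x + f x * pderiv i g x := by
  simp only [pderiv, fderiv_fun_mul hf hg, _root_.add_apply,
    _root_.smul_apply, smul_eq_mul]
  ring

lemma pderiv_const_mul {f : Coord n → ℝ} {x : Coord n} (c : ℝ)
    (hf : DifferentiableAt ℝ f x) (i : Fin n) :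
    pderiv i (fun y => c * f y) x = c * pderiv i f x := by
  rw [pderiv_mul (by fun_prop) hf, pderiv_const]; ring

lemma pderiv_sum {ι : Type*} (s : Finset ι) {f : ι → Coord n → ℝ} {x : Coord n}
    (hf : ∀ a ∈ s, DifferentiableAt ℝ (f a) x) (i : Fin n) :
    pderiv i (fun y => ∑ a ∈ s, f a y) x = ∑ a ∈ s, pderiv i (f a) x := by
  simp only [pderiv, fderiv_fun_sum hf, _root_.sum_apply]

lemma pderiv_scalar_comp {f : Coord n → ℝ} {h : ℝ → ℝ} {x : Coord n} {h' : ℝ}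
    (hh : HasDerivAt h h' (f x)) (hf : DifferentiableAt ℝ f x) (i : Fin n) :
    pderiv i (fun y => h (f y)) x = h' * pderiv i f x := by
  have := (hh.comp_hasFDerivAt x hf.hasFDerivAt).fderiv
  simp only [Function.comp_def] at this
  simp [pderiv, this]

lemma fderiv_coord_apply {m : ℕ} {φ : Coord n → Coord m} {x : Coord n}
    (hφ : DifferentiableAt ℝ φ x) (v : Coord n) (a : Fin m) :
    (fderiv ℝ φ x v) a = fderiv ℝ (fun y => φ y a) x v := by
  have h := ((PiLp.hasFDerivAt_apply (𝕜 := ℝ) (E := fun _ : Fin m => ℝ) 2 (φ x) a).comp x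
    hφ.hasFDerivAt).fderiv
  simp only [Function.comp_def] at h
  rw [h]
  simp

/-- The chain rule for partial derivatives. -/
lemma pderiv_comp {m : ℕ} {f : Coord m → ℝ} {φ : Coord n → Coord m} {x : Coord n}
    (hf : DifferentiableAt ℝ f (φ x)) (hφ : DifferentiableAt ℝ φ x) (i : Fin n) :
    pderiv i (fun y => f (φ y)) x
      = ∑ a, pderiv i (fun y => φ y a) x * pderiv a f (φ x) := by
  have h := fderiv_comp x hf hφ
  simp only [Function.comp_def] at h
  simp only [pderiv, h, ContinuousLinearMap.comp_apply]
  rw [fderiv_eq_sum_pderiv]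
  simp only [fderiv_coord_apply hφ, pderiv]

lemma contDiffOn_coord_iff {m : ℕ} {φ : Coord n → Coord m} {U : Set (Coord n)} :
    ContDiffOn ℝ ∞ φ U ↔ ∀ a, ContDiffOn ℝ ∞ (fun y => φ y a) U :=
  contDiffOn_euclidean

/-- Partial derivatives of a smooth function commute. -/
lemma pderiv_comm {f : Coord n → ℝ} {U : Set (Coord n)} (hU : IsOpen U)
    (hf : ContDiffOn ℝ ∞ f U) {x : Coord n} (hx : x ∈ U) (i j : Fin n) :
    pderiv i (pderiv j f) x = pderiv j (pderiv i f) x := by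
  have hfx : ContDiffAt ℝ ∞ f x := hf.contDiffAt (hU.mem_nhds hx)
  have hs : IsSymmSndFDerivAt ℝ f x := hfx.isSymmSndFDerivAt (by simp; exact ENat.LEInfty.out)
  have hd : DifferentiableAt ℝ (fderiv ℝ f) x :=
    (hfx.fderiv_right (m := ∞) (by simp)).differentiableAt (by simp)
  have key : ∀ a b : Fin n, pderiv a (pderiv b f) x
      = fderiv ℝ (fderiv ℝ f) x (EuclideanSpace.single a 1) (EuclideanSpace.single b 1) := by
    intro a b
    have : pderiv b f = fun y => fderiv ℝ f y (EuclideanSpace.single b 1) := rfl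
    rw [this, pderiv, fderiv_clm_apply hd (by fun_prop)]
    simp
  rw [key, key]
  exact hs _ _

/-- `G` is a smooth field of symmetric invertible matrices on the open set `U`, that is, a
pseudo-Riemannian metric in coordinates. -/
structure IsMetricOn (G : Coord n → Matrix (Fin n) (Fin n) ℝ) (U : Set (Coord n)) : Prop where
  isOpen : IsOpen U
  smooth : ∀ i j, ContDiffOn ℝ ∞ (fun y => G y i j) U
  symm : ∀ y ∈ U, ∀ i j, G y i j = G y j i
  det_ne : ∀ y ∈ U, (G y).det ≠ 0

variable {G G' : Coord n → Matrix (Fin n) (Fin n) ℝ} {U U' : Set (Coord n)} {x : Coord n}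

lemma IsMetricOn.mono (h : IsMetricOn G U) {V : Set (Coord n)} (hV : IsOpen V) (hVU : V ⊆ U) :
    IsMetricOn G V :=
  ⟨hV, fun i j => (h.smooth i j).mono hVU, fun y hy => h.symm y (hVU hy),
    fun y hy => h.det_ne y (hVU hy)⟩

lemma IsMetricOn.congr (h : IsMetricOn G U) (hG : ∀ y ∈ U, G' y = G y) : IsMetricOn G' U :=
  ⟨h.isOpen, fun i j => (h.smooth i j).congr fun y hy => by rw [hG y hy],
    fun y hy => by rw [hG y hy]; exact h.symm y hy,
    fun y hy => by rw [hG y hy]; exact h.det_ne y hy⟩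

lemma contDiffOn_matrix_det {M : Coord n → Matrix (Fin n) (Fin n) ℝ}
    (h : ∀ i j, ContDiffOn ℝ ∞ (fun y => M y i j) U) : ContDiffOn ℝ ∞ (fun y => (M y).det) U := by
  simp only [Matrix.det_apply]
  refine ContDiffOn.sum fun σ _ => ContDiffOn.const_smul _ (contDiffOn_prod fun i _ => h _ _)

lemma contDiffOn_matrix_inv {M : Coord n → Matrix (Fin n) (Fin n) ℝ}
    (h : ∀ i j, ContDiffOn ℝ ∞ (fun y => M y i j) U) (hd : ∀ y ∈ U, (M y).det ≠ 0) (i j : Fin n) :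
    ContDiffOn ℝ ∞ (fun y => (M y)⁻¹ i j) U := by
  simp only [Matrix.inv_def, Ring.inverse_eq_inv', Matrix.smul_apply, smul_eq_mul,
    Matrix.adjugate_apply]
  refine ((contDiffOn_matrix_det h).inv hd).mul (contDiffOn_matrix_det fun a b => ?_)
  simp only [Matrix.updateRow_apply]
  split_ifs
  · exact contDiffOn_const
  · exact h a b

lemma IsMetricOn.inv_smooth (h : IsMetricOn G U) (i j : Fin n) :
    ContDiffOn ℝ ∞ (fun y => (G y)⁻¹ i j) U :=
  contDiffOn_matrix_inv h.smooth h.det_ne i j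

lemma IsMetricOn.inv_symm (h : IsMetricOn G U) (hx : x ∈ U) (i j : Fin n) :
    (G x)⁻¹ i j = (G x)⁻¹ j i := by
  have hT : (G x)ᵀ = G x := by ext i j; exact h.symm x hx j i
  have : ((G x)⁻¹)ᵀ = (G x)⁻¹ := by rw [Matrix.transpose_nonsing_inv, hT]
  exact congrFun (congrFun this j) i

lemma IsMetricOn.mul_inv (h : IsMetricOn G U) (hx : x ∈ U) : G x * (G x)⁻¹ = 1 :=
  Matrix.mul_nonsing_inv _ (h.det_ne x hx).isUnit

lemma IsMetricOn.inv_mul (h : IsMetricOn G U) (hx : x ∈ U) : (G x)⁻¹ * G x = 1 :=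
  Matrix.nonsing_inv_mul _ (h.det_ne x hx).isUnit

lemma IsMetricOn.differentiableAt (h : IsMetricOn G U) (hx : x ∈ U) (i j : Fin n) :
    DifferentiableAt ℝ (fun y => G y i j) x :=
  (h.smooth i j).differentiableAt_of_isOpen h.isOpen hx

lemma IsMetricOn.pderiv_symm (h : IsMetricOn G U) (hx : x ∈ U) (k i j : Fin n) :
    pderiv k (fun y => G y i j) x = pderiv k (fun y => G y j i) x :=
  pderiv_congr (eventually_of_mem (h.isOpen.mem_nhds hx) fun y hy => h.symm y hy i j) k

lemma IsMetricOn.christoffel_smooth (h : IsMetricOn G U) (k i j : Fin n) :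
    ContDiffOn ℝ ∞ (christoffel G k i j) U := by
  unfold christoffel
  refine contDiffOn_const.mul (ContDiffOn.sum fun l _ => (h.inv_smooth k l).mul ?_)
  exact (((h.smooth _ _).pderiv h.isOpen _).add ((h.smooth _ _).pderiv h.isOpen _)).sub
    ((h.smooth _ _).pderiv h.isOpen _)

lemma IsMetricOn.christoffel_symm (h : IsMetricOn G U) (hx : x ∈ U) (k i j : Fin n) :
    christoffel G k i j x = christoffel G k j i x := by
  unfold christoffel
  congr 1
  refine Finset.sum_congr rfl fun l _ => ?_
  rw [h.pderiv_symm hx l i j]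
  ring

/-- Lowering the upper index of the Christoffel symbols gives those of the first kind. -/
lemma IsMetricOn.lower_christoffel (h : IsMetricOn G U) (hx : x ∈ U) (m i j : Fin n) :
    ∑ k, G x m k * christoffel G k i j x = (1 / 2) *
      (pderiv i (fun y => G y m j) x + pderiv j (fun y => G y m i) x
        - pderiv m (fun y => G y i j) x) := by
  simp only [christoffel]
  set D : Fin n → ℝ := fun l => pderiv i (fun y => G y l j) x + pderiv j (fun y => G y l i) x
        - pderiv l (fun y => G y i j) x with hD
  have : ∑ k, G x m k * (1 / 2 * ∑ l, (G x)⁻¹ k l * D l)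
      = (1 / 2) * ((G x) *ᵥ ((G x)⁻¹ *ᵥ D)) m := by
    simp only [Matrix.mulVec, dotProduct, Finset.mul_sum]
    refine Finset.sum_congr rfl fun k _ => Finset.sum_congr rfl fun l _ => ?_
    ring
  rw [this, Matrix.mulVec_mulVec, h.mul_inv hx, Matrix.one_mulVec]

/-- The Levi-Civita connection is compatible with the metric. -/
lemma IsMetricOn.pderiv_metric (h : IsMetricOn G U) (hx : x ∈ U) (k i j : Fin n) :
    pderiv k (fun y => G y i j) x
      = ∑ m, G x i m * christoffel G m k j x + ∑ m, G x j m * christoffel G m k i x := by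
  rw [h.lower_christoffel hx, h.lower_christoffel hx, h.pderiv_symm hx k j i,
    h.pderiv_symm hx j i k, h.pderiv_symm hx i j k]
  ring

/-- The partial derivatives of a matrix-valued function, entrywise. -/
noncomputable def matrixPderiv {m l : ℕ} (k : Fin n) (M : Coord n → Matrix (Fin m) (Fin l) ℝ)
    (x : Coord n) : Matrix (Fin m) (Fin l) ℝ :=
  Matrix.of fun i j => pderiv k (fun y => M y i j) x

lemma matrixPderiv_mul {m l p : ℕ} {M : Coord n → Matrix (Fin m) (Fin l) ℝ}
    {N : Coord n → Matrix (Fin l) (Fin p) ℝ}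
    (hM : ∀ i j, DifferentiableAt ℝ (fun y => M y i j) x)
    (hN : ∀ i j, DifferentiableAt ℝ (fun y => N y i j) x) (k : Fin n) :
    matrixPderiv k (fun y => M y * N y) x
      = matrixPderiv k M x * N x + M x * matrixPderiv k N x := by
  ext i j
  simp only [matrixPderiv, Matrix.of_apply, Matrix.mul_apply, Matrix.add_apply]
  rw [pderiv_sum (f := fun a y => M y i a * N y a j) _ (fun a _ => (hM i a).mul (hN a j)),
    ← Finset.sum_add_distrib]
  exact Finset.sum_congr rfl fun a _ => pderiv_mul (hM i a) (hN a j) k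

lemma matrixPderiv_congr {m l : ℕ} {M N : Coord n → Matrix (Fin m) (Fin l) ℝ}
    (h : M =ᶠ[𝓝 x] N) (k : Fin n) : matrixPderiv k M x = matrixPderiv k N x := by
  ext i j
  exact pderiv_congr (h.mono fun y hy => by simp [hy]) k

/-- The inverse metric is parallel as well. -/
lemma IsMetricOn.pderiv_inv (h : IsMetricOn G U) (hx : x ∈ U) (k i j : Fin n) :
    pderiv k (fun y => (G y)⁻¹ i j) x
      = -(∑ m, christoffel G i k m x * (G x)⁻¹ m j + ∑ m, christoffel G j k m x * (G x)⁻¹ m i) := by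
  -- differentiate `G * G⁻¹ = 1`, with `∂ₖ G = G A + (G A)ᵀ`
  set A : Matrix (Fin n) (Fin n) ℝ := Matrix.of fun a b => christoffel G a k b x with hA
  have hT : (G x)ᵀ = G x := by ext i j; exact h.symm x hx j i
  have hTi : ((G x)⁻¹)ᵀ = (G x)⁻¹ := by rw [Matrix.transpose_nonsing_inv, hT]
  have hdG : matrixPderiv k G x = G x * A + (G x * A)ᵀ := by
    ext a b
    simp only [matrixPderiv, Matrix.of_apply, Matrix.add_apply, Matrix.mul_apply,
      Matrix.transpose_apply, hA, h.pderiv_metric hx]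
  have hdinv : ∀ a b, DifferentiableAt ℝ (fun y => (G y)⁻¹ a b) x := fun a b =>
    (h.inv_smooth a b).differentiableAt_of_isOpen h.isOpen hx
  have h1 : matrixPderiv k (fun y => G y * (G y)⁻¹) x = 0 := by
    rw [matrixPderiv_congr (N := fun _ => 1)
      (eventually_of_mem (h.isOpen.mem_nhds hx) fun y hy => h.mul_inv hy)]
    ext a b
    simp [matrixPderiv, pderiv_const]
  rw [matrixPderiv_mul (fun a b => h.differentiableAt hx a b) hdinv, hdG] at h1
  have h2 : matrixPderiv k (fun y => (G y)⁻¹) x = -(A * (G x)⁻¹ + (A * (G x)⁻¹)ᵀ) := by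
    have h3 := congrArg (fun M => (G x)⁻¹ * M) h1
    simp only [Matrix.mul_add, Matrix.mul_zero, ← Matrix.mul_assoc, h.inv_mul hx,
      Matrix.one_mul, Matrix.add_mul, Matrix.transpose_mul, hT] at h3
    rw [Matrix.mul_assoc _ (G x) (G x)⁻¹, h.mul_inv hx, Matrix.mul_one] at h3
    rw [Matrix.transpose_mul, hTi, eq_comm, neg_eq_iff_add_eq_zero]
    exact h3
  have h4 := congrFun (congrFun h2 i) j
  simp only [matrixPderiv, Matrix.of_apply, Matrix.neg_apply, Matrix.add_apply, Matrix.mul_apply,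
    Matrix.transpose_apply, hA] at h4
  exact h4

lemma IsMetricOn.sum_inv_mul (h : IsMetricOn G U) (hx : x ∈ U) (a b : Fin n) :
    ∑ d, (G x)⁻¹ a d * G x d b = if a = b then 1 else 0 := by
  have := congrFun (congrFun (h.inv_mul hx) a) b
  rwa [Matrix.mul_apply, Matrix.one_apply] at this

lemma IsMetricOn.traceCoord_smul (h : IsMetricOn G U) (hx : x ∈ U)
    {P : Coord n → Matrix (Fin n) (Fin n) ℝ} {c : ℝ} (hP : P x = c • G x) :
    traceCoord G P x = n * c := by
  simp only [traceCoord, hP, Matrix.smul_apply, smul_eq_mul]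
  have : ∀ a : Fin n, ∑ b, (G x)⁻¹ a b * (c * G x a b) = c := by
    intro a
    have h1 := h.sum_inv_mul hx a a
    simp only [if_true] at h1
    calc ∑ b, (G x)⁻¹ a b * (c * G x a b) = c * ∑ b, (G x)⁻¹ a b * G x b a := by
          rw [Finset.mul_sum]
          exact Finset.sum_congr rfl fun b _ => by rw [h.symm x hx a b]; ring
      _ = c := by rw [h1, mul_one]
  simp [this]

lemma IsMetricOn.raiseCoord_smul (h : IsMetricOn G U) (hx : x ∈ U)
    {P : Coord n → Matrix (Fin n) (Fin n) ℝ} {c : ℝ} (hP : P x = c • G x) (a b : Fin n) :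
    raiseCoord G P a b x = c * (G x)⁻¹ a b := by
  simp only [raiseCoord, hP, Matrix.smul_apply, smul_eq_mul]
  have : ∀ e : Fin n, ∑ d, (G x)⁻¹ a e * (G x)⁻¹ b d * (c * G x e d)
      = c * ((G x)⁻¹ a e * if b = e then 1 else 0) := by
    intro e
    rw [← h.sum_inv_mul hx b e, Finset.mul_sum, Finset.mul_sum]
    exact Finset.sum_congr rfl fun d _ => by rw [h.symm x hx e d]; ring
  simp [this]

lemma IsMetricOn.normSqCoord_smul (h : IsMetricOn G U) (hx : x ∈ U)
    {P : Coord n → Matrix (Fin n) (Fin n) ℝ} {c : ℝ} (hP : P x = c • G x) :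
    normSqCoord G P x = n * c ^ 2 := by
  have h1 := h.traceCoord_smul hx hP
  have : normSqCoord G P x = c * traceCoord G P x := by
    simp only [normSqCoord, h.raiseCoord_smul hx hP, traceCoord, Finset.mul_sum]
    exact Finset.sum_congr rfl fun a _ => Finset.sum_congr rfl fun b _ => by ring
  rw [this, h1]; ring

/-- A constant multiple of the metric satisfies the vacuum momentum constraint. -/
lemma IsMetricOn.momentumDiv_smul (h : IsMetricOn G U) (hx : x ∈ U)
    {P : Coord n → Matrix (Fin n) (Fin n) ℝ} {c : ℝ} (hP : ∀ y ∈ U, P y = c • G y) (a : Fin n) :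
    momentumDiv G P a x = 0 := by
  have hm : ∀ y ∈ U, ∀ i j, momentumTensor G P i j y = (c - n * c) * (G y)⁻¹ i j := by
    intro y hy i j
    rw [momentumTensor, h.raiseCoord_smul hy (hP y hy), h.traceCoord_smul hy (hP y hy)]
    ring
  have hd : ∀ i j, DifferentiableAt ℝ (fun y => (G y)⁻¹ i j) x := fun i j =>
    (h.inv_smooth i j).differentiableAt_of_isOpen h.isOpen hx
  simp only [momentumDiv]
  refine Finset.sum_eq_zero fun b _ => ?_
  rw [pderiv_congr (eventually_of_mem (h.isOpen.mem_nhds hx) fun y hy => hm y hy a b),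
    pderiv_const_mul _ (hd a b), h.pderiv_inv hx]
  simp only [hm x hx, Finset.sum_add_distrib]
  have e1 : ∀ i : Fin n, ∑ m, christoffel G i b m x * ((c - n * c) * (G x)⁻¹ m b)
      = (c - n * c) * ∑ m, christoffel G i b m x * (G x)⁻¹ m b := fun i => by
    rw [Finset.mul_sum]; exact Finset.sum_congr rfl fun _ _ => by ring
  have e2 : ∑ m, christoffel G b b m x * ((c - n * c) * (G x)⁻¹ a m)
      = (c - n * c) * ∑ m, christoffel G b b m x * (G x)⁻¹ m a := by
    rw [Finset.mul_sum]
    exact Finset.sum_congr rfl fun m _ => by rw [h.inv_symm hx a m]; ring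
  rw [e1, e2]
  ring

lemma IsMetricOn.ricciCoord_smooth (h : IsMetricOn G U) (i j : Fin n) :
    ContDiffOn ℝ ∞ (ricciCoord G i j) U := by
  unfold ricciCoord
  have hc := h.christoffel_smooth
  refine ContDiffOn.sum fun k _ => ?_
  refine (((hc _ _ _).pderiv h.isOpen _).sub ((hc _ _ _).pderiv h.isOpen _)).add
    (ContDiffOn.sum fun l _ => ?_)
  exact ((hc _ _ _).mul (hc _ _ _)).sub ((hc _ _ _).mul (hc _ _ _))

lemma IsMetricOn.scalarCoord_smooth (h : IsMetricOn G U) : ContDiffOn ℝ ∞ (scalarCoord G) U := by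
  unfold scalarCoord
  exact ContDiffOn.sum fun i _ => ContDiffOn.sum fun j _ =>
    (h.inv_smooth i j).mul (h.ricciCoord_smooth i j)

/-! Curvature quantities at a point depend only on the germ of the metric. -/

lemma christoffel_congr (h : G =ᶠ[𝓝 x] G') (k i j : Fin n) :
    christoffel G k i j x = christoffel G' k i j x := by
  have hp : ∀ a b c, pderiv a (fun y => G y b c) x = pderiv a (fun y => G' y b c) x :=
    fun a b c => pderiv_congr (h.mono fun y hy => by simp [hy]) a
  simp only [christoffel, hp, h.self_of_nhds]

lemma ricciCoord_congr (h : G =ᶠ[𝓝 x] G') (i j : Fin n) :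
    ricciCoord G i j x = ricciCoord G' i j x := by
  have hc : ∀ a b c, christoffel G a b c =ᶠ[𝓝 x] christoffel G' a b c := fun a b c =>
    h.eventually_nhds.mono fun y hy => christoffel_congr hy a b c
  simp only [ricciCoord, fun a b c => (hc a b c).self_of_nhds,
    fun a b c d => pderiv_congr (hc a b c) d]

lemma scalarCoord_congr (h : G =ᶠ[𝓝 x] G') : scalarCoord G x = scalarCoord G' x := by
  simp only [scalarCoord, h.self_of_nhds, ricciCoord_congr h]

end CoordCalculus

/-! ### Behaviour under a change of coordinates -/

section ChangeOfCoordinates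

open scoped Matrix

variable {n : ℕ}

/-- The Jacobian matrix `∂φᵃ/∂xⁱ` (row `a`, column `i`). -/
noncomputable def jacobianMatrix (φ : Coord n → Coord n) (x : Coord n) :
    Matrix (Fin n) (Fin n) ℝ :=
  Matrix.of fun a i => pderiv i (fun y => φ y a) x

/-- `φ` is a smooth map from `U` to `U'` under which the metric `G'` pulls back to `G`. -/
structure IsIsometryOn (G G' : Coord n → Matrix (Fin n) (Fin n) ℝ) (U U' : Set (Coord n))
    (φ : Coord n → Coord n) : Prop where
  metric : IsMetricOn G U
  metric' : IsMetricOn G' U'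
  smooth : ContDiffOn ℝ ∞ φ U
  mapsTo : MapsTo φ U U'
  pullback : ∀ y ∈ U, G y = (jacobianMatrix φ y)ᵀ * G' (φ y) * jacobianMatrix φ y

variable {G G' : Coord n → Matrix (Fin n) (Fin n) ℝ} {U U' : Set (Coord n)}
  {φ : Coord n → Coord n} {x : Coord n}

namespace IsIsometryOn

lemma jacobian_smooth (h : IsIsometryOn G G' U U' φ) (a i : Fin n) :
    ContDiffOn ℝ ∞ (fun y => jacobianMatrix φ y a i) U :=
  (contDiffOn_coord_iff.1 h.smooth a).pderiv h.metric.isOpen i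

lemma differentiableAt (h : IsIsometryOn G G' U U' φ) (hx : x ∈ U) : DifferentiableAt ℝ φ x :=
  (h.smooth.contDiffAt (h.metric.isOpen.mem_nhds hx)).differentiableAt (by simp)

lemma differentiableAt_jacobian (h : IsIsometryOn G G' U U' φ) (hx : x ∈ U) (a i : Fin n) :
    DifferentiableAt ℝ (fun y => jacobianMatrix φ y a i) x :=
  (h.jacobian_smooth a i).differentiableAt_of_isOpen h.metric.isOpen hx

lemma det_jacobian (h : IsIsometryOn G G' U U' φ) (hx : x ∈ U) :
    (jacobianMatrix φ x).det ≠ 0 := by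
  intro h0
  apply h.metric.det_ne x hx
  rw [h.pullback x hx, Matrix.det_mul, h0, mul_zero]

lemma pderiv_jacobian_symm (h : IsIsometryOn G G' U U' φ) (hx : x ∈ U) (a i j : Fin n) :
    pderiv i (fun y => jacobianMatrix φ y a j) x = pderiv j (fun y => jacobianMatrix φ y a i) x :=
  pderiv_comm h.metric.isOpen (contDiffOn_coord_iff.1 h.smooth a) hx i j

lemma pderiv_comp {f : Coord n → ℝ} (h : IsIsometryOn G G' U U' φ) (hf : ContDiffOn ℝ ∞ f U')
    (hx : x ∈ U) (k : Fin n) :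
    pderiv k (fun y => f (φ y)) x = ∑ c, jacobianMatrix φ x c k * pderiv c f (φ x) :=
  _root_.pderiv_comp (hf.differentiableAt_of_isOpen h.metric'.isOpen (h.mapsTo hx))
    (h.differentiableAt hx) k

lemma differentiableAt_comp {f : Coord n → ℝ} (h : IsIsometryOn G G' U U' φ)
    (hf : ContDiffOn ℝ ∞ f U') (hx : x ∈ U) : DifferentiableAt ℝ (fun y => f (φ y)) x :=
  (hf.differentiableAt_of_isOpen h.metric'.isOpen (h.mapsTo hx)).comp x (h.differentiableAt hx)

/-- The derivative of the pulled back metric. -/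
lemma pderiv_metric (h : IsIsometryOn G G' U U' φ) (hx : x ∈ U) (k i j : Fin n) :
    pderiv k (fun y => G y i j) x =
      (∑ a, ∑ b, ∑ c, pderiv c (fun z => G' z a b) (φ x) *
        (jacobianMatrix φ x a i * jacobianMatrix φ x b j * jacobianMatrix φ x c k))
      + (∑ a, ∑ b, G' (φ x) a b *
        (pderiv k (fun y => jacobianMatrix φ y a i) x * jacobianMatrix φ x b j))
      + ∑ a, ∑ b, G' (φ x) a b *
        (pderiv k (fun y => jacobianMatrix φ y a j) x * jacobianMatrix φ x b i) := by
  have e : (fun y => G y i j) =ᶠ[𝓝 x] fun y => ∑ a, ∑ b,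
      G' (φ y) a b * (jacobianMatrix φ y a i * jacobianMatrix φ y b j) := by
    refine eventually_of_mem (h.metric.isOpen.mem_nhds hx) fun y hy => ?_
    simp only [h.pullback y hy, Matrix.mul_apply, Matrix.transpose_apply, Finset.sum_mul]
    rw [Finset.sum_comm]
    exact Finset.sum_congr rfl fun a _ => Finset.sum_congr rfl fun b _ => by ring
  have hJ := h.differentiableAt_jacobian hx
  have hG' : ∀ a b, DifferentiableAt ℝ (fun y => G' (φ y) a b) x := fun a b =>
    h.differentiableAt_comp (h.metric'.smooth a b) hx
  rw [pderiv_congr e k, pderiv_sum (f := fun a y => ∑ b,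
      G' (φ y) a b * (jacobianMatrix φ y a i * jacobianMatrix φ y b j)) _
    (fun a _ => DifferentiableAt.fun_sum fun b _ => (hG' a b).mul ((hJ a i).mul (hJ b j)))]
  have swap : ∑ a, ∑ b, G' (φ x) a b *
        (pderiv k (fun y => jacobianMatrix φ y a j) x * jacobianMatrix φ x b i)
      = ∑ a, ∑ b, G' (φ x) a b *
        (pderiv k (fun y => jacobianMatrix φ y b j) x * jacobianMatrix φ x a i) := by
    rw [Finset.sum_comm]
    exact Finset.sum_congr rfl fun a _ => Finset.sum_congr rfl fun b _ => by
      rw [h.metric'.symm _ (h.mapsTo hx) a b]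
  rw [swap, ← Finset.sum_add_distrib, ← Finset.sum_add_distrib]
  refine Finset.sum_congr rfl fun a _ => ?_
  rw [pderiv_sum (f := fun b y => G' (φ y) a b * (jacobianMatrix φ y a i * jacobianMatrix φ y b j))
    _ (fun b _ => (hG' a b).mul ((hJ a i).mul (hJ b j))), ← Finset.sum_add_distrib,
    ← Finset.sum_add_distrib]
  refine Finset.sum_congr rfl fun b _ => ?_
  rw [pderiv_mul (hG' a b) ((hJ a i).fun_mul (hJ b j)), pderiv_mul (hJ a i) (hJ b j),
    h.pderiv_comp (h.metric'.smooth a b) hx, Finset.sum_mul, mul_add, ← add_assoc]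
  congr 1
  · congr 1
    exact Finset.sum_congr rfl fun c _ => by ring
  · ring

/-- The transformation law of the Christoffel symbols. -/
lemma christoffel_transform (h : IsIsometryOn G G' U U' φ) (hx : x ∈ U) (a i j : Fin n) :
    ∑ k, jacobianMatrix φ x a k * christoffel G k i j x
      = (∑ b, ∑ c, christoffel G' a b c (φ x) * jacobianMatrix φ x b i * jacobianMatrix φ x c j)
        + pderiv i (fun y => jacobianMatrix φ y a j) x := by
  set J := jacobianMatrix φ x with hJ
  set H : Fin n → Fin n → Fin n → ℝ := fun a i j => pderiv i (fun y => jacobianMatrix φ y a j) x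
    with hH
  have hHs : ∀ a i j, H a i j = H a j i := fun a i j => h.pderiv_jacobian_symm hx a i j
  set L : Fin n → ℝ := fun a => ∑ k, J a k * christoffel G k i j x with hL
  set R : Fin n → ℝ := fun a => (∑ b, ∑ c, christoffel G' a b c (φ x) * J b i * J c j) + H a i j
    with hR
  have hx' := h.mapsTo hx
  -- Both sides agree after lowering the index with the invertible matrix `Jᵀ G'`.
  have key : (Jᵀ * G' (φ x)) *ᵥ L = (Jᵀ * G' (φ x)) *ᵥ R := by
    ext l
    have lhs : ((Jᵀ * G' (φ x)) *ᵥ L) l = ∑ k, G x l k * christoffel G k i j x := by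
      have : L = J *ᵥ fun k => christoffel G k i j x := rfl
      rw [this, Matrix.mulVec_mulVec, ← h.pullback x hx]
      rfl
    have rhs : ((Jᵀ * G' (φ x)) *ᵥ R) l
        = (∑ b, ∑ c, (∑ d, J d l * ∑ a, G' (φ x) d a * christoffel G' a b c (φ x))
            * (J b i * J c j)) + ∑ a, ∑ b, G' (φ x) a b * (H a i j * J b l) := by
      have : (Jᵀ * G' (φ x)) *ᵥ R = Jᵀ *ᵥ (G' (φ x) *ᵥ R) := by rw [Matrix.mulVec_mulVec]
      rw [this]
      simp only [Matrix.mulVec, dotProduct, Matrix.transpose_apply, hR, mul_add,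
        Finset.sum_add_distrib]
      congr 1
      · simp only [Finset.mul_sum, Finset.sum_mul]
        calc _ = ∑ d, ∑ b, ∑ c, ∑ a, J d l *
              (G' (φ x) d a * (christoffel G' a b c (φ x) * J b i * J c j)) := by
              refine Finset.sum_congr rfl fun d _ => ?_
              rw [Finset.sum_comm]
              exact Finset.sum_congr rfl fun b _ => Finset.sum_comm
          _ = _ := by
              rw [Finset.sum_comm]
              refine Finset.sum_congr rfl fun b _ => ?_
              rw [Finset.sum_comm]
              exact Finset.sum_congr rfl fun c _ => Finset.sum_congr rfl fun d _ =>
                Finset.sum_congr rfl fun a _ => by ring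
      · simp only [Finset.mul_sum]
        rw [Finset.sum_comm]
        exact Finset.sum_congr rfl fun b _ => Finset.sum_congr rfl fun c _ => by
          rw [h.metric'.symm _ hx' b c]; ring
    rw [lhs, rhs, h.metric.lower_christoffel hx]
    simp only [h.metric'.lower_christoffel hx']
    rw [h.pderiv_metric hx, h.pderiv_metric hx, h.pderiv_metric hx]
    simp only [← hJ]
    change (1 / 2) * ((∑ a, ∑ b, ∑ c, pderiv c (fun z => G' z a b) (φ x) * (J a l * J b j * J c i))
        + (∑ a, ∑ b, G' (φ x) a b * (H a i l * J b j))
        + (∑ a, ∑ b, G' (φ x) a b * (H a i j * J b l))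
      + ((∑ a, ∑ b, ∑ c, pderiv c (fun z => G' z a b) (φ x) * (J a l * J b i * J c j))
        + (∑ a, ∑ b, G' (φ x) a b * (H a j l * J b i))
        + (∑ a, ∑ b, G' (φ x) a b * (H a j i * J b l)))
      - ((∑ a, ∑ b, ∑ c, pderiv c (fun z => G' z a b) (φ x) * (J a i * J b j * J c l))
        + (∑ a, ∑ b, G' (φ x) a b * (H a l i * J b j))
        + (∑ a, ∑ b, G' (φ x) a b * (H a l j * J b i)))) = _
    simp only [fun a => hHs a l i, fun a => hHs a l j, fun a => hHs a j i]
    have t1 : ∑ b, ∑ c, (∑ d, J d l * (1 / 2 * (pderiv b (fun y => G' y d c) (φ x)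
          + pderiv c (fun y => G' y d b) (φ x) - pderiv d (fun y => G' y b c) (φ x))))
            * (J b i * J c j)
        = (1 / 2) * ((∑ a, ∑ b, ∑ c, pderiv c (fun z => G' z a b) (φ x) * (J a l * J b j * J c i))
          + (∑ a, ∑ b, ∑ c, pderiv c (fun z => G' z a b) (φ x) * (J a l * J b i * J c j))
          - (∑ a, ∑ b, ∑ c, pderiv c (fun z => G' z a b) (φ x) * (J a i * J b j * J c l))) := by
      have r1 : ∑ a, ∑ b, ∑ c, pderiv c (fun z => G' z a b) (φ x) * (J a l * J b j * J c i)
          = ∑ b, ∑ c, ∑ d, pderiv b (fun y => G' y d c) (φ x) * (J d l * J c j * J b i) := by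
        rw [Finset.sum_comm_cycle, Finset.sum_comm_cycle]
        refine Finset.sum_comm.trans (Finset.sum_congr rfl fun b _ => ?_)
        rw [Finset.sum_comm]
      have r2 : ∑ a, ∑ b, ∑ c, pderiv c (fun z => G' z a b) (φ x) * (J a l * J b i * J c j)
          = ∑ b, ∑ c, ∑ d, pderiv c (fun y => G' y d b) (φ x) * (J d l * J b i * J c j) := by
        rw [Finset.sum_comm]
        exact Finset.sum_congr rfl fun b _ => Finset.sum_comm
      rw [r1, r2, ← Finset.sum_add_distrib, ← Finset.sum_sub_distrib, Finset.mul_sum]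
      refine Finset.sum_congr rfl fun b _ => ?_
      rw [← Finset.sum_add_distrib, ← Finset.sum_sub_distrib, Finset.mul_sum]
      refine Finset.sum_congr rfl fun c _ => ?_
      rw [← Finset.sum_add_distrib, ← Finset.sum_sub_distrib, Finset.mul_sum, Finset.sum_mul]
      exact Finset.sum_congr rfl fun d _ => by ring
    rw [t1]
    ring
  have hdet : (Jᵀ * G' (φ x)).det ≠ 0 := by
    rw [Matrix.det_mul, Matrix.det_transpose]
    exact mul_ne_zero (h.det_jacobian hx) (h.metric'.det_ne _ hx')
  have := congrArg (fun v => (Jᵀ * G' (φ x))⁻¹ *ᵥ v) key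
  simp only [Matrix.mulVec_mulVec, Matrix.nonsing_inv_mul _ hdet.isUnit, Matrix.one_mulVec] at this
  exact congrFun this a

end IsIsometryOn

/-- The connection matrices `(A_i)ᵏⱼ = Γᵏᵢⱼ`. -/
noncomputable def connectionMatrix (G : Coord n → Matrix (Fin n) (Fin n) ℝ) (i : Fin n)
    (x : Coord n) : Matrix (Fin n) (Fin n) ℝ :=
  Matrix.of fun k j => christoffel G k i j x

/-- The curvature matrices `F_{mi} = ∂ₘAᵢ - ∂ᵢAₘ + AₘAᵢ - AᵢAₘ`. -/
noncomputable def curvatureMatrix (G : Coord n → Matrix (Fin n) (Fin n) ℝ) (m i : Fin n)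
    (x : Coord n) : Matrix (Fin n) (Fin n) ℝ :=
  matrixPderiv m (connectionMatrix G i) x - matrixPderiv i (connectionMatrix G m) x
    + connectionMatrix G m x * connectionMatrix G i x
    - connectionMatrix G i x * connectionMatrix G m x

lemma IsMetricOn.ricciCoord_eq_curvature (h : IsMetricOn G U) (hx : x ∈ U) (i j : Fin n) :
    ricciCoord G i j x = ∑ k, curvatureMatrix G k j x k i := by
  have hs : ∀ k a b, christoffel G k a b =ᶠ[𝓝 x] christoffel G k b a := fun k a b =>
    eventually_of_mem (h.isOpen.mem_nhds hx) fun y hy => h.christoffel_symm hy k a b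
  simp only [ricciCoord, curvatureMatrix, matrixPderiv, connectionMatrix, Matrix.of_apply,
    Matrix.sub_apply, Matrix.add_apply, Matrix.mul_apply]
  refine Finset.sum_congr rfl fun k _ => ?_
  rw [Finset.sum_sub_distrib, pderiv_congr (hs k i j) k]
  have : ∀ l, christoffel G l i j x = christoffel G l j i x := fun l => h.christoffel_symm hx l i j
  simp only [this]
  ring

namespace IsIsometryOn

lemma differentiableAt_connection (h : IsMetricOn G U) (hx : x ∈ U) (m a b : Fin n) :
    DifferentiableAt ℝ (fun y => connectionMatrix G m y a b) x :=
  (h.christoffel_smooth a m b).differentiableAt_of_isOpen h.isOpen hx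

/-- The transformation law of the connection matrices. -/
lemma connection_transform (h : IsIsometryOn G G' U U' φ) (hx : x ∈ U) (i : Fin n) :
    jacobianMatrix φ x * connectionMatrix G i x
      = (∑ b, jacobianMatrix φ x b i • connectionMatrix G' b (φ x)) * jacobianMatrix φ x
        + matrixPderiv i (jacobianMatrix φ) x := by
  ext a j
  simp only [Matrix.mul_apply, Matrix.add_apply, connectionMatrix, Matrix.of_apply, matrixPderiv,
    Matrix.sum_apply, Matrix.smul_apply, smul_eq_mul]
  rw [h.christoffel_transform hx a i j]
  congr 1
  simp only [Finset.sum_mul]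
  rw [Finset.sum_comm]
  exact Finset.sum_congr rfl fun c _ => Finset.sum_congr rfl fun b _ => by ring

/-- The transformation law of the curvature matrices. -/
lemma curvature_transform (h : IsIsometryOn G G' U U' φ) (hx : x ∈ U) (m i : Fin n) :
    jacobianMatrix φ x * curvatureMatrix G m i x
      = (∑ d, ∑ b, (jacobianMatrix φ x d m * jacobianMatrix φ x b i) •
          curvatureMatrix G' d b (φ x)) * jacobianMatrix φ x := by
  have hx' := h.mapsTo hx
  set B : Fin n → Coord n → Matrix (Fin n) (Fin n) ℝ := fun i y =>
    ∑ b, jacobianMatrix φ y b i • connectionMatrix G' b (φ y) with hB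
  have hBapp : ∀ i a c, (fun y => B i y a c) = fun y =>
      ∑ b, jacobianMatrix φ y b i * christoffel G' a b c (φ y) := by
    intro i a c
    funext y
    simp [hB, Matrix.sum_apply, connectionMatrix]
  have hJd := h.differentiableAt_jacobian hx
  have hΓd : ∀ a b c, DifferentiableAt ℝ (fun y => christoffel G' a b c (φ y)) x := fun a b c =>
    h.differentiableAt_comp (h.metric'.christoffel_smooth a b c) hx
  have hBd : ∀ i a c, DifferentiableAt ℝ (fun y => B i y a c) x := by
    intro i a c
    rw [hBapp]
    exact DifferentiableAt.fun_sum fun b _ => (hJd b i).mul (hΓd a b c)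
  have hdJd : ∀ i a j, DifferentiableAt ℝ (fun y => matrixPderiv i (jacobianMatrix φ) y a j) x :=
    fun i a j => ((h.jacobian_smooth a j).pderiv h.metric.isOpen i).differentiableAt_of_isOpen
      h.metric.isOpen hx
  -- differentiate the transformation law of the connection
  have hD : ∀ m i, matrixPderiv m (jacobianMatrix φ) x * connectionMatrix G i x
      + jacobianMatrix φ x * matrixPderiv m (connectionMatrix G i) x
      = matrixPderiv m (B i) x * jacobianMatrix φ x + B i x * matrixPderiv m (jacobianMatrix φ) x
        + matrixPderiv m (matrixPderiv i (jacobianMatrix φ)) x := by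
    intro m i
    rw [← matrixPderiv_mul hJd (differentiableAt_connection h.metric hx i),
      ← matrixPderiv_mul (hBd i) hJd]
    rw [matrixPderiv_congr (N := fun y => B i y * jacobianMatrix φ y
      + matrixPderiv i (jacobianMatrix φ) y)
      (eventually_of_mem (h.metric.isOpen.mem_nhds hx) fun y hy => h.connection_transform hy i)]
    ext a c
    simp only [matrixPderiv, Matrix.of_apply, Matrix.add_apply]
    refine pderiv_add ?_ (hdJd i a c) m
    simp only [Matrix.mul_apply]
    exact DifferentiableAt.fun_sum fun b _ => (hBd i a b).mul (hJd b c)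
  have hsymm : matrixPderiv m (matrixPderiv i (jacobianMatrix φ)) x
      = matrixPderiv i (matrixPderiv m (jacobianMatrix φ)) x := by
    ext a c
    exact pderiv_comm h.metric.isOpen (h.jacobian_smooth a c) hx m i
  have hJF : jacobianMatrix φ x * curvatureMatrix G m i x
      = (matrixPderiv m (B i) x - matrixPderiv i (B m) x + B m x * B i x - B i x * B m x)
        * jacobianMatrix φ x := by
    have c1 := h.connection_transform hx i
    have c2 := h.connection_transform hx m
    have d1 := hD m i
    have d2 := hD i m
    rw [hsymm] at d1
    change _ = B i x * _ + _ at c1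
    change _ = B m x * _ + _ at c2
    simp only [curvatureMatrix, mul_sub, mul_add, sub_mul, add_mul]
    rw [← mul_assoc, ← mul_assoc, c1, c2, add_mul, add_mul, mul_assoc (B m x), mul_assoc (B i x),
      mul_assoc (B m x), mul_assoc (B i x), c1, c2, eq_sub_of_add_eq' d1, eq_sub_of_add_eq' d2,
      mul_add, mul_add]
    abel
  rw [hJF]
  congr 1
  have hdB : ∀ m i, matrixPderiv m (B i) x
      = (∑ b, pderiv m (fun y => jacobianMatrix φ y b i) x • connectionMatrix G' b (φ x))
        + ∑ d, ∑ b, (jacobianMatrix φ x d m * jacobianMatrix φ x b i) •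
          matrixPderiv d (connectionMatrix G' b) (φ x) := by
    intro m i
    ext a c
    simp only [matrixPderiv, Matrix.of_apply, Matrix.add_apply, Matrix.sum_apply,
      Matrix.smul_apply, smul_eq_mul]
    rw [hBapp, pderiv_sum (f := fun b y => jacobianMatrix φ y b i * christoffel G' a b c (φ y)) _
      (fun b _ => (hJd b i).mul (hΓd a b c)), Finset.sum_comm (γ := Fin n),
      ← Finset.sum_add_distrib]
    refine Finset.sum_congr rfl fun b _ => ?_
    rw [pderiv_mul (hJd b i) (hΓd a b c), h.pderiv_comp (h.metric'.christoffel_smooth a b c) hx,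
      Finset.mul_sum]
    congr 1
    exact Finset.sum_congr rfl fun d _ => by simp only [connectionMatrix, Matrix.of_apply]; ring
  have hprod : ∀ m i, B m x * B i x = ∑ d, ∑ b, (jacobianMatrix φ x d m * jacobianMatrix φ x b i) •
      (connectionMatrix G' d (φ x) * connectionMatrix G' b (φ x)) := by
    intro m i
    simp only [hB, Finset.sum_mul_sum]
    refine Finset.sum_congr rfl fun d _ => Finset.sum_congr rfl fun b _ => ?_
    rw [Matrix.smul_mul, Matrix.mul_smul, smul_smul]
  have hswap : ∀ X : Fin n → Fin n → Matrix (Fin n) (Fin n) ℝ,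
      ∑ d, ∑ b, (jacobianMatrix φ x d i * jacobianMatrix φ x b m) • X d b
      = ∑ d, ∑ b, (jacobianMatrix φ x d m * jacobianMatrix φ x b i) • X b d := by
    intro X
    rw [Finset.sum_comm]
    exact Finset.sum_congr rfl fun d _ => Finset.sum_congr rfl fun b _ => by
      rw [mul_comm]
  have hH : ∑ b, pderiv m (fun y => jacobianMatrix φ y b i) x • connectionMatrix G' b (φ x)
      = ∑ b, pderiv i (fun y => jacobianMatrix φ y b m) x • connectionMatrix G' b (φ x) :=
    Finset.sum_congr rfl fun b _ => by rw [h.pderiv_jacobian_symm hx]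
  rw [hdB m i, hdB i m, hH, hprod, hprod, hswap, hswap]
  simp only [curvatureMatrix, smul_sub, smul_add, Finset.sum_sub_distrib, Finset.sum_add_distrib]
  abel

/-- The Ricci tensor is a tensor. -/
lemma ricci_transform (h : IsIsometryOn G G' U U' φ) (hx : x ∈ U) :
    Matrix.of (fun i j => ricciCoord G i j x)
      = (jacobianMatrix φ x)ᵀ * Matrix.of (fun i j => ricciCoord G' i j (φ x))
        * jacobianMatrix φ x := by
  have hx' := h.mapsTo hx
  set J := jacobianMatrix φ x with hJ
  have hdet := (h.det_jacobian hx).isUnit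
  have hinv : ∀ c d, ∑ k, J c k * J⁻¹ k d = if c = d then 1 else 0 := by
    intro c d
    have := congrFun (congrFun (Matrix.mul_nonsing_inv J hdet) c) d
    rwa [Matrix.mul_apply, Matrix.one_apply] at this
  have hF : ∀ k j, curvatureMatrix G k j x
      = J⁻¹ * ((∑ d, ∑ b, (J d k * J b j) • curvatureMatrix G' d b (φ x)) * J) := by
    intro k j
    rw [← h.curvature_transform hx k j, ← mul_assoc, Matrix.nonsing_inv_mul _ hdet, one_mul]
  ext i j
  simp only [Matrix.of_apply, Matrix.mul_apply, Matrix.transpose_apply,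
    h.metric.ricciCoord_eq_curvature hx, h.metric'.ricciCoord_eq_curvature hx', hF,
    Matrix.sum_apply, Matrix.smul_apply, smul_eq_mul]
  calc _ = ∑ c, ∑ e, ∑ d, ∑ b, (∑ k, J d k * J⁻¹ k c) *
        (J b j * curvatureMatrix G' d b (φ x) c e * J e i) := by
        simp only [Finset.mul_sum, Finset.sum_mul]
        rw [Finset.sum_comm]
        refine Finset.sum_congr rfl fun c _ => ?_
        rw [Finset.sum_comm]
        refine Finset.sum_congr rfl fun e _ => ?_
        rw [Finset.sum_comm]
        refine Finset.sum_congr rfl fun d _ => ?_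
        rw [Finset.sum_comm]
        exact Finset.sum_congr rfl fun b _ => Finset.sum_congr rfl fun k _ => by ring
    _ = ∑ c, ∑ e, ∑ b, J b j * curvatureMatrix G' c b (φ x) c e * J e i := by
        refine Finset.sum_congr rfl fun c _ => Finset.sum_congr rfl fun e _ => ?_
        rw [Finset.sum_comm]
        exact Finset.sum_congr rfl fun b _ => by simp [hinv]
    _ = _ := by
        simp only [Finset.mul_sum, Finset.sum_mul]
        refine Finset.sum_comm.trans <| (Finset.sum_congr rfl fun e _ => Finset.sum_comm).trans <|
          Finset.sum_comm.trans ?_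
        refine Finset.sum_congr rfl fun b _ => Finset.sum_congr rfl fun e _ =>
          Finset.sum_congr rfl fun c _ => ?_
        ring

/-- The scalar curvature does not depend on the coordinates. -/
theorem scalarCoord_eq (h : IsIsometryOn G G' U U' φ) (hx : x ∈ U) :
    scalarCoord G x = scalarCoord G' (φ x) := by
  have tr : ∀ (A B : Matrix (Fin n) (Fin n) ℝ), ∑ i, ∑ j, A i j * B i j = (A * Bᵀ).trace := by
    intro A B
    simp [Matrix.trace, Matrix.mul_apply]
  have h1 : scalarCoord G x
      = ((G x)⁻¹ * (Matrix.of (fun i j => ricciCoord G i j x))ᵀ).trace := by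
    rw [← tr]; rfl
  have h2 : scalarCoord G' (φ x)
      = ((G' (φ x))⁻¹ * (Matrix.of (fun i j => ricciCoord G' i j (φ x)))ᵀ).trace := by
    rw [← tr]; rfl
  have hdet := (h.det_jacobian hx).isUnit
  set J := jacobianMatrix φ x with hJ
  have hdetT : IsUnit Jᵀ.det := by rwa [Matrix.det_transpose]
  rw [h1, h2, h.ricci_transform hx, h.pullback x hx, Matrix.mul_inv_rev, Matrix.mul_inv_rev,
    Matrix.transpose_mul, Matrix.transpose_mul, Matrix.transpose_transpose, ← hJ]
  set X := (Matrix.of (fun i j => ricciCoord G' i j (φ x)))ᵀ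
  have : J⁻¹ * ((G' (φ x))⁻¹ * Jᵀ⁻¹) * (Jᵀ * (X * J)) = J⁻¹ * ((G' (φ x))⁻¹ * X * J) := by
    rw [mul_assoc, mul_assoc, ← mul_assoc Jᵀ⁻¹, Matrix.nonsing_inv_mul _ hdetT, one_mul, mul_assoc]
  rw [this, Matrix.trace_mul_comm, mul_assoc, Matrix.mul_nonsing_inv _ hdet, mul_one]

end IsIsometryOn

end ChangeOfCoordinates

/-! ### Spherically symmetric metrics on `ℝ³` -/

section Radial

lemma norm_sq_coord (x : Coord 3) : ‖x‖ ^ 2 = x 0 ^ 2 + x 1 ^ 2 + x 2 ^ 2 := by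
  rw [EuclideanSpace.real_norm_sq_eq, Fin.sum_univ_three]

/-- The spherically symmetric metric `w(s)⁻¹ dr² + r² dΩ²`, where `s = r²` and `w = 1 - β(s) s`,
in Cartesian coordinates. In terms of the mass function `m` of the metric
`(1 - 2m/r)⁻¹ dr² + r² dΩ²`, the profile is `β = 2m/r³`. -/
noncomputable def radialMetric (β : ℝ → ℝ) (x : Coord 3) : Matrix (Fin 3) (Fin 3) ℝ :=
  Matrix.of fun i j => (if i = j then 1 else 0)
    + β (‖x‖ ^ 2) / (1 - β (‖x‖ ^ 2) * ‖x‖ ^ 2) * (x i * x j)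

variable {β : ℝ → ℝ} {x : Coord 3}

lemma radialMetric_inv (hx : 1 - β (‖x‖ ^ 2) * ‖x‖ ^ 2 ≠ 0) :
    radialMetric β x * Matrix.of (fun i j => (if i = j then 1 else 0) - β (‖x‖ ^ 2) * (x i * x j))
      = 1 := by
  have hn := norm_sq_coord x
  ext i j
  simp only [radialMetric, Matrix.mul_apply, Matrix.of_apply, Fin.sum_univ_three, Matrix.one_apply]
  set b := β (‖x‖ ^ 2)
  set a := b / (1 - b * ‖x‖ ^ 2) with ha
  have hab : a * (1 - b * ‖x‖ ^ 2) = b := div_mul_cancel₀ _ hx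
  rw [hn] at hab
  fin_cases i <;> fin_cases j <;> simp <;> first
    | linear_combination (x 0 * x 0) * hab
    | linear_combination (x 0 * x 1) * hab
    | linear_combination (x 0 * x 2) * hab
    | linear_combination (x 1 * x 1) * hab
    | linear_combination (x 1 * x 2) * hab
    | linear_combination (x 2 * x 2) * hab

lemma radialMetric_quadratic (x v : Coord 3) :
    ∑ i, ∑ j, radialMetric β x i j * v i * v j
      = ‖v‖ ^ 2 + β (‖x‖ ^ 2) / (1 - β (‖x‖ ^ 2) * ‖x‖ ^ 2) * (∑ i, x i * v i) ^ 2 := by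
  rw [norm_sq_coord v]
  simp only [radialMetric, Matrix.of_apply, Fin.sum_univ_three]
  simp
  ring

lemma sum_mul_sq_le (x v : Coord 3) : (∑ i, x i * v i) ^ 2 ≤ ‖x‖ ^ 2 * ‖v‖ ^ 2 := by
  rw [EuclideanSpace.real_norm_sq_eq, EuclideanSpace.real_norm_sq_eq]
  exact Finset.sum_mul_sq_le_sq_mul_sq _ _ _

/-- The radial component of a vector is controlled by its length. -/
lemma radialMetric_radial_le (hx : 0 < 1 - β (‖x‖ ^ 2) * ‖x‖ ^ 2) (v : Coord 3) :
    (∑ i, x i * v i) ^ 2 ≤ ‖x‖ ^ 2 * (1 - β (‖x‖ ^ 2) * ‖x‖ ^ 2) *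
      ∑ i, ∑ j, radialMetric β x i j * v i * v j := by
  have h := sum_mul_sq_le x v
  rw [radialMetric_quadratic]
  set p := ∑ i, x i * v i
  set w := 1 - β (‖x‖ ^ 2) * ‖x‖ ^ 2 with hw
  have : ‖x‖ ^ 2 * w * (‖v‖ ^ 2 + β (‖x‖ ^ 2) / w * p ^ 2)
      = w * (‖x‖ ^ 2 * ‖v‖ ^ 2 - p ^ 2) + p ^ 2 := by
    field_simp
    rw [hw]
    ring
  rw [this]
  nlinarith

lemma radialMetric_pos (hx : 0 < 1 - β (‖x‖ ^ 2) * ‖x‖ ^ 2) {v : Coord 3}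
    (hv : v ≠ 0) : 0 < ∑ i, ∑ j, radialMetric β x i j * v i * v j := by
  have h1 := radialMetric_radial_le hx v
  have h2 := radialMetric_quadratic (β := β) x v
  by_cases hp : ∑ i, x i * v i = 0
  · rw [h2, hp]
    have := norm_pos_iff.2 hv
    rw [zero_pow two_ne_zero, mul_zero, add_zero]
    positivity
  · have hpos : 0 < (∑ i, x i * v i) ^ 2 := sq_pos_of_ne_zero hp
    by_contra hneg
    push Not at hneg
    have : ‖x‖ ^ 2 * (1 - β (‖x‖ ^ 2) * ‖x‖ ^ 2) *
      ∑ i, ∑ j, radialMetric β x i j * v i * v j ≤ 0 :=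
      mul_nonpos_of_nonneg_of_nonpos (by positivity) hneg
    linarith

lemma radialMetric_symm (x : Coord 3) (i j : Fin 3) :
    radialMetric β x i j = radialMetric β x j i := by
  simp only [radialMetric, Matrix.of_apply, eq_comm (a := i), mul_comm (x i)]

lemma contDiff_norm_sq_coord : ContDiff ℝ ∞ (fun y : Coord 3 => ‖y‖ ^ 2) := contDiff_norm_sq ℝ

lemma contDiffOn_coord (i : Fin 3) (U : Set (Coord 3)) :
    ContDiffOn ℝ ∞ (fun y : Coord 3 => y i) U :=
  contDiffOn_coord_iff.1 contDiffOn_id i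

/-- The requirements on a profile `β`: it is smooth on the open set `I` of values of `s = r²`, and
`w = 1 - β(s) s` is positive there. -/
structure IsProfileOn (β : ℝ → ℝ) (I : Set ℝ) : Prop where
  isOpen : IsOpen I
  smooth : ContDiffOn ℝ ∞ β I
  w_pos : ∀ s ∈ I, 0 < 1 - β s * s

variable {I : Set ℝ}

lemma IsProfileOn.smooth_norm_sq {f : ℝ → ℝ} (hf : ContDiffOn ℝ ∞ f I) :
    ContDiffOn ℝ ∞ (fun y : Coord 3 => f (‖y‖ ^ 2)) {y : Coord 3 | ‖y‖ ^ 2 ∈ I} :=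
  hf.comp contDiff_norm_sq_coord.contDiffOn fun _ hy => hy

lemma IsProfileOn.isMetricOn (h : IsProfileOn β I) :
    IsMetricOn (radialMetric β) {y : Coord 3 | ‖y‖ ^ 2 ∈ I} where
  isOpen := h.isOpen.preimage (by fun_prop)
  smooth i j := by
    simp only [radialMetric, Matrix.of_apply]
    have hb := IsProfileOn.smooth_norm_sq h.smooth
    refine contDiffOn_const.add ((hb.div (contDiffOn_const.sub
      (hb.mul contDiff_norm_sq_coord.contDiffOn)) fun y hy => (h.w_pos _ hy).ne').mul
      ((contDiffOn_coord i _).mul (contDiffOn_coord j _)))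
  symm y _ i j := radialMetric_symm y i j
  det_ne y hy := by
    have := congrArg Matrix.det (radialMetric_inv (h.w_pos _ hy).ne')
    rw [Matrix.det_mul, Matrix.det_one] at this
    exact left_ne_zero_of_mul (this ▸ one_ne_zero)

lemma pderiv_norm_sq (x : Coord 3) (k : Fin 3) :
    pderiv k (fun y : Coord 3 => ‖y‖ ^ 2) x = 2 * x k := by
  have e : (fun y : Coord 3 => ‖y‖ ^ 2) = fun y => ∑ i : Fin 3, y i * y i := by
    funext y
    rw [norm_sq_coord, Fin.sum_univ_three]; ring
  have hd : ∀ i : Fin 3, DifferentiableAt ℝ (fun y : Coord 3 => y i) x := fun i => by fun_prop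
  rw [e, pderiv_sum (f := fun i (y : Coord 3) => y i * y i) _ fun i _ => (hd i).mul (hd i)]
  simp only [pderiv_mul (hd _) (hd _), pderiv_coord]
  fin_cases k <;> simp [Fin.sum_univ_three] <;> ring

lemma pderiv_radial {f : ℝ → ℝ} {f' : ℝ} (hf : HasDerivAt f f' (‖x‖ ^ 2)) (k : Fin 3) :
    pderiv k (fun y : Coord 3 => f (‖y‖ ^ 2)) x = 2 * f' * x k := by
  rw [pderiv_scalar_comp (f := fun y : Coord 3 => ‖y‖ ^ 2) hf
    (contDiff_norm_sq_coord.differentiable (by simp) x), pderiv_norm_sq]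
  ring

lemma differentiableAt_radial {f : ℝ → ℝ} {f' : ℝ} (hf : HasDerivAt f f' (‖x‖ ^ 2)) :
    DifferentiableAt ℝ (fun y : Coord 3 => f (‖y‖ ^ 2)) x :=
  hf.differentiableAt.comp x (contDiff_norm_sq_coord.differentiable (by simp) x)

/-- The derivative of a tensor `A(s) xᵢ xⱼ + B(s) δᵢⱼ`. -/
lemma pderiv_radial_tensor {A B : ℝ → ℝ} {A' B' : ℝ} (hA : HasDerivAt A A' (‖x‖ ^ 2))
    (hB : HasDerivAt B B' (‖x‖ ^ 2)) (k i j : Fin 3) (c : ℝ) :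
    pderiv k (fun y : Coord 3 => A (‖y‖ ^ 2) * (y i * y j) + B (‖y‖ ^ 2) * c) x
      = 2 * A' * x k * x i * x j
        + A (‖x‖ ^ 2) * ((if k = i then 1 else 0) * x j + x i * (if k = j then 1 else 0))
        + 2 * B' * x k * c := by
  have hd : ∀ i : Fin 3, DifferentiableAt ℝ (fun y : Coord 3 => y i) x := fun i => by fun_prop
  have hA' := differentiableAt_radial hA
  have hB' := differentiableAt_radial hB
  rw [pderiv_add (hA'.fun_mul ((hd i).fun_mul (hd j))) (hB'.fun_mul (by fun_prop)),
    pderiv_mul hA' ((hd i).fun_mul (hd j)), pderiv_mul (hd i) (hd j), pderiv_mul hB' (by fun_prop),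
    pderiv_radial hA, pderiv_radial hB, pderiv_coord, pderiv_coord, pderiv_const]
  ring

/-- The coefficient `α` of the Christoffel symbols `Γᵏᵢⱼ = xₖ (α xᵢ xⱼ + β δᵢⱼ)` of a radial
metric. -/
noncomputable def radialAlpha (β : ℝ → ℝ) (s : ℝ) : ℝ := (deriv β s + β s ^ 2) / (1 - β s * s)

lemma IsProfileOn.hasDerivAt (h : IsProfileOn β I) {s : ℝ} (hs : s ∈ I) :
    HasDerivAt β (deriv β s) s :=
  ((h.smooth.contDiffAt (h.isOpen.mem_nhds hs)).differentiableAt (by simp)).hasDerivAt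

lemma IsProfileOn.deriv_smooth (h : IsProfileOn β I) : ContDiffOn ℝ ∞ (deriv β) I :=
  h.smooth.deriv_of_isOpen h.isOpen (by simp)

lemma IsProfileOn.alpha_smooth (h : IsProfileOn β I) : ContDiffOn ℝ ∞ (radialAlpha β) I := by
  unfold radialAlpha
  exact (h.deriv_smooth.add (h.smooth.pow 2)).div
    (contDiffOn_const.sub (h.smooth.mul contDiffOn_id)) fun s hs => (h.w_pos s hs).ne'

lemma IsProfileOn.christoffel_radial (h : IsProfileOn β I) (hx : ‖x‖ ^ 2 ∈ I) (k i j : Fin 3) :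
    christoffel (radialMetric β) k i j x = x k * (radialAlpha β (‖x‖ ^ 2) * (x i * x j)
      + β (‖x‖ ^ 2) * if i = j then 1 else 0) := by
  have hw := (h.w_pos _ hx).ne'
  have hβ := h.hasDerivAt hx
  have hinv : (radialMetric β x)⁻¹ = _ := Matrix.inv_eq_right_inv (radialMetric_inv hw)
  set A : ℝ → ℝ := fun s => β s / (1 - β s * s) with hA
  have hA' : HasDerivAt A ((deriv β (‖x‖ ^ 2) + β (‖x‖ ^ 2) ^ 2)
      / (1 - β (‖x‖ ^ 2) * ‖x‖ ^ 2) ^ 2) (‖x‖ ^ 2) := by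
    have h1 := hβ.fun_div ((hasDerivAt_const _ (1 : ℝ)).fun_sub
      (hβ.fun_mul (hasDerivAt_id' (‖x‖ ^ 2)))) hw
    exact h1.congr_deriv (by ring)
  have hp : ∀ a b c, pderiv a (fun y => radialMetric β y b c) x
      = 2 * ((deriv β (‖x‖ ^ 2) + β (‖x‖ ^ 2) ^ 2) / (1 - β (‖x‖ ^ 2) * ‖x‖ ^ 2) ^ 2)
          * x a * x b * x c
        + β (‖x‖ ^ 2) / (1 - β (‖x‖ ^ 2) * ‖x‖ ^ 2)
          * ((if a = b then 1 else 0) * x c + x b * (if a = c then 1 else 0))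
        + 2 * 0 * x a * (if b = c then 1 else 0) := by
    intro a b c
    have e : (fun y => radialMetric β y b c) = fun y : Coord 3 =>
        A (‖y‖ ^ 2) * (y b * y c)
          + (fun _ : ℝ => (1 : ℝ)) (‖y‖ ^ 2) * (if b = c then 1 else 0) := by
      funext y
      simp only [radialMetric, Matrix.of_apply, hA]
      ring
    rw [e]
    exact pderiv_radial_tensor hA' (hasDerivAt_const _ _) a b c _
  have hn := norm_sq_coord x
  simp only [christoffel, hp, hinv, Matrix.of_apply, radialAlpha]
  set s := ‖x‖ ^ 2
  set b := β s
  set D := deriv β s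
  have hb : b / (1 - b * s) * (1 - b * s) = b := div_mul_cancel₀ _ hw
  have hc : (D + b ^ 2) / (1 - b * s) ^ 2 * (1 - b * s) = (D + b ^ 2) / (1 - b * s) := by
    field_simp
  clear_value s b D
  clear hp hA' hinv hβ
  generalize (D + b ^ 2) / (1 - b * s) ^ 2 = p at *
  generalize (D + b ^ 2) / (1 - b * s) = r at *
  generalize b / (1 - b * s) = q at *
  subst hn
  have main : ∀ l : Fin 3,
      (2 * p * x i * x l * x j + q * ((if i = l then 1 else 0) * x j + x l * if i = j then 1 else 0)
        + 2 * 0 * x i * (if l = j then 1 else 0)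
      + (2 * p * x j * x l * x i
        + q * ((if j = l then 1 else 0) * x i + x l * if j = i then 1 else 0)
        + 2 * 0 * x j * (if l = i then 1 else 0))
      - (2 * p * x l * x i * x j
        + q * ((if l = i then 1 else 0) * x j + x i * if l = j then 1 else 0)
        + 2 * 0 * x l * (if i = j then 1 else 0)))
      = x l * (2 * p * x i * x j + 2 * q * if i = j then 1 else 0) := by
    intro l
    simp only [eq_comm (a := l), eq_comm (a := j) (b := i)]
    ring
  simp only [main, Fin.sum_univ_three]
  generalize (if i = j then (1 : ℝ) else 0) = d
  fin_cases k <;> simp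
  · linear_combination (x 0 * x i * x j) * hc + (x 0 * d) * hb
  · linear_combination (x 1 * x i * x j) * hc + (x 1 * d) * hb
  · linear_combination (x 2 * x i * x j) * hc + (x 2 * d) * hb

/-- The Ricci tensor of a radial metric. -/
lemma IsProfileOn.ricci_radial (h : IsProfileOn β I) (hx : ‖x‖ ^ 2 ∈ I) (i j : Fin 3) :
    ricciCoord (radialMetric β) i j x =
      (3 * radialAlpha β (‖x‖ ^ 2) - 2 * deriv β (‖x‖ ^ 2) - β (‖x‖ ^ 2) *
        (radialAlpha β (‖x‖ ^ 2) * ‖x‖ ^ 2 + β (‖x‖ ^ 2))) * (x i * x j)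
      + (2 * β (‖x‖ ^ 2) + 2 * deriv β (‖x‖ ^ 2) * ‖x‖ ^ 2 - radialAlpha β (‖x‖ ^ 2) * ‖x‖ ^ 2
        + β (‖x‖ ^ 2) * ‖x‖ ^ 2 * (radialAlpha β (‖x‖ ^ 2) * ‖x‖ ^ 2 + β (‖x‖ ^ 2)))
        * if i = j then 1 else 0 := by
  have hβ := h.hasDerivAt hx
  have hα : HasDerivAt (radialAlpha β) (deriv (radialAlpha β) (‖x‖ ^ 2)) (‖x‖ ^ 2) :=
    ((h.alpha_smooth.contDiffAt (h.isOpen.mem_nhds hx)).differentiableAt (by simp)).hasDerivAt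
  have hΓ := fun k i j => h.christoffel_radial hx k i j
  have hp : ∀ m k a b, pderiv m (christoffel (radialMetric β) k a b) x
      = (if m = k then 1 else 0) * (radialAlpha β (‖x‖ ^ 2) * (x a * x b)
          + β (‖x‖ ^ 2) * if a = b then 1 else 0)
        + x k * (2 * deriv (radialAlpha β) (‖x‖ ^ 2) * x m * x a * x b
        + radialAlpha β (‖x‖ ^ 2) *
          ((if m = a then 1 else 0) * x b + x a * (if m = b then 1 else 0))
        + 2 * deriv β (‖x‖ ^ 2) * x m * (if a = b then 1 else 0)) := by
    intro m k a b
    rw [pderiv_congr (eventually_of_mem (h.isMetricOn.isOpen.mem_nhds hx)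
      fun y hy => h.christoffel_radial hy k a b) m, pderiv_mul (by fun_prop), pderiv_coord,
      pderiv_radial_tensor hα hβ]
    have hd : ∀ i : Fin 3, DifferentiableAt ℝ (fun y : Coord 3 => y i) x := fun i => by fun_prop
    exact ((differentiableAt_radial hα).fun_mul ((hd a).fun_mul (hd b))).fun_add
      ((differentiableAt_radial hβ).fun_mul (by fun_prop))
  simp only [ricciCoord, hp, hΓ]
  have hn := norm_sq_coord x
  generalize deriv (radialAlpha β) (‖x‖ ^ 2) = a'
  generalize radialAlpha β (‖x‖ ^ 2) = a
  generalize deriv β (‖x‖ ^ 2) = b'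
  generalize β (‖x‖ ^ 2) = b
  rw [hn]
  fin_cases i <;> fin_cases j <;> simp [Fin.sum_univ_three] <;> ring

/-- The scalar curvature of a radial metric. -/
theorem IsProfileOn.scalar_radial (h : IsProfileOn β I) (hx : ‖x‖ ^ 2 ∈ I) :
    scalarCoord (radialMetric β) x = 6 * β (‖x‖ ^ 2) + 4 * ‖x‖ ^ 2 * deriv β (‖x‖ ^ 2) := by
  have hw := (h.w_pos _ hx).ne'
  have hinv : (radialMetric β x)⁻¹ = _ := Matrix.inv_eq_right_inv (radialMetric_inv hw)
  have hn := norm_sq_coord x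
  simp only [scalarCoord, h.ricci_radial hx, hinv, Matrix.of_apply]
  generalize radialAlpha β (‖x‖ ^ 2) = a
  generalize deriv β (‖x‖ ^ 2) = b'
  generalize β (‖x‖ ^ 2) = b
  have e : ∀ P Q : ℝ, ∑ i : Fin 3, ∑ j : Fin 3,
      ((if i = j then 1 else 0) - b * (x i * x j)) * (P * (x i * x j) + Q * if i = j then 1 else 0)
      = P * (‖x‖ ^ 2 * (1 - b * ‖x‖ ^ 2)) + Q * (3 - b * ‖x‖ ^ 2) := by
    intro P Q
    rw [hn]
    simp [Fin.sum_univ_three]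
    ring
  rw [e]
  ring

end Radial

/-! ### The interpolating profile -/

section Profile

/-- A smooth nondecreasing function with `softMin u = u` for `u ≤ 8`, constant for `u ≥ 9`. -/
noncomputable def softMin (u : ℝ) : ℝ :=
  8 + ∫ t in (8 : ℝ)..u, (1 - Real.smoothTransition (t - 8))

lemma contDiff_softMin_integrand :
    ContDiff ℝ ∞ (fun t : ℝ => 1 - Real.smoothTransition (t - 8)) :=
  contDiff_const.sub (Real.smoothTransition.contDiff.comp (contDiff_id.sub contDiff_const))

lemma hasDerivAt_softMin (u : ℝ) :
    HasDerivAt softMin (1 - Real.smoothTransition (u - 8)) u := by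
  have h := contDiff_softMin_integrand.continuous
  exact (intervalIntegral.integral_hasDerivAt_right (h.intervalIntegrable _ _)
    h.aestronglyMeasurable.stronglyMeasurableAtFilter h.continuousAt).const_add 8

lemma contDiff_softMin : ContDiff ℝ ∞ softMin := by
  rw [contDiff_infty_iff_deriv]
  refine ⟨fun u => (hasDerivAt_softMin u).differentiableAt, ?_⟩
  rw [show deriv softMin = _ from funext fun u => (hasDerivAt_softMin u).deriv]
  exact contDiff_softMin_integrand

lemma softMin_of_le {u : ℝ} (hu : u ≤ 8) : softMin u = u := by
  have : ∫ t in (8 : ℝ)..u, (1 - Real.smoothTransition (t - 8)) = ∫ t in (8 : ℝ)..u, (1 : ℝ) := by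
    refine intervalIntegral.integral_congr fun t ht => ?_
    rw [uIcc_of_ge hu] at ht
    simp only [Real.smoothTransition.zero_of_nonpos (sub_nonpos.2 ht.2), sub_zero]
  rw [softMin, this, intervalIntegral.integral_const]
  simp

lemma softMin_monotone : Monotone softMin :=
  monotone_of_deriv_nonneg (fun u => (hasDerivAt_softMin u).differentiableAt) fun u => by
    rw [(hasDerivAt_softMin u).deriv]
    exact sub_nonneg.2 (Real.smoothTransition.le_one _)

lemma softMin_le (u : ℝ) : softMin u ≤ u := by
  have hm : Monotone fun u => u - softMin u :=
    monotone_of_deriv_nonneg (fun u => (hasDerivAt_id' u).fun_sub (hasDerivAt_softMin u)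
      |>.differentiableAt) fun u => by
      rw [((hasDerivAt_id' u).fun_sub (hasDerivAt_softMin u)).deriv]
      linarith [Real.smoothTransition.nonneg (u - 8)]
  rcases le_total u 8 with h | h
  · exact (softMin_of_le h).le
  · have := hm h
    simp only [softMin_of_le le_rfl, sub_self] at this
    linarith

lemma eight_le_softMin_nine : 8 ≤ softMin 9 := by
  have := softMin_monotone (show (8 : ℝ) ≤ 9 by norm_num)
  rwa [softMin_of_le le_rfl] at this

lemma softMin_of_ge {u : ℝ} (hu : 9 ≤ u) : softMin u = softMin 9 := by
  have h := contDiff_softMin_integrand.continuous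
  have h1 := intervalIntegral.integral_add_adjacent_intervals
    (h.intervalIntegrable (μ := MeasureTheory.volume) 8 9) (h.intervalIntegrable 9 u)
  have h2 : ∫ t in (9 : ℝ)..u, (1 - Real.smoothTransition (t - 8))
      = ∫ t in (9 : ℝ)..u, (0 : ℝ) := by
    refine intervalIntegral.integral_congr fun t ht => ?_
    rw [uIcc_of_le hu] at ht
    have : 1 ≤ t - 8 := by linarith [ht.1]
    simp only [Real.smoothTransition.one_of_one_le this, sub_self]
  rw [softMin, softMin, ← h1, h2]
  simp

lemma softMin_pos {u : ℝ} (hu : 0 < u) : 0 < softMin u := by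
  rcases le_total u 8 with h | h
  · rwa [softMin_of_le h]
  · have := softMin_monotone h
    rw [softMin_of_le le_rfl] at this
    linarith

/-- The profile of a radial metric which is flat for `r ≤ 2`, and for `r ≥ 3` is the metric
`(1 - 2M/r + κ² r²)⁻¹ dr² + r² dΩ²` with `2M = κ² softMin 9`. In between, the constant `2M` is
replaced by the nondecreasing function `κ² softMin (r³)`. -/
noncomputable def endProfile (κ s : ℝ) : ℝ :=
  κ ^ 2 * (softMin (s * Real.sqrt s) / (s * Real.sqrt s) - 1)

variable {κ s : ℝ}

lemma endProfile_of_le (hs0 : 0 < s) (hs : s ≤ 4) : endProfile κ s = 0 := by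
  have h2 : Real.sqrt s ≤ 2 := by
    rw [show (2 : ℝ) = Real.sqrt 4 by rw [show (4 : ℝ) = 2 ^ 2 by norm_num]; simp]
    exact Real.sqrt_le_sqrt hs
  have h0 := Real.sqrt_pos.2 hs0
  have h8 : s * Real.sqrt s ≤ 8 := by nlinarith
  rw [endProfile, softMin_of_le h8, div_self (by positivity), sub_self, mul_zero]

lemma endProfile_nonpos (hs0 : 0 < s) : endProfile κ s ≤ 0 := by
  have h0 := Real.sqrt_pos.2 hs0
  have : softMin (s * Real.sqrt s) / (s * Real.sqrt s) ≤ 1 :=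
    (div_le_one (by positivity)).2 (softMin_le _)
  exact mul_nonpos_of_nonneg_of_nonpos (sq_nonneg _) (by linarith)

lemma endProfile_ge (hs0 : 0 < s) : -κ ^ 2 ≤ endProfile κ s := by
  have h0 := Real.sqrt_pos.2 hs0
  have : 0 ≤ softMin (s * Real.sqrt s) / (s * Real.sqrt s) :=
    (div_pos (softMin_pos (by positivity)) (by positivity)).le
  rw [endProfile]
  nlinarith [sq_nonneg κ, mul_nonneg (sq_nonneg κ) this]

lemma endProfile_of_ge (hs : 9 ≤ s) :
    endProfile κ s = κ ^ 2 * (softMin 9 / (s * Real.sqrt s) - 1) := by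
  have h1 : 1 ≤ Real.sqrt s := Real.one_le_sqrt.2 (by linarith)
  rw [endProfile, softMin_of_ge (by nlinarith)]

/-- The scalar curvature `6β + 4sβ'` of the interpolating metric is at least that of hyperbolic
space of curvature `-κ²`; the difference is `6κ² softMin'(r³)`. -/
lemma endProfile_scalar (hs0 : 0 < s) :
    -6 * κ ^ 2 ≤ 6 * endProfile κ s + 4 * s * deriv (endProfile κ) s := by
  have h0 := Real.sqrt_pos.2 hs0
  have hsq : Real.sqrt s * Real.sqrt s = s := Real.mul_self_sqrt hs0.le
  have hu : HasDerivAt (fun s => s * Real.sqrt s) (3 / 2 * Real.sqrt s) s := by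
    refine ((hasDerivAt_id' s).fun_mul (Real.hasDerivAt_sqrt hs0.ne')).congr_deriv ?_
    field_simp
    nlinarith
  set u := s * Real.sqrt s with hudef
  have hupos : 0 < u := by positivity
  set θ' := 1 - Real.smoothTransition (u - 8)
  have hθ' : 0 ≤ θ' := sub_nonneg.2 (Real.smoothTransition.le_one _)
  have hd :=
    ((((hasDerivAt_softMin u).comp s hu).fun_div hu hupos.ne').sub_const 1).const_mul (κ ^ 2)
  have hd' : deriv (endProfile κ) s = _ := hd.deriv
  rw [hd', endProfile, ← hudef]
  simp only [Function.comp_apply, ← hudef]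
  have hs3 : s * (3 / 2 * Real.sqrt s) = 3 / 2 * u := by rw [hudef]; ring
  have key : 6 * (κ ^ 2 * (softMin u / u - 1)) + 4 * s * (κ ^ 2 * ((θ' * (3 / 2 * Real.sqrt s) * u
      - softMin u * (3 / 2 * Real.sqrt s)) / u ^ 2)) = -6 * κ ^ 2 + 6 * κ ^ 2 * θ' := by
    have : 4 * s * (κ ^ 2 * ((θ' * (3 / 2 * Real.sqrt s) * u
      - softMin u * (3 / 2 * Real.sqrt s)) / u ^ 2))
      = 4 * κ ^ 2 * ((s * (3 / 2 * Real.sqrt s)) * (θ' * u - softMin u) / u ^ 2) := by ring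
    rw [this, hs3]
    field_simp
    ring
  rw [key]
  nlinarith [mul_nonneg (sq_nonneg κ) hθ']

lemma endProfile_isProfileOn (κ : ℝ) : IsProfileOn (endProfile κ) (Ioi 0) where
  isOpen := isOpen_Ioi
  smooth := by
    have hu : ContDiffOn ℝ ∞ (fun s : ℝ => s * Real.sqrt s) (Ioi 0) :=
      contDiffOn_id.mul (contDiffOn_id.sqrt fun s hs => (mem_Ioi.1 hs).ne')
    refine contDiffOn_const.mul ((((contDiff_softMin.comp_contDiffOn hu).div hu) fun s hs =>
      (mul_pos hs (Real.sqrt_pos.2 hs)).ne').sub contDiffOn_const)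
  w_pos s hs := by
    have := mul_nonpos_of_nonpos_of_nonneg (endProfile_nonpos (κ := κ) hs) (le_of_lt hs)
    linarith

lemma endProfile_w_le (hs0 : 0 < s) : 1 - endProfile κ s * s ≤ 1 + κ ^ 2 * s := by
  nlinarith [endProfile_ge (κ := κ) hs0]

end Profile

/-! ### Umbilic hypersurfaces of the Schwarzschild spacetime -/

section Schwarzschild

/-- The sum of the squares of the three space coordinates. -/
noncomputable def spaceSq (y : Coord 4) : ℝ := ∑ i : Fin 3, y i.succ ^ 2

lemma areaRadius_eq (y : Coord 4) : areaRadius y = Real.sqrt (spaceSq y) := rfl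

lemma spaceSq_nonneg (y : Coord 4) : 0 ≤ spaceSq y := Finset.sum_nonneg fun _ _ => sq_nonneg _

/-- The function `1 - 2M/r` in terms of `s = r²`. -/
noncomputable def lapseSq (M s : ℝ) : ℝ := 1 - 2 * M / Real.sqrt s

/-- The coefficient of `xᵢ xⱼ` in the Schwarzschild metric, in terms of `s = r²`. -/
noncomputable def schwarzschildCoeff (M s : ℝ) : ℝ := ((lapseSq M s)⁻¹ - 1) / s

variable {M K : ℝ}

lemma schwarzschild_zero_zero (y : Coord 4) :
    schwarzschild M y 0 0 = -lapseSq M (spaceSq y) := rfl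

lemma schwarzschild_zero_succ (y : Coord 4) (j : Fin 3) : schwarzschild M y 0 j.succ = 0 := rfl

lemma schwarzschild_succ_zero (y : Coord 4) (i : Fin 3) : schwarzschild M y i.succ 0 = 0 := rfl

lemma schwarzschild_succ_succ (y : Coord 4) (i j : Fin 3) :
    schwarzschild M y i.succ j.succ = (if i = j then 1 else 0)
      + schwarzschildCoeff M (spaceSq y) * (y i.succ * y j.succ) := by
  change _ + ((lapseSq M (spaceSq y))⁻¹ - 1) * (_ / areaRadius y ^ 2) = _
  rw [areaRadius_eq, Real.sq_sqrt (spaceSq_nonneg y), schwarzschildCoeff]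
  ring

lemma lapseSq_pos (hM : 0 < M) {s : ℝ} (hs : 4 * M ^ 2 < s) : 0 < lapseSq M s := by
  have h2 : 2 * M < Real.sqrt s := Real.lt_sqrt_of_sq_lt (by linarith)
  rw [lapseSq, sub_pos, div_lt_one (by linarith)]
  exact h2

lemma contDiffOn_lapseSq (M : ℝ) : ContDiffOn ℝ ∞ (lapseSq M) (Ioi 0) :=
  contDiffOn_const.sub (contDiffOn_const.div (contDiffOn_id.sqrt fun _ hs => (mem_Ioi.1 hs).ne')
    fun _ hs => (Real.sqrt_pos.2 hs).ne')

lemma Ioi_exterior_subset (M : ℝ) : Ioi (4 * M ^ 2) ⊆ Ioi (0 : ℝ) :=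
  Ioi_subset_Ioi (by positivity)

lemma contDiffOn_schwarzschildCoeff (hM : 0 < M) :
    ContDiffOn ℝ ∞ (schwarzschildCoeff M) (Ioi (4 * M ^ 2)) :=
  ((((contDiffOn_lapseSq M).mono (Ioi_exterior_subset M)).inv
    fun _ hs => (lapseSq_pos hM hs).ne').sub contDiffOn_const).div contDiffOn_id
    fun _ hs => (Ioi_exterior_subset M hs).ne'

/-- The exterior region `r > 2M`. -/
def exteriorRegion (M : ℝ) : Set (Coord 4) := {y | 4 * M ^ 2 < spaceSq y}

lemma contDiff_coord4 (μ : Fin 4) : ContDiff ℝ ∞ (fun y : Coord 4 => y μ) :=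
  contDiff_euclidean.1 contDiff_id μ

lemma contDiff_spaceSq : ContDiff ℝ ∞ spaceSq :=
  ContDiff.sum fun i _ => (contDiff_coord4 i.succ).pow 2

lemma spaceSq_comp_smooth {h : ℝ → ℝ} (hh : ContDiffOn ℝ ∞ h (Ioi (4 * M ^ 2))) :
    ContDiffOn ℝ ∞ (fun y => h (spaceSq y)) (exteriorRegion M) :=
  hh.comp contDiff_spaceSq.contDiffOn fun _ hy => hy

lemma schwarzschild_isMetricOn (hM : 0 < M) : IsMetricOn (schwarzschild M) (exteriorRegion M) where
  isOpen := isOpen_lt continuous_const contDiff_spaceSq.continuous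
  smooth μ ν := by
    refine Fin.cases ?_ (fun i => ?_) μ <;> refine Fin.cases ?_ (fun j => ?_) ν
    · exact (spaceSq_comp_smooth ((contDiffOn_lapseSq M).mono (Ioi_exterior_subset M))).neg
    · exact contDiffOn_const
    · exact contDiffOn_const
    · simp only [schwarzschild_succ_succ]
      exact contDiffOn_const.add ((spaceSq_comp_smooth (contDiffOn_schwarzschildCoeff hM)).mul
        ((contDiff_coord4 _).mul (contDiff_coord4 _)).contDiffOn)
  symm y _ μ ν := by
    refine Fin.cases ?_ (fun i => ?_) μ <;> refine Fin.cases ?_ (fun j => ?_) ν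
    · rfl
    · rfl
    · rfl
    · simp only [schwarzschild_succ_succ, eq_comm (a := i), mul_comm (y i.succ)]
  det_ne y hy := by
    have hV := (lapseSq_pos hM hy).ne'
    have hs := (Ioi_exterior_subset M hy)
    have hs0 : spaceSq y ≠ 0 := (mem_Ioi.1 hs).ne'
    have e : (schwarzschild M y).det = -lapseSq M (spaceSq y) *
        (1 + schwarzschildCoeff M (spaceSq y) * spaceSq y) := by
      have hsub : (schwarzschild M y).submatrix Fin.succ Fin.succ = Matrix.of fun i j : Fin 3 =>
          (if i = j then 1 else 0) + schwarzschildCoeff M (spaceSq y) * (y i.succ * y j.succ) := by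
        ext i j
        exact schwarzschild_succ_succ y i j
      rw [Matrix.det_succ_row_zero, Fin.sum_univ_succ]
      simp only [schwarzschild_zero_succ, schwarzschild_zero_zero, Fin.val_zero, pow_zero, one_mul,
        mul_zero, zero_mul, Finset.sum_const_zero, add_zero]
      rw [Fin.succAbove_zero, hsub, Matrix.det_fin_three]
      generalize schwarzschildCoeff M (spaceSq y) = b
      generalize lapseSq M (spaceSq y) = V
      simp only [spaceSq, Fin.sum_univ_three, Matrix.of_apply]
      simp only [Fin.reduceEq, if_true, if_false, Fin.reduceSucc]
      ring
    rw [e, schwarzschildCoeff]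
    have : 1 + ((lapseSq M (spaceSq y))⁻¹ - 1) / spaceSq y * spaceSq y
      = (lapseSq M (spaceSq y))⁻¹ := by field_simp; ring
    rw [this, neg_mul, mul_inv_cancel₀ hV]
    norm_num

lemma pderiv_spaceSq_zero (y : Coord 4) : pderiv 0 spaceSq y = 0 := by
  have hd : ∀ i : Fin 3, DifferentiableAt ℝ (fun y : Coord 4 => y i.succ) y := fun i => by fun_prop
  have e : spaceSq = fun y : Coord 4 => ∑ i : Fin 3, y i.succ * y i.succ := by
    funext y; simp [spaceSq, sq]
  rw [e, pderiv_sum (f := fun (i : Fin 3) (y : Coord 4) => y i.succ * y i.succ) _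
    fun i _ => (hd i).mul (hd i)]
  refine Finset.sum_eq_zero fun i _ => ?_
  rw [pderiv_mul (hd i) (hd i), pderiv_coord, if_neg (Fin.succ_ne_zero i).symm]
  ring

lemma pderiv_spaceSq_succ (y : Coord 4) (k : Fin 3) : pderiv k.succ spaceSq y = 2 * y k.succ := by
  have hd : ∀ i : Fin 3, DifferentiableAt ℝ (fun y : Coord 4 => y i.succ) y := fun i => by fun_prop
  have e : spaceSq = fun y : Coord 4 => ∑ i : Fin 3, y i.succ * y i.succ := by
    funext y; simp [spaceSq, sq]
  rw [e, pderiv_sum (f := fun (i : Fin 3) (y : Coord 4) => y i.succ * y i.succ) _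
    fun i _ => (hd i).mul (hd i)]
  simp only [pderiv_mul (hd _) (hd _), pderiv_coord, Fin.succ_inj]
  simp [Finset.sum_add_distrib]
  ring

/-- The Christoffel symbols of the first kind. -/
noncomputable def christoffelFirst {n : ℕ} (G : Coord n → Matrix (Fin n) (Fin n) ℝ)
    (m i j : Fin n) (x : Coord n) : ℝ :=
  (1 / 2) * (pderiv i (fun y => G y m j) x + pderiv j (fun y => G y m i) x
        - pderiv m (fun y => G y i j) x)

variable {y : Coord 4}

lemma lapseSq_hasDerivAt {s : ℝ} (hs : 4 * M ^ 2 < s) :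
    HasDerivAt (lapseSq M) (deriv (lapseSq M) s) s :=
  (((contDiffOn_lapseSq M).contDiffAt (Ioi_mem_nhds (Ioi_exterior_subset M hs))).differentiableAt
    (by simp)).hasDerivAt

lemma schwarzschildCoeff_hasDerivAt (hM : 0 < M) {s : ℝ} (hs : 4 * M ^ 2 < s) :
    HasDerivAt (schwarzschildCoeff M) (deriv (schwarzschildCoeff M) s) s :=
  (((contDiffOn_schwarzschildCoeff hM).contDiffAt (Ioi_mem_nhds hs)).differentiableAt
    (by simp)).hasDerivAt

section Derivatives

lemma pderiv_zero_zero (hy : y ∈ exteriorRegion M) (α : Fin 4) :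
    pderiv α (fun y => schwarzschild M y 0 0) y
      = -(deriv (lapseSq M) (spaceSq y) * pderiv α spaceSq y) := by
  have h := (lapseSq_hasDerivAt (M := M) hy).fun_neg
  simp only [schwarzschild_zero_zero]
  rw [pderiv_scalar_comp (h := fun s => -lapseSq M s) h
    (contDiff_spaceSq.differentiable (by simp) y)]
  ring

lemma pderiv_succ_succ (hM : 0 < M) (hy : y ∈ exteriorRegion M) (α : Fin 4) (i j : Fin 3) :
    pderiv α (fun y => schwarzschild M y i.succ j.succ) y
      = deriv (schwarzschildCoeff M) (spaceSq y) * pderiv α spaceSq y * (y i.succ * y j.succ)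
      + schwarzschildCoeff M (spaceSq y) * ((if α = i.succ then 1 else 0) * y j.succ
        + y i.succ * (if α = j.succ then 1 else 0)) := by
  have h := schwarzschildCoeff_hasDerivAt hM hy
  have hsq := contDiff_spaceSq.differentiable (by simp) y
  have hd : ∀ i : Fin 3, DifferentiableAt ℝ (fun y : Coord 4 => y i.succ) y := fun i => by fun_prop
  have hc : DifferentiableAt ℝ (fun y => schwarzschildCoeff M (spaceSq y)) y :=
    h.differentiableAt.comp y hsq
  simp only [schwarzschild_succ_succ]
  rw [pderiv_add (by fun_prop) (hc.fun_mul ((hd i).fun_mul (hd j))), pderiv_const,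
    pderiv_mul hc ((hd i).fun_mul (hd j)), pderiv_scalar_comp h hsq, pderiv_mul (hd i) (hd j),
    pderiv_coord, pderiv_coord]
  ring

lemma pderiv_zero_succ (α : Fin 4) (i : Fin 3) :
    pderiv α (fun y => schwarzschild M y 0 i.succ) y = 0 :=
  pderiv_const α 0 y

lemma pderiv_succ_zero (α : Fin 4) (i : Fin 3) :
    pderiv α (fun y => schwarzschild M y i.succ 0) y = 0 :=
  pderiv_const α 0 y

/-- The second fundamental form only involves `[μ, αβ] Tᵢᵅ Tⱼᵝ` for tangent vectors of the form
`Tᵢ = g yᵢ ∂ₜ + ∂ᵢ`. This is the time component. -/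
lemma sum_christoffelFirst_zero (hM : 0 < M) (hy : y ∈ exteriorRegion M) (g : ℝ)
    (T : Fin 3 → Fin 4 → ℝ) (hT0 : ∀ i, T i 0 = g * y i.succ)
    (hT : ∀ i k, T i (Fin.succ k) = if i = k then 1 else 0)
    (i j : Fin 3) :
    ∑ α, ∑ β, christoffelFirst (schwarzschild M) 0 α β y * T i α * T j β
      = -2 * deriv (lapseSq M) (spaceSq y) * g * (y i.succ * y j.succ) := by
  simp only [Fin.sum_univ_succ (n := 3), hT0, hT, christoffelFirst, pderiv_zero_zero hy,
    pderiv_zero_succ, pderiv_succ_zero, pderiv_spaceSq_zero, pderiv_spaceSq_succ]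
  have h0 : ∀ a b : Fin 3, pderiv 0 (fun y => schwarzschild M y a.succ b.succ) y = 0 := by
    intro a b
    rw [pderiv_succ_succ hM hy, pderiv_spaceSq_zero]
    simp [(Fin.succ_ne_zero _).symm]
  simp [h0]
  ring

/-- The spatial components of the same contraction. -/
lemma sum_christoffelFirst_succ (hM : 0 < M) (hy : y ∈ exteriorRegion M) (g : ℝ)
    (T : Fin 3 → Fin 4 → ℝ)
    (hT0 : ∀ i, T i 0 = g * y i.succ) (hT : ∀ i k, T i (Fin.succ k) = if i = k then 1 else 0)
    (k i j : Fin 3) :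
    ∑ α, ∑ β, christoffelFirst (schwarzschild M) k.succ α β y * T i α * T j β
      = y k.succ * ((deriv (lapseSq M) (spaceSq y) * g ^ 2
          + deriv (schwarzschildCoeff M) (spaceSq y)) * (y i.succ * y j.succ)
          + schwarzschildCoeff M (spaceSq y) * if i = j then 1 else 0) := by
  simp only [Fin.sum_univ_succ (n := 3), hT0, hT, christoffelFirst, pderiv_zero_zero hy,
    pderiv_succ_succ hM hy,
    pderiv_zero_succ, pderiv_succ_zero, pderiv_spaceSq_zero, pderiv_spaceSq_succ]
  have hz : ∀ a : Fin 3, ((0 : Fin 4) = a.succ) = False := fun a =>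
    eq_false (Fin.succ_ne_zero a).symm
  simp [hz]
  simp only [eq_comm (a := k), eq_comm (a := j) (b := i)]
  split_ifs <;> ring

end Derivatives

/-- The function `λ² = 1 - 2M/r + K² r²` in terms of `s = r²`. -/
noncomputable def umbilicSq (M K s : ℝ) : ℝ := lapseSq M s + K ^ 2 * s

/-- The function `f'(r)/r = K / (λ V)` of `s = r²`, for the umbilic hypersurface `t = f(r)`. -/
noncomputable def umbilicSlope (M K s : ℝ) : ℝ := K / (Real.sqrt (umbilicSq M K s) * lapseSq M s)

lemma umbilicSq_pos (hM : 0 < M) {s : ℝ} (hs : 4 * M ^ 2 < s) : 0 < umbilicSq M K s := by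
  have h0 : 0 < s := Ioi_exterior_subset M hs
  have := lapseSq_pos hM hs
  rw [umbilicSq]; positivity

lemma contDiffOn_umbilicSq (M K : ℝ) : ContDiffOn ℝ ∞ (umbilicSq M K) (Ioi 0) :=
  (contDiffOn_lapseSq M).add (contDiffOn_const.mul contDiffOn_id)

lemma contDiffOn_umbilicSlope (hM : 0 < M) : ContDiffOn ℝ ∞ (umbilicSlope M K) (Ioi (4 * M ^ 2)) :=
  contDiffOn_const.div ((((contDiffOn_umbilicSq M K).mono (Ioi_exterior_subset M)).sqrt
    fun _ hs => (umbilicSq_pos hM hs).ne').mul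
      ((contDiffOn_lapseSq M).mono (Ioi_exterior_subset M)))
    fun _ hs => (mul_pos (Real.sqrt_pos.2 (umbilicSq_pos hM hs)) (lapseSq_pos hM hs)).ne'

/-- The height function `f` of the umbilic hypersurface, normalized to vanish at `r = R`. -/
noncomputable def umbilicHeight (M K R r : ℝ) : ℝ := ∫ t in R..r, t * umbilicSlope M K (t ^ 2)

lemma sq_exterior {r : ℝ} (hM : 0 < M) (hr : 2 * M < r) : 4 * M ^ 2 < r ^ 2 := by nlinarith

lemma contDiffOn_umbilicHeight_integrand (hM : 0 < M) :
    ContDiffOn ℝ ∞ (fun t => t * umbilicSlope M K (t ^ 2)) (Ioi (2 * M)) :=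
  contDiffOn_id.mul ((contDiffOn_umbilicSlope hM).comp (contDiffOn_id.pow 2)
    fun _ ht => sq_exterior hM ht)

variable {R r : ℝ}

lemma umbilicHeight_hasDerivAt (hM : 0 < M) (hR : 2 * M < R) (hr : 2 * M < r) :
    HasDerivAt (umbilicHeight M K R) (r * umbilicSlope M K (r ^ 2)) r := by
  have hc := (contDiffOn_umbilicHeight_integrand (K := K) hM).continuousOn
  refine intervalIntegral.integral_hasDerivAt_right ?_
    (hc.stronglyMeasurableAtFilter isOpen_Ioi r hr)
    (hc.continuousAt (Ioi_mem_nhds hr))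
  refine (hc.mono fun t ht => ?_).intervalIntegrable
  exact lt_of_lt_of_le (lt_min hR hr) ht.1

lemma contDiffOn_umbilicHeight (hM : 0 < M) (hR : 2 * M < R) :
    ContDiffOn ℝ ∞ (umbilicHeight M K R) (Ioi (2 * M)) := by
  rw [contDiffOn_infty_iff_deriv_of_isOpen isOpen_Ioi]
  exact ⟨fun r hr => (umbilicHeight_hasDerivAt hM hR hr).differentiableAt.differentiableWithinAt,
    (contDiffOn_umbilicHeight_integrand hM).congr
      fun r hr => (umbilicHeight_hasDerivAt hM hR hr).deriv⟩

/-- The slope of the hypersurface approaches that of the outgoing null cone fast enough for the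
retarded time to converge. -/
lemma umbilicHeight_reachesNullInfinity (hM : 0 < M) (hK : 0 < K) (hR : 2 * M < R) :
    ReachesNullInfinity M (umbilicHeight M K R) := by
  set D : ℝ → ℝ :=
    fun r => umbilicHeight M K R r - 1 * (r + 2 * M * Real.log (r / (2 * M) - 1)) with hD
  set D' : ℝ → ℝ := fun r => r * umbilicSlope M K (r ^ 2) - (lapseSq M (r ^ 2))⁻¹ with hD'
  have hR0 : 0 < R := by linarith
  have hder : ∀ r ∈ Ioi R, HasDerivAt D (D' r) r := by
    intro r hr
    have hr : R < r := hr
    have hr0 : 0 < r := by linarith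
    have h1 : 0 < r / (2 * M) - 1 := by
      rw [sub_pos, one_lt_div (by linarith)]; linarith
    have h2 : HasDerivAt (fun r => r / (2 * M) - 1) (1 / (2 * M)) r :=
      ((hasDerivAt_id' r).div_const _).sub_const 1
    have h3 := (umbilicHeight_hasDerivAt (K := K) hM hR (hR.trans hr)).fun_sub
      (((hasDerivAt_id' r).fun_add ((h2.log h1.ne').const_mul (2 * M))).const_mul 1)
    refine h3.congr_deriv ?_
    simp only [hD', lapseSq, Real.sqrt_sq hr0.le]
    congr 1
    have h4 : r - 2 * M ≠ 0 := by linarith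
    field_simp
    ring
  have hval : ∀ r ∈ Ioi R, ‖D' r‖ ≤ (K ^ 2)⁻¹ * r ^ (-2 : ℝ) := by
    intro r hr
    have hr : R < r := hr
    have hr0 : 0 < r := by linarith
    have hs := sq_exterior hM (hR.trans hr)
    have hV := lapseSq_pos hM hs
    have hlam := umbilicSq_pos (K := K) hM hs
    set l := Real.sqrt (umbilicSq M K (r ^ 2)) with hl
    have hl0 : 0 < l := Real.sqrt_pos.2 hlam
    have hl2 : l ^ 2 = lapseSq M (r ^ 2) + K ^ 2 * r ^ 2 := Real.sq_sqrt hlam.le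
    have hKr : K * r ≤ l := by
      rw [hl]
      refine Real.le_sqrt_of_sq_le ?_
      rw [umbilicSq, mul_pow]
      linarith
    -- `f' - 1/V = (K r - λ)/(λ V)` and `λ² - K² r² = V`
    have e : D' r = -1 / (l * (l + K * r)) := by
      simp only [hD', umbilicSlope, ← hl]
      have : l + K * r ≠ 0 := by positivity
      field_simp
      nlinarith
    have hb : (K ^ 2 * r ^ 2) ≤ l * (l + K * r) := by
      have : 0 < K * r := by positivity
      nlinarith
    rw [e, norm_div, norm_neg, norm_one, Real.norm_of_nonneg (by positivity), Real.rpow_neg hr0.le,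
      ← mul_inv, one_div]
    refine inv_anti₀ (by positivity) ?_
    rw [show r ^ (2 : ℝ) = r ^ 2 from mod_cast Real.rpow_natCast r 2]
    exact hb
  have hint : MeasureTheory.IntegrableOn D' (Ioi R) := by
    refine MeasureTheory.Integrable.mono'
      ((integrableOn_Ioi_rpow_of_lt (by norm_num : (-2 : ℝ) < -1) hR0).const_mul (K ^ 2)⁻¹) ?_
      ((MeasureTheory.ae_restrict_iff' measurableSet_Ioi).2 (Eventually.of_forall hval))
    refine ContinuousOn.aestronglyMeasurable ?_ measurableSet_Ioi
    refine ((contDiffOn_umbilicHeight_integrand (K := K) hM).continuousOn.mono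
      (Ioi_subset_Ioi hR.le)).sub ?_
    have : ContinuousOn (fun s => (lapseSq M s)⁻¹) (Ioi (4 * M ^ 2)) :=
      (((contDiffOn_lapseSq M).mono (Ioi_exterior_subset M)).inv
        fun _ hs => (lapseSq_pos hM hs).ne').continuousOn
    exact this.comp (by fun_prop) fun r hr => sq_exterior hM (hR.trans hr)
  exact ⟨1, _, Or.inl rfl,
    MeasureTheory.tendsto_limUnder_of_hasDerivAt_of_integrableOn_Ioi hder hint⟩

/-- The future unit normal of the umbilic hypersurface. -/
noncomputable def umbilicNormal (M K : ℝ) (x : Coord 3) : Coord 4 :=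
  WithLp.toLp 2 (Fin.cons (Real.sqrt (umbilicSq M K (‖x‖ ^ 2)) / lapseSq M (‖x‖ ^ 2))
    (fun i => K * x i))

variable {x : Coord 3} {f : ℝ → ℝ}

lemma radialGraph_zero (f : ℝ → ℝ) (x : Coord 3) : radialGraph f x 0 = f ‖x‖ := rfl

lemma radialGraph_succ (f : ℝ → ℝ) (x : Coord 3) (i : Fin 3) : radialGraph f x i.succ = x i := rfl

lemma spaceSq_radialGraph (f : ℝ → ℝ) (x : Coord 3) : spaceSq (radialGraph f x) = ‖x‖ ^ 2 := by
  simp only [spaceSq, radialGraph_succ, EuclideanSpace.real_norm_sq_eq]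

lemma pderiv_radialGraph_zero {g : ℝ → ℝ} (hx : x ≠ 0)
    (hf : HasDerivAt f (‖x‖ * g (‖x‖ ^ 2)) ‖x‖) (i : Fin 3) :
    pderiv i (fun y => radialGraph f y 0) x = g (‖x‖ ^ 2) * x i := by
  have hn : 0 < ‖x‖ := norm_pos_iff.2 hx
  have e : (fun y => radialGraph f y 0) = fun y : Coord 3 => (f ∘ Real.sqrt) (‖y‖ ^ 2) := by
    funext y
    simp [radialGraph_zero]
  have h : HasDerivAt (f ∘ Real.sqrt) (g (‖x‖ ^ 2) / 2) (‖x‖ ^ 2) := by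
    have h1 := Real.hasDerivAt_sqrt (x := ‖x‖ ^ 2) (by positivity)
    have hs : Real.sqrt (‖x‖ ^ 2) = ‖x‖ := Real.sqrt_sq hn.le
    have h2 : HasDerivAt f (‖x‖ * g (‖x‖ ^ 2)) (Real.sqrt (‖x‖ ^ 2)) := by rwa [hs]
    refine (h2.comp _ h1).congr_deriv ?_
    rw [hs]
    field_simp
  rw [e, pderiv_radial h]
  ring

lemma pderiv_radialGraph_succ (i k : Fin 3) (x : Coord 3) :
    pderiv i (fun y => radialGraph f y k.succ) x = if i = k then 1 else 0 :=
  pderiv_coord i k x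

end Schwarzschild

/-! ### The geometry of the umbilic hypersurfaces -/

section Umbilic

variable {M K R : ℝ} {x : Coord 3} {β : ℝ → ℝ}

/-- The second fundamental form, expressed with Christoffel symbols of the first kind. -/
lemma extrinsicCurvature_eq {G : Coord 4 → Matrix (Fin 4) (Fin 4) ℝ} {U : Set (Coord 4)}
    (h : IsMetricOn G U) {φ N : Coord 3 → Coord 4} (hx : φ x ∈ U) (i j : Fin 3) :
    extrinsicCurvature G φ N x i j
      = ∑ μ, N x μ * ((∑ ν, G (φ x) μ ν * pderiv i (pderiv j (fun y => φ y ν)) x)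
        + ∑ α, ∑ β, christoffelFirst G μ α β (φ x) * pderiv i (fun y => φ y α) x
            * pderiv j (fun y => φ y β) x) := by
  simp only [extrinsicCurvature, Matrix.of_apply]
  refine Finset.sum_congr rfl fun μ _ => ?_
  have e : ∀ α β, christoffelFirst G μ α β (φ x) = ∑ ν, G (φ x) μ ν * christoffel G ν α β (φ x) :=
    fun α β => (h.lower_christoffel hx μ α β).symm
  simp only [e, Finset.sum_mul, mul_add, Finset.mul_sum, Finset.sum_add_distrib]
  congr 1
  · exact Finset.sum_congr rfl fun ν _ => by ring
  · rw [Finset.sum_comm]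
    refine Finset.sum_congr rfl fun α _ => ?_
    rw [Finset.sum_comm]
    exact Finset.sum_congr rfl fun b _ => Finset.sum_congr rfl fun ν _ => by ring

lemma umbilicNormal_zero (M K : ℝ) (x : Coord 3) : umbilicNormal M K x 0
    = Real.sqrt (umbilicSq M K (‖x‖ ^ 2)) / lapseSq M (‖x‖ ^ 2) := rfl

lemma umbilicNormal_succ (M K : ℝ) (x : Coord 3) (i : Fin 3) :
    umbilicNormal M K x i.succ = K * x i := rfl

lemma sum_sq_coord (x : Coord 3) : ∑ i, x i * x i = ‖x‖ ^ 2 := by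
  rw [norm_sq_coord, Fin.sum_univ_three]; ring

/-- The profile `2M/r³ - K²` is that of the metric induced on the umbilic hypersurface. -/
lemma one_sub_profile (hs : 0 < ‖x‖ ^ 2)
    (hβ : β (‖x‖ ^ 2) = 2 * M / (‖x‖ ^ 2 * Real.sqrt (‖x‖ ^ 2)) - K ^ 2) :
    1 - β (‖x‖ ^ 2) * ‖x‖ ^ 2 = umbilicSq M K (‖x‖ ^ 2) := by
  have := (Real.sqrt_pos.2 hs).ne'
  rw [hβ, umbilicSq, lapseSq]
  generalize ‖x‖ ^ 2 = s at *
  field_simp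
  ring

lemma norm_sq_exterior (hM : 0 < M) (hR : 2 * M < R) (hx : R < ‖x‖) : 4 * M ^ 2 < ‖x‖ ^ 2 :=
  sq_exterior hM (hR.trans hx)

lemma ne_zero_of_exterior (hM : 0 < M) (hR : 2 * M < R) (hx : R < ‖x‖) : x ≠ 0 :=
  norm_pos_iff.1 (by linarith)

lemma radialGraph_mem_exterior (hM : 0 < M) (hR : 2 * M < R) (hx : R < ‖x‖)
    (f : ℝ → ℝ) : radialGraph f x ∈ exteriorRegion M := by
  change 4 * M ^ 2 < spaceSq _
  rw [spaceSq_radialGraph]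
  exact norm_sq_exterior hM hR hx

lemma pderiv_umbilic_zero (hM : 0 < M) (hR : 2 * M < R) (hx : R < ‖x‖) (i : Fin 3) :
    pderiv i (fun y => radialGraph (umbilicHeight M K R) y 0) x
      = umbilicSlope M K (‖x‖ ^ 2) * x i :=
  pderiv_radialGraph_zero (ne_zero_of_exterior hM hR hx)
    (umbilicHeight_hasDerivAt hM hR (hR.trans hx)) i

lemma umbilic_inducedMetric (hM : 0 < M) (hR : 2 * M < R) (hx : R < ‖x‖)
    (hβ : β (‖x‖ ^ 2) = 2 * M / (‖x‖ ^ 2 * Real.sqrt (‖x‖ ^ 2)) - K ^ 2) :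
    inducedMetric (schwarzschild M) (radialGraph (umbilicHeight M K R)) x = radialMetric β x := by
  have hs := norm_sq_exterior hM hR hx
  have hs0 : 0 < ‖x‖ ^ 2 := Ioi_exterior_subset M hs
  have hw := one_sub_profile hs0 hβ
  have hV := lapseSq_pos hM hs
  have hl := umbilicSq_pos (K := K) hM hs
  have hl2 : umbilicSq M K (‖x‖ ^ 2) = lapseSq M (‖x‖ ^ 2) + K ^ 2 * ‖x‖ ^ 2 := rfl
  have hsq := Real.sq_sqrt hl.le
  have key : schwarzschildCoeff M (‖x‖ ^ 2) - lapseSq M (‖x‖ ^ 2) * umbilicSlope M K (‖x‖ ^ 2) ^ 2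
      = β (‖x‖ ^ 2) / (1 - β (‖x‖ ^ 2) * ‖x‖ ^ 2) := by
    have hb : β (‖x‖ ^ 2) = (1 - umbilicSq M K (‖x‖ ^ 2)) / ‖x‖ ^ 2 := by
      rw [← hw, eq_div_iff hs0.ne']; ring
    rw [hw, hb, umbilicSlope, div_pow, mul_pow, hsq, schwarzschildCoeff]
    generalize umbilicSq M K (‖x‖ ^ 2) = l at *
    generalize lapseSq M (‖x‖ ^ 2) = V at *
    generalize ‖x‖ ^ 2 = s at *
    field_simp
    rw [hl2]
    ring
  ext i j
  simp only [inducedMetric, radialMetric, Matrix.of_apply, Fin.sum_univ_succ (n := 3),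
    schwarzschild_zero_zero, schwarzschild_zero_succ, schwarzschild_succ_zero,
    schwarzschild_succ_succ, pderiv_umbilic_zero hM hR hx, pderiv_radialGraph_succ,
    spaceSq_radialGraph, ← key]
  simp only [radialGraph_succ]
  simp
  ring

lemma umbilic_isFutureUnitNormal (hM : 0 < M) (hR : 2 * M < R) (hx : R < ‖x‖) :
    IsFutureUnitNormal (schwarzschild M) (radialGraph (umbilicHeight M K R)) x
      (umbilicNormal M K x) := by
  have hs := norm_sq_exterior hM hR hx
  have hs0 : 0 < ‖x‖ ^ 2 := Ioi_exterior_subset M hs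
  have hV := lapseSq_pos hM hs
  have hl := umbilicSq_pos (K := K) hM hs
  have hl2 : umbilicSq M K (‖x‖ ^ 2) = lapseSq M (‖x‖ ^ 2) + K ^ 2 * ‖x‖ ^ 2 := rfl
  have hsq := Real.sq_sqrt hl.le
  have hr := Real.sqrt_pos.2 hl
  have hn := sum_sq_coord x
  have hb : 1 + schwarzschildCoeff M (‖x‖ ^ 2) * ‖x‖ ^ 2 = (lapseSq M (‖x‖ ^ 2))⁻¹ := by
    rw [schwarzschildCoeff, div_mul_cancel₀ _ hs0.ne']; ring
  have hrow : ∀ i : Fin 3, ∑ j : Fin 3, ((if i = j then 1 else 0)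
      + schwarzschildCoeff M (‖x‖ ^ 2) * (x i * x j)) * (K * x j)
      = K * (lapseSq M (‖x‖ ^ 2))⁻¹ * x i := by
    intro i
    have : ∀ j : Fin 3, ((if i = j then 1 else 0) + schwarzschildCoeff M (‖x‖ ^ 2) * (x i * x j))
        * (K * x j) = (if i = j then K * x j else 0)
          + schwarzschildCoeff M (‖x‖ ^ 2) * K * x i * (x j * x j) := by
      intro j; split_ifs <;> ring
    simp only [this, Finset.sum_add_distrib, ← Finset.mul_sum, hn, ← hb]
    simp
    ring
  refine ⟨?_, fun i => ?_, ?_⟩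
  · simp only [Fin.sum_univ_succ (n := 3), schwarzschild_zero_zero, schwarzschild_zero_succ,
      schwarzschild_succ_zero, schwarzschild_succ_succ, spaceSq_radialGraph, radialGraph_succ,
      umbilicNormal_zero, umbilicNormal_succ]
    have : ∀ i : Fin 3, ∑ j : Fin 3, ((if i = j then 1 else 0)
        + schwarzschildCoeff M (‖x‖ ^ 2) * (x i * x j)) * (K * x i) * (K * x j)
        = K ^ 2 * (lapseSq M (‖x‖ ^ 2))⁻¹ * (x i * x i) := by
      intro i
      rw [show K ^ 2 * (lapseSq M (‖x‖ ^ 2))⁻¹ * (x i * x i)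
        = (K * x i) * (K * (lapseSq M (‖x‖ ^ 2))⁻¹ * x i) by ring, ← hrow i, Finset.mul_sum]
      exact Finset.sum_congr rfl fun j _ => by ring
    simp only [this, ← Finset.mul_sum, hn, zero_mul, Finset.sum_const_zero, add_zero, zero_add]
    generalize Real.sqrt (umbilicSq M K (‖x‖ ^ 2)) = r at *
    generalize umbilicSq M K (‖x‖ ^ 2) = l at *
    generalize lapseSq M (‖x‖ ^ 2) = V at *
    field_simp
    rw [hsq, hl2]
    ring
  · simp only [Fin.sum_univ_succ (n := 3), schwarzschild_zero_zero, schwarzschild_zero_succ,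
      schwarzschild_succ_zero, schwarzschild_succ_succ, spaceSq_radialGraph,
      umbilicNormal_zero, umbilicNormal_succ, pderiv_umbilic_zero hM hR hx,
      pderiv_radialGraph_succ]
    simp only [radialGraph_succ]
    have : ∀ k : Fin 3, ∑ j : Fin 3, ((if k = j then 1 else 0)
        + schwarzschildCoeff M (‖x‖ ^ 2) * (x k * x j)) * (K * x k) * (if i = j then 1 else 0)
        = ((if i = k then 1 else 0) + schwarzschildCoeff M (‖x‖ ^ 2) * (x i * x k))
          * (K * x k) := by
      intro k
      simp only [mul_ite, mul_one, mul_zero, Finset.sum_ite_eq, Finset.mem_univ, if_true,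
        eq_comm (a := k)]
      ring
    simp only [this, hrow, zero_mul, Finset.sum_const_zero, add_zero, zero_add]
    rw [umbilicSlope]
    field_simp
    ring
  · rw [umbilicNormal_zero]
    positivity

/-- The hypersurface is totally umbilic: `p = -K g`. -/
lemma umbilic_extrinsicCurvature (hM : 0 < M) (hR : 2 * M < R) (hx : R < ‖x‖)
    (hβ : β (‖x‖ ^ 2) = 2 * M / (‖x‖ ^ 2 * Real.sqrt (‖x‖ ^ 2)) - K ^ 2) :
    extrinsicCurvature (schwarzschild M) (radialGraph (umbilicHeight M K R)) (umbilicNormal M K) x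
      = (-K) • radialMetric β x := by
  have hs := norm_sq_exterior hM hR hx
  have hs0 : 0 < ‖x‖ ^ 2 := Ioi_exterior_subset M hs
  have hw := one_sub_profile hs0 hβ
  have hV := lapseSq_pos hM hs
  have hl := umbilicSq_pos (K := K) hM hs
  have hl2 : umbilicSq M K (‖x‖ ^ 2) = lapseSq M (‖x‖ ^ 2) + K ^ 2 * ‖x‖ ^ 2 := rfl
  have hsq := Real.sq_sqrt hl.le
  have hr := Real.sqrt_pos.2 hl
  have hn := sum_sq_coord x
  have hφ := radialGraph_mem_exterior hM hR hx (umbilicHeight M K R)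
  have hg : HasDerivAt (umbilicSlope M K) (-(umbilicSlope M K (‖x‖ ^ 2)) *
      ((deriv (lapseSq M) (‖x‖ ^ 2) + K ^ 2) / (2 * umbilicSq M K (‖x‖ ^ 2))
        + deriv (lapseSq M) (‖x‖ ^ 2) / lapseSq M (‖x‖ ^ 2))) (‖x‖ ^ 2) := by
    have h1 := lapseSq_hasDerivAt (M := M) hs
    have h2 : HasDerivAt (umbilicSq M K) (deriv (lapseSq M) (‖x‖ ^ 2) + K ^ 2 * 1) (‖x‖ ^ 2) :=
      h1.fun_add ((hasDerivAt_id' _).const_mul (K ^ 2))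
    have h3 := (hasDerivAt_const (‖x‖ ^ 2) K).fun_div ((h2.sqrt hl.ne').fun_mul h1)
      (mul_pos hr hV).ne'
    refine h3.congr_deriv ?_
    rw [umbilicSlope]
    generalize deriv (lapseSq M) (‖x‖ ^ 2) = V'
    have hl3 : umbilicSq M K (‖x‖ ^ 2) = Real.sqrt (umbilicSq M K (‖x‖ ^ 2)) ^ 2 := hsq.symm
    generalize hrr : Real.sqrt (umbilicSq M K (‖x‖ ^ 2)) = r at *
    rw [hl3]
    field_simp
    ring
  have hcoeff : deriv (schwarzschildCoeff M) (‖x‖ ^ 2) * ‖x‖ ^ 2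
      = -(deriv (lapseSq M) (‖x‖ ^ 2)) / lapseSq M (‖x‖ ^ 2) ^ 2
        - schwarzschildCoeff M (‖x‖ ^ 2) := by
    have h1 := lapseSq_hasDerivAt (M := M) hs
    have h3 : HasDerivAt (schwarzschildCoeff M) _ (‖x‖ ^ 2) :=
      ((h1.fun_inv hV.ne').sub_const 1).fun_div (hasDerivAt_id' _) hs0.ne'
    rw [h3.deriv, schwarzschildCoeff]
    generalize ‖x‖ ^ 2 = s at *
    field_simp
  have hdd : ∀ i j : Fin 3, pderiv i (pderiv j
      (fun y => radialGraph (umbilicHeight M K R) y 0)) x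
      = 2 * deriv (umbilicSlope M K) (‖x‖ ^ 2) * x i * x j
        + umbilicSlope M K (‖x‖ ^ 2) * if i = j then 1 else 0 := by
    intro i j
    have hopen : IsOpen {y : Coord 3 | R < ‖y‖} := isOpen_lt continuous_const continuous_norm
    rw [pderiv_congr (eventually_of_mem (hopen.mem_nhds hx)
      fun y hy => pderiv_umbilic_zero hM hR hy j) i,
      pderiv_mul (differentiableAt_radial hg) (by fun_prop), pderiv_radial hg, pderiv_coord,
      hg.deriv]
  have hdd' : ∀ i j k : Fin 3, pderiv i (pderiv j
      (fun y => radialGraph (umbilicHeight M K R) y k.succ)) x = 0 := by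
    intro i j k
    rw [show pderiv j (fun y => radialGraph (umbilicHeight M K R) y k.succ)
      = fun _ => if j = k then 1 else 0 from funext fun y => pderiv_radialGraph_succ j k y,
      pderiv_const]
  have hT0 : ∀ i : Fin 3, pderiv i (fun y => radialGraph (umbilicHeight M K R) y 0) x
      = umbilicSlope M K (‖x‖ ^ 2) * radialGraph (umbilicHeight M K R) x i.succ :=
    fun i => pderiv_umbilic_zero hM hR hx i
  have hT : ∀ i k : Fin 3, pderiv i (fun y => radialGraph (umbilicHeight M K R) y k.succ) x
      = if i = k then 1 else 0 := fun i k => pderiv_radialGraph_succ i k x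
  ext i j
  rw [extrinsicCurvature_eq (schwarzschild_isMetricOn hM) hφ, Fin.sum_univ_succ]
  rw [sum_christoffelFirst_zero hM hφ (umbilicSlope M K (‖x‖ ^ 2))
    (fun i μ => pderiv i (fun y => radialGraph (umbilicHeight M K R) y μ) x) hT0 hT]
  have hsucc := fun k => sum_christoffelFirst_succ hM hφ (umbilicSlope M K (‖x‖ ^ 2))
    (fun i μ => pderiv i (fun y => radialGraph (umbilicHeight M K R) y μ) x) hT0 hT k i j
  simp only [hsucc]
  simp only [Fin.sum_univ_succ (n := 3), hdd, hdd', spaceSq_radialGraph,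
    schwarzschild_zero_zero, schwarzschild_zero_succ, schwarzschild_succ_zero, umbilicNormal_zero,
    umbilicNormal_succ, mul_zero, zero_mul, Finset.sum_const_zero, add_zero, zero_add]
  simp only [radialGraph_succ]
  have e : ∀ A : ℝ, ∑ k : Fin 3, K * x k * (x k * A) = K * ‖x‖ ^ 2 * A := by
    intro A
    rw [← hn, Finset.mul_sum, Finset.sum_mul]
    exact Finset.sum_congr rfl fun _ _ => by ring
  rw [e, hg.deriv]
  simp only [Matrix.smul_apply, radialMetric, Matrix.of_apply, smul_eq_mul]
  have hb : β (‖x‖ ^ 2) = (1 - umbilicSq M K (‖x‖ ^ 2)) / ‖x‖ ^ 2 := by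
    rw [← hw, eq_div_iff hs0.ne']; ring
  rw [hw, hb]
  have hexp : K * ‖x‖ ^ 2 * ((deriv (lapseSq M) (‖x‖ ^ 2) * umbilicSlope M K (‖x‖ ^ 2) ^ 2
      + deriv (schwarzschildCoeff M) (‖x‖ ^ 2)) * (x i * x j)
      + schwarzschildCoeff M (‖x‖ ^ 2) * if i = j then 1 else 0)
      = K * ((deriv (lapseSq M) (‖x‖ ^ 2) * umbilicSlope M K (‖x‖ ^ 2) ^ 2 * ‖x‖ ^ 2
      + deriv (schwarzschildCoeff M) (‖x‖ ^ 2) * ‖x‖ ^ 2) * (x i * x j)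
      + schwarzschildCoeff M (‖x‖ ^ 2) * ‖x‖ ^ 2 * if i = j then 1 else 0) := by ring
  rw [hexp, hcoeff, umbilicSlope, schwarzschildCoeff]
  generalize deriv (lapseSq M) (‖x‖ ^ 2) = V'
  generalize (if i = j then (1 : ℝ) else 0) = d
  have hl3 : umbilicSq M K (‖x‖ ^ 2) = Real.sqrt (umbilicSq M K (‖x‖ ^ 2)) ^ 2 := hsq.symm
  -- with `V = λ² - K² r²` the remaining identity is one between rational functions of `λ` and `r²`
  generalize Real.sqrt (umbilicSq M K (‖x‖ ^ 2)) = r at *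
  have hV2 : lapseSq M (‖x‖ ^ 2) = r ^ 2 - K ^ 2 * ‖x‖ ^ 2 := by rw [← hl3, hl2]; ring
  rw [hl3]
  rw [hV2] at hV ⊢
  generalize ‖x‖ ^ 2 = s at hs0 hV ⊢
  have hV' := hV.ne'
  field_simp
  ring

/-- The profile of the metric induced on the umbilic hypersurface. -/
noncomputable def umbilicProfile (M K s : ℝ) : ℝ := 2 * M / (s * Real.sqrt s) - K ^ 2

lemma umbilicProfile_isProfileOn (hM : 0 < M) (K : ℝ) :
    IsProfileOn (umbilicProfile M K) (Ioi (4 * M ^ 2)) where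
  isOpen := isOpen_Ioi
  smooth := by
    refine ContDiffOn.sub (contDiffOn_const.div (contDiffOn_id.mul (contDiffOn_id.sqrt fun s hs =>
      ?_)) fun s hs => ?_) contDiffOn_const
    · exact (Ioi_exterior_subset M hs).ne'
    · have := Ioi_exterior_subset M hs
      exact (mul_pos this (Real.sqrt_pos.2 this)).ne'
  w_pos s hs := by
    have h0 : 0 < s := Ioi_exterior_subset M hs
    have h := umbilicSq_pos (K := K) hM hs
    have h1 := (Real.sqrt_pos.2 h0).ne'
    convert h using 1
    rw [umbilicProfile, umbilicSq, lapseSq]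
    field_simp
    ring

lemma radialMetric_posDef (hx : 0 < 1 - β (‖x‖ ^ 2) * ‖x‖ ^ 2) : (radialMetric β x).PosDef := by
  refine Matrix.PosDef.of_dotProduct_mulVec_pos ?_ fun v hv => ?_
  · ext i j
    simp [radialMetric_symm x j i]
  · have h := radialMetric_pos hx (v := WithLp.toLp 2 v) fun h0 => hv (by
      simpa using congrArg WithLp.ofLp h0)
    refine h.trans_eq ?_
    simp only [dotProduct, Matrix.mulVec, Finset.mul_sum, star_trivial]
    exact Finset.sum_congr rfl fun i _ => Finset.sum_congr rfl fun j _ => by ring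

/-- The hypersurfaces `t = f(r)` constructed above have constant mean curvature `-3K`. -/
theorem umbilic_isCMCHypersurface (hM : 0 < M) (hR : 2 * M < R) :
    IsCMCHypersurface M (-3 * K) {x | R < ‖x‖} (radialGraph (umbilicHeight M K R))
      (umbilicNormal M K) where
  mass_pos := hM
  smooth := by
    refine contDiffOn_coord_iff.2 fun μ => ?_
    refine Fin.cases ?_ (fun i => ?_) μ
    · refine (contDiffOn_umbilicHeight hM hR).comp (t := Ioi (2 * M)) (fun x hx => ?_)
        fun x hx => hR.trans hx
      exact (contDiffAt_norm ℝ (ne_zero_of_exterior hM hR hx)).contDiffWithinAt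
    · exact contDiffOn_coord i _
  injective x _ y _ h := by
    ext i
    exact congrArg (fun z : Coord 4 => z i.succ) h
  exterior x hx := by
    rw [areaRadius_eq, spaceSq_radialGraph, Real.sqrt_sq (norm_nonneg x)]
    exact hR.trans hx
  spacelike x hx := by
    rw [umbilic_inducedMetric (K := K) (β := umbilicProfile M K) hM hR hx rfl]
    exact radialMetric_posDef ((umbilicProfile_isProfileOn hM K).w_pos _
      (norm_sq_exterior hM hR hx))
  normal x hx := umbilic_isFutureUnitNormal hM hR hx
  cmc x hx := by
    have hopen : IsOpen {y : Coord 3 | R < ‖y‖} := isOpen_lt continuous_const continuous_norm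
    have hm : IsMetricOn (inducedMetric (schwarzschild M) (radialGraph (umbilicHeight M K R)))
        {y : Coord 3 | R < ‖y‖} :=
      ((umbilicProfile_isProfileOn hM K).isMetricOn.mono hopen
        fun y hy => norm_sq_exterior hM hR hy).congr
        fun y hy => umbilic_inducedMetric (K := K) (β := umbilicProfile M K) hM hR hy rfl
    rw [hm.traceCoord_smul hx (c := -K)]
    · push_cast; ring
    · rw [umbilic_extrinsicCurvature (β := umbilicProfile M K) hM hR hx rfl,
        umbilic_inducedMetric (K := K) (β := umbilicProfile M K) hM hR hx rfl]

end Umbilic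

/-! ### The ends of the manifold -/

section Ends

/-- The region `{|x| > R}` of `ℝ³`. -/
def outside (R : ℝ) : Set (Coord 3) := {x | R < ‖x‖}

lemma isOpen_outside (R : ℝ) : IsOpen (outside R) := isOpen_lt continuous_const continuous_norm

lemma isPreconnected_outside {R : ℝ} (hR : 0 ≤ R) : IsPreconnected (outside R) := by
  have hrank : 1 < Module.rank ℝ (Coord 3) := by
    rw [← Module.finrank_eq_rank, finrank_euclideanSpace_fin]
    norm_num
  have e : outside R = (fun p : ℝ × Coord 3 => p.1 • p.2) '' (Ioi R ×ˢ Metric.sphere 0 1) := by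
    ext x
    constructor
    · intro hx
      have hx0 : 0 < ‖x‖ := lt_of_le_of_lt hR hx
      refine ⟨(‖x‖, ‖x‖⁻¹ • x), ⟨hx, ?_⟩, ?_⟩
      · simp [norm_smul, hx0.ne']
      · simp [smul_smul, hx0.ne']
    · rintro ⟨⟨t, v⟩, ⟨ht, hv⟩, rfl⟩
      have ht : R < t := ht
      have hv : ‖v‖ = 1 := by simpa using hv
      simp only [outside, mem_ofPred_eq, norm_smul, hv, mul_one, Real.norm_eq_abs]
      exact ht.trans_le (le_abs_self t)
  rw [e]
  exact (isPreconnected_Ioi.prod (isPreconnected_sphere hrank 0 1)).image _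
    (continuous_fst.smul continuous_snd).continuousOn

/-- The homothety `x ↦ x / R` from `{|x| > R}` onto `{|x| > 1}`. -/
noncomputable def shrinkHomeo (R : ℝ) (hR : 0 < R) : OpenPartialHomeomorph (Coord 3) (Coord 3) where
  toFun x := R⁻¹ • x
  invFun x := R • x
  source := outside R
  target := outside 1
  map_source' x hx := by
    simp only [outside, mem_ofPred_eq, norm_smul, norm_inv, Real.norm_of_nonneg hR.le] at hx ⊢
    rwa [lt_inv_mul_iff₀ hR, mul_one]
  map_target' x hx := by
    simp only [outside, mem_ofPred_eq, norm_smul, Real.norm_of_nonneg hR.le] at hx ⊢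
    nlinarith
  left_inv' x _ := by simp [smul_smul, hR.ne']
  right_inv' x _ := by simp [smul_smul, hR.ne']
  open_source := isOpen_outside R
  open_target := isOpen_outside 1
  continuousOn_toFun := by fun_prop
  continuousOn_invFun := by fun_prop

/-- The map turning the inner end `{1 < |x| < 2}` inside out, with `|x|` going to
`1 / (|x| - 1)`. -/
noncomputable def invertHomeo : OpenPartialHomeomorph (Coord 3) (Coord 3) where
  toFun x := (‖x‖ * (‖x‖ - 1))⁻¹ • x
  invFun y := ((1 + ‖y‖⁻¹) * ‖y‖⁻¹) • y
  source := {x | 1 < ‖x‖ ∧ ‖x‖ < 2}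
  target := outside 1
  map_source' x hx := by
    obtain ⟨h1, h2⟩ := hx
    have h3 : 0 < ‖x‖ - 1 := by linarith
    have h4 : 0 < ‖x‖ := by linarith
    simp only [outside, mem_ofPred_eq, norm_smul, norm_inv, norm_mul, norm_norm,
      Real.norm_of_nonneg h3.le]
    rw [mul_inv_rev, mul_assoc, inv_mul_cancel₀ h4.ne', mul_one]
    exact (one_lt_inv₀ h3).2 (by linarith)
  map_target' y hy := by
    have hy : 1 < ‖y‖ := hy
    have h4 : 0 < ‖y‖ := by linarith
    have h5 : ‖y‖⁻¹ < 1 := inv_lt_one_of_one_lt₀ hy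
    have h6 : 0 < ‖y‖⁻¹ := by positivity
    have : ‖((1 + ‖y‖⁻¹) * ‖y‖⁻¹) • y‖ = 1 + ‖y‖⁻¹ := by
      rw [norm_smul, Real.norm_of_nonneg (by positivity), mul_assoc, inv_mul_cancel₀ h4.ne',
        mul_one]
    simp only [mem_ofPred_eq, this]
    constructor <;> linarith
  left_inv' x hx := by
    obtain ⟨h1, h2⟩ := hx
    have h3 : 0 < ‖x‖ - 1 := by linarith
    have h4 : 0 < ‖x‖ := by linarith
    have : ‖(‖x‖ * (‖x‖ - 1))⁻¹ • x‖ = (‖x‖ - 1)⁻¹ := by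
      rw [norm_smul, Real.norm_of_nonneg (by positivity), mul_inv_rev, mul_assoc,
        inv_mul_cancel₀ h4.ne', mul_one]
    simp only [this, smul_smul, inv_inv]
    convert one_smul ℝ x
    field_simp
    ring
  right_inv' y hy := by
    have hy : 1 < ‖y‖ := hy
    have h4 : 0 < ‖y‖ := by linarith
    have : ‖((1 + ‖y‖⁻¹) * ‖y‖⁻¹) • y‖ = 1 + ‖y‖⁻¹ := by
      rw [norm_smul, Real.norm_of_nonneg (by positivity), mul_assoc, inv_mul_cancel₀ h4.ne',
        mul_one]
    simp only [this, smul_smul]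
    convert one_smul ℝ y
    field_simp
    ring
  open_source := (isOpen_lt continuous_const continuous_norm).inter
    (isOpen_lt continuous_norm continuous_const)
  open_target := isOpen_outside 1
  continuousOn_toFun := by
    have h : ContinuousOn (fun x : Coord 3 => ‖x‖ * (‖x‖ - 1)) {x | 1 < ‖x‖ ∧ ‖x‖ < 2} := by
      fun_prop
    refine (h.inv₀ fun x hx => ?_).smul continuousOn_id
    have h3 : 0 < ‖x‖ - 1 := by linarith [hx.1]
    have h4 : 0 < ‖x‖ := by linarith [hx.1]
    positivity
  continuousOn_invFun := by
    have : ContinuousOn (fun y : Coord 3 => ‖y‖⁻¹) (outside 1) :=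
      ContinuousOn.inv₀ (by fun_prop) fun y hy => (zero_lt_one.trans hy).ne'
    exact ((continuousOn_const.add this).mul this).smul continuousOn_id

lemma norm_invertHomeo {x : Coord 3} (hx : 1 < ‖x‖) : ‖invertHomeo x‖ = (‖x‖ - 1)⁻¹ := by
  have h3 : 0 < ‖x‖ - 1 := by linarith
  have h4 : 0 < ‖x‖ := by linarith
  change ‖(‖x‖ * (‖x‖ - 1))⁻¹ • x‖ = _
  rw [norm_smul, Real.norm_of_nonneg (by positivity), mul_inv_rev, mul_assoc,
    inv_mul_cancel₀ h4.ne', mul_one]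

lemma norm_shrinkHomeo {R : ℝ} (hR : 0 < R) (x : Coord 3) :
    ‖shrinkHomeo R hR x‖ = R⁻¹ * ‖x‖ := by
  change ‖R⁻¹ • x‖ = _
  rw [norm_smul, norm_inv, Real.norm_of_nonneg hR.le]

lemma contDiffOn_norm_coord {U : Set (Coord 3)} (hU : ∀ x ∈ U, x ≠ 0) :
    ContDiffOn ℝ ∞ (fun x : Coord 3 => ‖x‖) U := fun x hx =>
  (contDiffAt_norm ℝ (hU x hx)).contDiffWithinAt

lemma shrinkHomeo_contDiffOn {R : ℝ} (hR : 0 < R) :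
    ContDiffOn ℝ ∞ (shrinkHomeo R hR) (shrinkHomeo R hR).source ∧
    ContDiffOn ℝ ∞ (shrinkHomeo R hR).symm (shrinkHomeo R hR).target :=
  ⟨(contDiff_id.const_smul R⁻¹).contDiffOn, (contDiff_id.const_smul R).contDiffOn⟩

lemma invertHomeo_contDiffOn :
    ContDiffOn ℝ ∞ invertHomeo invertHomeo.source ∧
    ContDiffOn ℝ ∞ invertHomeo.symm invertHomeo.target := by
  constructor
  · have hn := contDiffOn_norm_coord (U := invertHomeo.source) fun x hx =>
      norm_pos_iff.1 (zero_lt_one.trans hx.1)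
    refine ContDiffOn.smul (ContDiffOn.inv (hn.mul (hn.sub contDiffOn_const)) fun x hx => ?_)
      contDiffOn_id
    have h3 : 0 < ‖x‖ - 1 := by linarith [hx.1]
    have h4 : 0 < ‖x‖ := by linarith [hx.1]
    positivity
  · have hn := contDiffOn_norm_coord (U := invertHomeo.target) fun x hx =>
      norm_pos_iff.1 (zero_lt_one.trans hx)
    have hi := hn.inv fun x hx => (zero_lt_one.trans hx).ne'
    exact ((contDiffOn_const.add hi).mul hi).smul contDiffOn_id

variable {S : Type*} [TopologicalSpace S]

/-- The part of an end lying outside the coordinate sphere of radius `R`. -/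
def endRegion (e : OpenPartialHomeomorph S (Coord 3)) (R : ℝ) : Set S :=
  {p | p ∈ e.source ∧ R < ‖e p‖}

lemma isOpen_endRegion (e : OpenPartialHomeomorph S (Coord 3)) (R : ℝ) :
    IsOpen (endRegion e R) :=
  e.isOpen_inter_preimage (isOpen_outside R)

lemma endRegion_anti (e : OpenPartialHomeomorph S (Coord 3)) {R R' : ℝ} (h : R ≤ R') :
    endRegion e R' ⊆ endRegion e R := fun _ hp => ⟨hp.1, h.trans_lt hp.2⟩

lemma isPreconnected_endRegion {e : OpenPartialHomeomorph S (Coord 3)}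
    (he : e.target = outside 1) {R : ℝ} (hR : 1 ≤ R) : IsPreconnected (endRegion e R) := by
  have : endRegion e R = e.symm '' outside R := by
    have h : outside R ⊆ e.target := he ▸ fun x hx => hR.trans_lt hx
    rw [e.symm.image_eq_target_inter_inv_preimage h]
    rfl
  rw [this]
  refine (isPreconnected_outside (by linarith)).image _ (e.continuousOn_symm.mono ?_)
  exact he ▸ fun x hx => hR.trans_lt hx

lemma trans_target_eq {e : OpenPartialHomeomorph S (Coord 3)}
    {ψ : OpenPartialHomeomorph (Coord 3) (Coord 3)} (h : ψ.source ⊆ e.target) :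
    (e.trans ψ).target = ψ.target := by
  rw [OpenPartialHomeomorph.trans_target]
  exact inter_eq_left.2 fun x hx => h (ψ.map_target hx)

lemma mem_endRegion_shrink {e : OpenPartialHomeomorph S (Coord 3)} {R r : ℝ} (hR : 0 < R)
    (hr : 1 ≤ r) {p : S} :
    p ∈ endRegion (e.trans (shrinkHomeo R hR)) r ↔ p ∈ endRegion e (R * r) := by
  simp only [endRegion, mem_ofPred_eq, OpenPartialHomeomorph.trans_source, mem_inter_iff,
    mem_preimage, OpenPartialHomeomorph.coe_trans, Function.comp_apply, norm_shrinkHomeo,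
    lt_inv_mul_iff₀ hR]
  refine ⟨fun h => ⟨h.1.1, h.2⟩, fun h => ⟨⟨h.1, ?_⟩, h.2⟩⟩
  exact lt_of_le_of_lt (by nlinarith) h.2

variable [ChartedSpace (Coord 3) S]

/-- A finite system of disjoint ends of `S`, each of them diffeomorphic to `{|x| > 1}`, whose
complement becomes compact when the ends are truncated. Nothing is said about the behaviour of the
ends as `|x| → ∞`: they may close up in `S`. -/
structure IsWeakEndSystem {ι : Type*} (e : ι → OpenPartialHomeomorph S (Coord 3)) : Prop where
  smooth : ∀ i, e i ∈ IsManifold.maximalAtlas (𝓡 3) ∞ S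
  target : ∀ i, (e i).target = outside 1
  disjoint : Pairwise fun i j => Disjoint (e i).source (e j).source
  compact : ∀ R, 1 < R → IsCompact (⋃ i, endRegion (e i) R)ᶜ

/-- A system of ends which go off to infinity in `S`: the sets `{|x| ≥ R}` are closed not only in
the end but in `S`. -/
structure IsProperEndSystem {ι : Type*} (e : ι → OpenPartialHomeomorph S (Coord 3)) : Prop
    extends IsWeakEndSystem e where
  closed : ∀ i R, 1 < R → IsClosed {p | p ∈ (e i).source ∧ R ≤ ‖e i p‖}

lemma trans_mem_maximalAtlas [IsManifold (𝓡 3) ∞ S] {e : OpenPartialHomeomorph S (Coord 3)}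
    (he : e ∈ IsManifold.maximalAtlas (𝓡 3) ∞ S) {ψ : OpenPartialHomeomorph (Coord 3) (Coord 3)}
    (hψ : ContDiffOn ℝ ∞ ψ ψ.source) (hψ' : ContDiffOn ℝ ∞ ψ.symm ψ.target) :
    e.trans ψ ∈ IsManifold.maximalAtlas (𝓡 3) ∞ S := by
  refine (e.trans ψ).mem_maximalAtlas_of_contMDiffOn ?_ ?_
  · rw [OpenPartialHomeomorph.coe_trans, OpenPartialHomeomorph.trans_source]
    exact hψ.contMDiffOn.comp ((contMDiffOn_of_mem_maximalAtlas he).mono inter_subset_left)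
      fun x hx => hx.2
  · rw [OpenPartialHomeomorph.coe_trans_symm, OpenPartialHomeomorph.trans_target]
    exact (contMDiffOn_symm_of_mem_maximalAtlas he).comp
      (hψ'.contMDiffOn.mono inter_subset_left) fun x hx => hx.2

variable (S) in
/-- An asymptotically flat manifold has a weak system of ends: the two ends of each of the given
spherical shells are treated separately. -/
lemma exists_weakEndSystem [IsManifold (𝓡 3) ∞ S] (hS : IsAsymptoticallyFlat S) :
    ∃ (ι : Type) (_ : Finite ι) (e : ι → OpenPartialHomeomorph S (Coord 3)),
      IsWeakEndSystem e := by
  obtain ⟨C, n, e, he, ht⟩ := hS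
  have ht' : ∀ i, (e i).target = outside 1 := fun i => by
    rw [ht i]; ext x; simp [outside]
  set ψ : Bool → OpenPartialHomeomorph (Coord 3) (Coord 3) := fun b =>
    if b then invertHomeo else shrinkHomeo 2 two_pos with hψ
  have hs : ∀ b, (ψ b).source ⊆ outside 1 := by
    rintro (_ | _) x hx
    · exact one_lt_two.trans (show (2 : ℝ) < ‖x‖ from hx)
    · exact hx.1
  have htar : ∀ b, (ψ b).target = outside 1 := by rintro (_ | _) <;> rfl
  have hd : Disjoint (ψ true).source (ψ false).source :=
    Set.disjoint_left.2 fun x hx hx' => lt_asymm hx.2 hx'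
  refine ⟨Fin n × Bool, inferInstance, fun k => (e k.1).trans (ψ k.2), ⟨?_, ?_, ?_, ?_⟩⟩
  · rintro ⟨i, _ | _⟩
    · exact trans_mem_maximalAtlas (he.smooth i) (shrinkHomeo_contDiffOn two_pos).1
        (shrinkHomeo_contDiffOn two_pos).2
    · exact trans_mem_maximalAtlas (he.smooth i) invertHomeo_contDiffOn.1 invertHomeo_contDiffOn.2
  · rintro ⟨i, b⟩
    rw [trans_target_eq ((hs b).trans (ht' i).ge), htar]
  · rintro ⟨i, b⟩ ⟨j, c⟩ hne
    rw [Set.disjoint_left]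
    rintro p hp hp'
    simp only [OpenPartialHomeomorph.trans_source, mem_inter_iff, mem_preimage] at hp hp'
    by_cases hij : i = j
    · subst hij
      have hbc : b ≠ c := fun h => hne (by rw [h])
      rcases b with _ | _ <;> rcases c with _ | _
      · exact hbc rfl
      · exact Set.disjoint_left.1 hd hp'.2 hp.2
      · exact Set.disjoint_left.1 hd hp.2 hp'.2
      · exact hbc rfl
    · exact Set.disjoint_left.1 (he.disjoint hij) hp.1 hp'.1
  · intro R hR
    have hR0 : 0 < R := by linarith
    set A : Set (Coord 3) := {x | 1 + R⁻¹ ≤ ‖x‖ ∧ ‖x‖ ≤ 2 * R} with hA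
    have hAc : IsCompact A := by
      refine (isCompact_closedBall (0 : Coord 3) (2 * R)).of_isClosed_subset ?_ fun x hx => ?_
      · exact (isClosed_le continuous_const continuous_norm).inter
          (isClosed_le continuous_norm continuous_const)
      · simpa using hx.2
    have hRi : 0 < R⁻¹ := by positivity
    have hAt : ∀ i, A ⊆ (e i).target := fun i x hx => by
      rw [ht' i]
      exact lt_of_lt_of_le (by linarith) hx.1
    have key : (⋃ k : Fin n × Bool, endRegion ((e k.1).trans (ψ k.2)) R)ᶜ
        = C ∪ ⋃ i, (e i).symm '' A := by
      ext p
      have hcov : p ∈ C ↔ ¬ ∃ i, p ∈ (e i).source := by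
        rw [← mem_iUnion, he.cover, mem_compl_iff, not_not]
      rw [mem_compl_iff, mem_union, mem_iUnion, mem_iUnion, hcov]
      simp only [Prod.exists, Bool.exists_bool]
      have h1 : ∀ i, p ∈ endRegion ((e i).trans (ψ false)) R
          ↔ p ∈ (e i).source ∧ 2 * R < ‖e i p‖ := fun i =>
        mem_endRegion_shrink two_pos hR.le
      have h2 : ∀ i, p ∈ endRegion ((e i).trans (ψ true)) R
          ↔ p ∈ (e i).source ∧ ‖e i p‖ < 1 + R⁻¹ := by
        intro i
        have hlt : ∀ q, q ∈ (e i).source → 1 < ‖e i q‖ := fun q hq => by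
          have := (e i).map_source hq
          rwa [ht' i] at this
        change (p ∈ (e i).source ∧ (1 < ‖e i p‖ ∧ ‖e i p‖ < 2)) ∧ R < ‖invertHomeo (e i p)‖ ↔ _
        constructor
        · rintro ⟨⟨hp, h1, h2⟩, h3⟩
          refine ⟨hp, ?_⟩
          rw [norm_invertHomeo h1, lt_inv_comm₀ hR0 (by linarith)] at h3
          linarith
        · rintro ⟨hp, h3⟩
          have h1 := hlt p hp
          have : R⁻¹ < 1 := inv_lt_one_of_one_lt₀ hR
          refine ⟨⟨hp, h1, by linarith⟩, ?_⟩
          rw [norm_invertHomeo h1, lt_inv_comm₀ hR0 (by linarith)]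
          linarith
      have h3 : ∀ i, p ∈ (e i).symm '' A ↔ p ∈ (e i).source ∧ e i p ∈ A := by
        intro i
        rw [(e i).symm.image_eq_target_inter_inv_preimage (hAt i)]
        rfl
      rw [exists_congr h3]
      simp only [h1, h2, hA, mem_ofPred_eq]
      constructor
      · intro h
        by_cases hp : ∃ i, p ∈ (e i).source
        · obtain ⟨i, hi⟩ := hp
          refine Or.inr ⟨i, hi, ?_⟩
          by_contra hcon
          rw [not_and_or, not_le, not_le] at hcon
          exact h ⟨i, hcon.elim (fun h => Or.inr ⟨hi, h⟩) fun h => Or.inl ⟨hi, h⟩⟩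
        · exact Or.inl hp
      · rintro (h | ⟨i, hi, h4, h5⟩) ⟨j, h6⟩
        · exact h ⟨j, h6.elim And.left And.left⟩
        · have hij : i = j := by
            by_contra hij
            exact Set.disjoint_left.1 (he.disjoint hij) hi (h6.elim And.left And.left)
          subst hij
          rcases h6 with h6 | h6 <;> linarith [h6.2]
    rw [key]
    exact he.compact.union (isCompact_iUnion fun i =>
      hAc.image_of_continuousOn ((e i).continuousOn_symm.mono (hAt i)))

/-- Discarding the ends which close up in `S` leaves a proper system of ends. For a compact
neighbourhood `W` of the complement of the truncated ends, each end is, far enough out, either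
contained in `W`, and can be discarded, or disjoint from `W`. -/
lemma IsWeakEndSystem.exists_proper [T2Space S] [IsManifold (𝓡 3) ∞ S] {ι : Type} [Finite ι]
    {e : ι → OpenPartialHomeomorph S (Coord 3)} (he : IsWeakEndSystem e) :
    ∃ (κ : Type) (_ : Finite κ) (e' : κ → OpenPartialHomeomorph S (Coord 3)),
      IsProperEndSystem e' := by
  have : LocallyCompactSpace S := ChartedSpace.locallyCompactSpace (Coord 3) S
  obtain ⟨W, hW, hCW⟩ := exists_compact_superset (he.compact 2 one_lt_two)
  have hF : frontier W ⊆ ⋃ i, endRegion (e i) 2 := by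
    intro p hp
    by_contra hcon
    exact hp.2 (hCW hcon)
  have hFc : IsCompact (frontier W) := hW.of_isClosed_subset isClosed_frontier
    (hW.isClosed.frontier_subset)
  -- the coordinate radius is bounded on the compact frontier
  have hbound : ∀ i, ∃ r : ℝ, ∀ p ∈ frontier W, p ∈ (e i).source → ‖e i p‖ ≤ r := by
    intro i
    have hK : IsCompact (frontier W \ ⋃ j ∈ {j | j ≠ i}, endRegion (e j) 2) :=
      hFc.diff (isOpen_biUnion fun j _ => isOpen_endRegion _ _)
    have hsub : (frontier W \ ⋃ j ∈ {j | j ≠ i}, endRegion (e j) 2) ⊆ (e i).source := by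
      rintro p ⟨hp, hp'⟩
      obtain ⟨j, hj⟩ := mem_iUnion.1 (hF hp)
      by_cases hji : j = i
      · exact hji ▸ hj.1
      · exact absurd (mem_biUnion (show j ∈ {j | j ≠ i} from hji) hj) hp'
    obtain ⟨r, hr⟩ := (hK.image_of_continuousOn
      ((e i).continuousOn.mono hsub)).isBounded.exists_norm_le
    refine ⟨r, fun p hp hpi => hr _ ⟨p, ⟨hp, fun hcon => ?_⟩, rfl⟩⟩
    obtain ⟨j, hj, hpj⟩ := mem_iUnion₂.1 hcon
    exact Set.disjoint_left.1 (he.disjoint hj) hpj.1 hpi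
  choose r hr using hbound
  obtain ⟨r0, hr0⟩ := Finite.exists_le r
  set Q := max r0 2 with hQ
  have hQ2 : 2 ≤ Q := le_max_right _ _
  have hQ0 : 0 < Q := by linarith
  have hdisj : ∀ i, ∀ p ∈ endRegion (e i) Q, p ∉ frontier W := fun i p hp hpF => by
    have h1 := hr i p hpF hp.1
    have h2 := hp.2
    have h3 := (hr0 i).trans (le_max_left r0 2)
    linarith
  -- by connectedness each truncated end lies inside or outside of `W`
  have hdich : ∀ i, endRegion (e i) Q ⊆ interior W ∨ endRegion (e i) Q ⊆ Wᶜ := by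
    intro i
    refine IsPreconnected.subset_or_subset isOpen_interior hW.isClosed.isOpen_compl
      (disjoint_compl_right.mono_left interior_subset) (fun p hp => ?_)
      (isPreconnected_endRegion (he.target i) (by linarith))
    by_cases hpW : p ∈ W
    · by_contra hcon
      exact hdisj i p hp ⟨subset_closure hpW, fun h => hcon (Or.inl h)⟩
    · exact Or.inr hpW
  have hsrc : ∀ i, (shrinkHomeo Q hQ0).source ⊆ (e i).target := fun i x hx => by
    rw [he.target i]
    exact lt_trans (show (1 : ℝ) < Q by linarith) hx
  refine ⟨{i // endRegion (e i) Q ⊆ Wᶜ}, inferInstance,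
    fun i => (e i.1).trans (shrinkHomeo Q hQ0), ⟨⟨fun i => ?_, fun i => ?_, ?_, fun R hR => ?_⟩,
    fun i R hR => ?_⟩⟩
  · exact trans_mem_maximalAtlas (he.smooth i.1) (shrinkHomeo_contDiffOn hQ0).1
      (shrinkHomeo_contDiffOn hQ0).2
  · rw [trans_target_eq (hsrc i.1)]
    rfl
  · intro i j hij
    refine (he.disjoint fun h => hij (Subtype.ext h)).mono ?_ ?_ <;>
    · rw [OpenPartialHomeomorph.trans_source]
      exact inter_subset_left
  · refine ((he.compact (Q * R) (by nlinarith)).union hW).of_isClosed_subset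
      (isOpen_iUnion fun i => isOpen_endRegion _ _).isClosed_compl fun p hp => ?_
    by_contra hcon
    rw [mem_union, not_or, mem_compl_iff, not_not] at hcon
    obtain ⟨i, hi⟩ := mem_iUnion.1 hcon.1
    have hiQ : p ∈ endRegion (e i) Q := endRegion_anti (e i) (by nlinarith) hi
    have hreal : endRegion (e i) Q ⊆ Wᶜ := (hdich i).resolve_left fun h =>
      hcon.2 (interior_subset (h hiQ))
    exact hp (mem_iUnion.2 ⟨⟨i, hreal⟩, (mem_endRegion_shrink hQ0 hR.le).2 hi⟩)
  · have hset : {p | p ∈ ((e i.1).trans (shrinkHomeo Q hQ0)).source ∧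
        R ≤ ‖((e i.1).trans (shrinkHomeo Q hQ0)) p‖}
        = {p | p ∈ (e i.1).source ∧ Q * R ≤ ‖e i.1 p‖} := by
      ext p
      simp only [mem_ofPred_eq, OpenPartialHomeomorph.trans_source, mem_inter_iff,
        mem_preimage, OpenPartialHomeomorph.coe_trans, Function.comp_apply, norm_shrinkHomeo,
        le_inv_mul_iff₀ hQ0]
      refine ⟨fun h => ⟨h.1.1, h.2⟩, fun h => ⟨⟨h.1, ?_⟩, h.2⟩⟩
      exact lt_of_lt_of_le (show Q < Q * R by nlinarith) h.2
    rw [hset]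
    set A := {p | p ∈ (e i.1).source ∧ Q * R ≤ ‖e i.1 p‖} with hA
    have hAQ : A ⊆ endRegion (e i.1) Q := fun p hp =>
      ⟨hp.1, lt_of_lt_of_le (show Q < Q * R by nlinarith) hp.2⟩
    refine isClosed_of_closure_subset fun p hp => ?_
    have hpW : p ∉ interior W := by
      have : closure A ⊆ (interior W)ᶜ := closure_minimal
        ((hAQ.trans i.2).trans (compl_subset_compl.2 interior_subset))
        isOpen_interior.isClosed_compl
      exact this hp
    have hpC : p ∈ ⋃ j, endRegion (e j) 2 := by
      by_contra hcon
      exact hpW (hCW hcon)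
    obtain ⟨j, hj⟩ := mem_iUnion.1 hpC
    obtain ⟨q, hqj, hqA⟩ := mem_closure_iff.1 hp _ (isOpen_endRegion _ _) hj
    have hji : j = i.1 := by
      by_contra hji
      exact Set.disjoint_left.1 (he.disjoint hji) hqj.1 hqA.1
    subst hji
    refine ⟨hj.1, ?_⟩
    by_contra hlt
    rw [not_le] at hlt
    have hopen : IsOpen ((e i.1).source ∩ (e i.1) ⁻¹' {x | ‖x‖ < Q * R}) :=
      (e i.1).isOpen_inter_preimage (isOpen_lt continuous_norm continuous_const)
    obtain ⟨q', hq', hq'A⟩ := mem_closure_iff.1 hp _ hopen ⟨hj.1, hlt⟩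
    exact absurd hq'A.2 (not_le.2 hq'.2)

end Ends

/-! ### Tensor fields on the manifold and their components in charts -/

section Components

open scoped Matrix

variable {S : Type*} [TopologicalSpace S] {e e' : OpenPartialHomeomorph S (Coord 3)}

/-- The transition map from the chart `e` to the chart `e'`. -/
def transition (e e' : OpenPartialHomeomorph S (Coord 3)) (y : Coord 3) : Coord 3 := e' (e.symm y)

/-- The domain of the transition map from `e` to `e'`, as a subset of the target of `e`. -/
def overlap (e e' : OpenPartialHomeomorph S (Coord 3)) : Set (Coord 3) :=
  e.target ∩ e.symm ⁻¹' e'.source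

lemma isOpen_overlap (e e' : OpenPartialHomeomorph S (Coord 3)) : IsOpen (overlap e e') :=
  e.symm.isOpen_inter_preimage e'.open_source

lemma transition_mapsTo : MapsTo (transition e e') (overlap e e') (overlap e' e) := fun y hy => by
  refine ⟨e'.map_source hy.2, ?_⟩
  change e'.symm (e' (e.symm y)) ∈ e.source
  rw [e'.left_inv hy.2]
  exact e.map_target hy.1

lemma symm_transition {y : Coord 3} (hy : y ∈ overlap e e') :
    e'.symm (transition e e' y) = e.symm y := e'.left_inv hy.2

variable [ChartedSpace (Coord 3) S]

lemma contMDiffAt_real_iff (he : e ∈ IsManifold.maximalAtlas (𝓡 3) ∞ S) {f : S → ℝ} {x : S}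
    (hx : x ∈ e.source) :
    ContMDiffAt (𝓡 3) 𝓘(ℝ, ℝ) ∞ f x ↔ ContDiffAt ℝ ∞ (f ∘ e.symm) (e x) := by
  have h1 : ContMDiffAt (𝓡 3) (𝓡 3) ∞ e x := contMDiffAt_of_mem_maximalAtlas he hx
  have h2 : ContMDiffAt (𝓡 3) (𝓡 3) ∞ e.symm (e x) :=
    contMDiffAt_symm_of_mem_maximalAtlas he (e.map_source hx)
  constructor
  · intro h
    refine contMDiffAt_iff_contDiffAt.1 (ContMDiffAt.comp (e x) ?_ h2)
    rwa [e.left_inv hx]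
  · intro h
    refine ((contMDiffAt_iff_contDiffAt.2 h).comp x h1).congr_of_eventuallyEq ?_
    filter_upwards [e.open_source.mem_nhds hx] with y hy
    simp [e.left_inv hy]

lemma transition_smooth (he : e ∈ IsManifold.maximalAtlas (𝓡 3) ∞ S)
    (he' : e' ∈ IsManifold.maximalAtlas (𝓡 3) ∞ S) :
    ContDiffOn ℝ ∞ (transition e e') (overlap e e') := fun y hy => by
  have h1 : ContMDiffAt (𝓡 3) (𝓡 3) ∞ e.symm y := contMDiffAt_symm_of_mem_maximalAtlas he hy.1
  have h2 : ContMDiffAt (𝓡 3) (𝓡 3) ∞ e' (e.symm y) := contMDiffAt_of_mem_maximalAtlas he' hy.2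
  exact (contMDiffAt_iff_contDiffAt.1 (h2.comp y h1)).contDiffWithinAt

lemma mdifferentiableAt_symm (he : e ∈ IsManifold.maximalAtlas (𝓡 3) ∞ S) {y : Coord 3}
    (hy : y ∈ e.target) : MDifferentiableAt (𝓡 3) (𝓡 3) e.symm y :=
  (contMDiffAt_symm_of_mem_maximalAtlas he hy).mdifferentiableAt (by simp)

variable {b : ∀ x : S, TangentSpace (𝓡 3) x →L[ℝ] TangentSpace (𝓡 3) x →L[ℝ] ℝ}

/-- The chart bases of two charts are related by the Jacobian matrix of the transition map. -/
lemma mfderiv_symm_transition (he : e ∈ IsManifold.maximalAtlas (𝓡 3) ∞ S)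
    (he' : e' ∈ IsManifold.maximalAtlas (𝓡 3) ∞ S) {y : Coord 3} (hy : y ∈ overlap e e') :
    ∀ v : Coord 3, (mfderiv (𝓡 3) (𝓡 3) e.symm y v : Coord 3)
      = (mfderiv (𝓡 3) (𝓡 3) e'.symm (transition e e' y) (fderiv ℝ (transition e e') y v) :
        Coord 3) := by
  intro v
  have hφ : MDifferentiableAt (𝓡 3) (𝓡 3) (transition e e') y :=
    mdifferentiableAt_iff_differentiableAt.2
      (((transition_smooth he he').contDiffAt ((isOpen_overlap e e').mem_nhds hy)).differentiableAt
        (by simp))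
  have h1 : e.symm =ᶠ[𝓝 y] e'.symm ∘ transition e e' := by
    filter_upwards [(isOpen_overlap e e').mem_nhds hy] with z hz
    exact (symm_transition hz).symm
  rw [h1.mfderiv_eq, mfderiv_comp y (mdifferentiableAt_symm he' (transition_mapsTo hy).1) hφ,
    mfderiv_eq_fderiv]
  rfl

/-- The matrix of components determines a bilinear form through its chart basis. -/
lemma chartComponents_sum (b : ∀ x : S, TangentSpace (𝓡 3) x →L[ℝ] TangentSpace (𝓡 3) x →L[ℝ] ℝ)
    (e : OpenPartialHomeomorph S (Coord 3)) (y v w : Coord 3) :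
    b (e.symm y) (mfderiv (𝓡 3) (𝓡 3) e.symm y v) (mfderiv (𝓡 3) (𝓡 3) e.symm y w)
      = ∑ i, ∑ j, chartComponents b e y i j * v i * w j := by
  have key : ∀ B : Coord 3 →L[ℝ] Coord 3 →L[ℝ] ℝ, ∀ L : Coord 3 →L[ℝ] Coord 3,
      B (L v) (L w) = ∑ i, ∑ j,
        B (L (EuclideanSpace.single i 1)) (L (EuclideanSpace.single j 1)) * v i * w j := by
    intro B L
    conv_lhs => rw [← sum_single_coord v, ← sum_single_coord w]
    simp only [map_sum, map_smul, _root_.sum_apply, _root_.smul_apply,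
      smul_eq_mul]
    simp only [Finset.mul_sum]
    rw [Finset.sum_comm]
    refine Finset.sum_congr rfl fun i _ => Finset.sum_congr rfl fun j _ => ?_
    ring
  exact key (b (e.symm y)) (mfderiv (𝓡 3) (𝓡 3) e.symm y)

lemma chartComponents_transition (he : e ∈ IsManifold.maximalAtlas (𝓡 3) ∞ S)
    (he' : e' ∈ IsManifold.maximalAtlas (𝓡 3) ∞ S) {y : Coord 3} (hy : y ∈ overlap e e') :
    chartComponents b e y = (jacobianMatrix (transition e e') y)ᵀ
      * chartComponents b e' (transition e e' y) * jacobianMatrix (transition e e') y := by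
  ext i j
  have hd : DifferentiableAt ℝ (transition e e') y :=
    ((transition_smooth he he').contDiffAt ((isOpen_overlap e e').mem_nhds hy)).differentiableAt
      (by simp)
  have hJ : ∀ a k, (fderiv ℝ (transition e e') y (EuclideanSpace.single k 1)) a
      = jacobianMatrix (transition e e') y a k := fun a k => by
    rw [fderiv_coord_apply hd]
    rfl
  have h1 : chartComponents b e y i j = b (e'.symm (transition e e' y))
      (mfderiv (𝓡 3) (𝓡 3) e'.symm (transition e e' y)
        (fderiv ℝ (transition e e') y (EuclideanSpace.single i 1)))
      (mfderiv (𝓡 3) (𝓡 3) e'.symm (transition e e' y)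
        (fderiv ℝ (transition e e') y (EuclideanSpace.single j 1))) := by
    have h2 := mfderiv_symm_transition he he' hy (EuclideanSpace.single i 1)
    have h3 := mfderiv_symm_transition he he' hy (EuclideanSpace.single j 1)
    have aux : ∀ (p q : S) (hpq : p = q) (B : ∀ x : S, Coord 3 →L[ℝ] Coord 3 →L[ℝ] ℝ)
        (v w v' w' : Coord 3), v = v' → w = w' → B p v w = B q v' w' := by
      rintro p q rfl B v w v' w' rfl rfl
      rfl
    exact aux _ _ (symm_transition hy).symm b _ _ _ _ h2 h3
  rw [h1, chartComponents_sum, Matrix.mul_apply]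
  simp only [Matrix.mul_apply, Matrix.transpose_apply, hJ, Finset.sum_mul]
  rw [Finset.sum_comm]
  refine Finset.sum_congr rfl fun i _ => Finset.sum_congr rfl fun j _ => ?_
  ring

variable [IsManifold (𝓡 3) ∞ S]

/-- A field of bilinear forms is smooth at `x`, as a section of the bundle of bilinear forms. -/
def IsSmoothFormAt (b : ∀ x : S, TangentSpace (𝓡 3) x →L[ℝ] TangentSpace (𝓡 3) x →L[ℝ] ℝ)
    (x : S) : Prop :=
  ContMDiffAt (𝓡 3) ((𝓡 3).prod 𝓘(ℝ, Coord 3 →L[ℝ] Coord 3 →L[ℝ] ℝ)) ∞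
    (fun x => TotalSpace.mk' (Coord 3 →L[ℝ] Coord 3 →L[ℝ] ℝ)
      (E := fun x : S => TangentSpace (𝓡 3) x →L[ℝ] TangentSpace (𝓡 3) x →L[ℝ] ℝ) x (b x)) x

/-- An operator valued function on `ℝ³` is smooth if its values on the standard basis are. -/
lemma contDiffAt_clm_coord_iff {F : Type*} [NormedAddCommGroup F] [NormedSpace ℝ F]
    {f : Coord 3 → Coord 3 →L[ℝ] F} {y : Coord 3} :
    ContDiffAt ℝ ∞ f y ↔
      ∀ i : Fin 3, ContDiffAt ℝ ∞ (fun z => f z (EuclideanSpace.single i 1)) y := by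
  constructor
  · exact fun h i => h.clm_apply contDiffAt_const
  · intro h
    have e : f = fun z => ∑ i, (EuclideanSpace.proj i : Coord 3 →L[ℝ] ℝ).smulRight
        (f z (EuclideanSpace.single i 1)) := by
      funext z
      ext v
      conv_lhs => rw [← sum_single_coord v]
      simp only [map_sum, map_smul, _root_.sum_apply, ContinuousLinearMap.smulRight_apply]
      rfl
    rw [e]
    exact ContDiffAt.sum fun i _ => contDiffAt_const.smulRight (h i)

/-- Smoothness of a field of bilinear forms can be read off in the preferred chart. -/
lemma isSmoothFormAt_chartAt_iff (x : S) :
    IsSmoothFormAt b x ↔ ∀ i j, ContDiffAt ℝ ∞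
      (fun y => chartComponents b (chartAt (Coord 3) x) y i j) (chartAt (Coord 3) x x) := by
  have h1 : IsSmoothFormAt b x ↔ ContMDiffAt (𝓡 3) 𝓘(ℝ, Coord 3 →L[ℝ] Coord 3 →L[ℝ] ℝ) ∞
      (fun z => ContinuousLinearMap.inCoordinates (Coord 3) (TangentSpace (𝓡 3))
        (Coord 3 →L[ℝ] ℝ) (fun z : S => TangentSpace (𝓡 3) z →L[ℝ] Trivial S ℝ z) x z x z (b z))
      x := by
    unfold IsSmoothFormAt
    rw [contMDiffAt_hom_bundle]
    exact ⟨fun h => h.2, fun h => ⟨contMDiffAt_id, h⟩⟩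
  rw [h1, contMDiffAt_iff_source_of_mem_source (mem_chart_source (Coord 3) x)]
  simp only [mfld_simps, contMDiffWithinAt_univ]
  rw [contMDiffAt_iff_contDiffAt, contDiffAt_clm_coord_iff]
  refine forall_congr' fun i => ?_
  rw [contDiffAt_clm_coord_iff]
  refine forall_congr' fun j => ?_
  refine (fun {f g : Coord 3 → ℝ} (h : f =ᶠ[𝓝 _] g) =>
    (⟨fun hf => hf.congr_of_eventuallyEq h.symm, fun hg => hg.congr_of_eventuallyEq h⟩ :
      ContDiffAt ℝ ∞ f _ ↔ ContDiffAt ℝ ∞ g _)) ?_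
  filter_upwards [(chartAt (Coord 3) x).open_target.mem_nhds
    ((chartAt (Coord 3) x).map_source (mem_chart_source (Coord 3) x))] with y hy
  have hs := (chartAt (Coord 3) x).map_target hy
  change ContinuousLinearMap.inCoordinates (Coord 3) (TangentSpace (𝓡 3))
        (Coord 3 →L[ℝ] ℝ) (fun z : S => TangentSpace (𝓡 3) z →L[ℝ] Trivial S ℝ z) x _ x _
        (b ((chartAt (Coord 3) x).symm y)) _ _ = _
  rw [inCoordinates_apply_eq₂ (by exact hs) (by exact hs) (by exact mem_univ _)]
  have hsymm : ∀ v : Coord 3, ((trivializationAt (Coord 3) (TangentSpace (𝓡 3)) x).symm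
      ((chartAt (Coord 3) x).symm y) v : TangentSpace (𝓡 3) ((chartAt (Coord 3) x).symm y))
      = mfderiv (𝓡 3) (𝓡 3) (chartAt (Coord 3) x).symm y v := fun v => by
    have h := TangentBundle.symmL_trivializationAt (𝕜 := ℝ) (I := 𝓡 3) hs
    simp only [mfld_simps, mfderivWithin_univ] at h
    have h2 := congrArg (fun L : Coord 3 →L[ℝ] Coord 3 => L v) h
    have aux : ∀ z, z = y → (mfderiv (𝓡 3) (𝓡 3) (chartAt (Coord 3) x).symm z v : Coord 3)
        = (mfderiv (𝓡 3) (𝓡 3) (chartAt (Coord 3) x).symm y v : Coord 3) := by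
      rintro _ rfl
      rfl
    exact (Trivialization.symmL_apply (R := ℝ) _ (by exact hs) v).symm.trans
      (h2.trans (aux _ ((chartAt (Coord 3) x).right_inv hy)))
  rw [hsymm, hsymm]
  simp [chartComponents]

lemma isSmoothFormAt_iff (he : e ∈ IsManifold.maximalAtlas (𝓡 3) ∞ S) {x : S}
    (hx : x ∈ e.source) :
    IsSmoothFormAt b x ↔ ∀ i j, ContDiffAt ℝ ∞ (fun y => chartComponents b e y i j) (e x) := by
  have key : ∀ e e' : OpenPartialHomeomorph S (Coord 3),
      e ∈ IsManifold.maximalAtlas (𝓡 3) ∞ S → e' ∈ IsManifold.maximalAtlas (𝓡 3) ∞ S →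
      x ∈ e.source → x ∈ e'.source →
      (∀ i j, ContDiffAt ℝ ∞ (fun y => chartComponents b e' y i j) (e' x)) →
      ∀ i j, ContDiffAt ℝ ∞ (fun y => chartComponents b e y i j) (e x) := by
    intro e e' he he' hx hx' h i j
    have hy : e x ∈ overlap e e' := ⟨e.map_source hx, by
      rw [mem_preimage, e.left_inv hx]; exact hx'⟩
    have hn := (isOpen_overlap e e').mem_nhds hy
    have hφx : transition e e' (e x) = e' x := by rw [transition, e.left_inv hx]
    have hφ := (transition_smooth he he').contDiffAt hn
    have hJ : ∀ a k, ContDiffAt ℝ ∞ (fun y => jacobianMatrix (transition e e') y a k) (e x) :=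
      fun a k => ((contDiffOn_coord_iff.1 (transition_smooth he he') a).pderiv
        (isOpen_overlap e e') k).contDiffAt hn
    have hc : ∀ a c, ContDiffAt ℝ ∞
        (fun y => chartComponents b e' (transition e e' y) a c) (e x) := fun a c => by
      refine ContDiffAt.comp (g := fun z => chartComponents b e' z a c) (e x) ?_ hφ
      rw [hφx]
      exact h a c
    have e1 : (fun y => chartComponents b e y i j) =ᶠ[𝓝 (e x)] fun y => ∑ c, (∑ a,
        jacobianMatrix (transition e e') y a i * chartComponents b e' (transition e e' y) a c)
          * jacobianMatrix (transition e e') y c j := by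
      filter_upwards [hn] with y hy
      rw [chartComponents_transition he he' hy]
      simp only [Matrix.mul_apply, Matrix.transpose_apply]
    refine ContDiffAt.congr_of_eventuallyEq ?_ e1
    exact ContDiffAt.sum fun c _ => (ContDiffAt.sum fun a _ => (hJ a i).mul (hc a c)).mul (hJ c j)
  rw [isSmoothFormAt_chartAt_iff]
  exact ⟨key _ _ he (IsManifold.chart_mem_maximalAtlas x) hx (mem_chart_source _ x),
    key _ _ (IsManifold.chart_mem_maximalAtlas x) he (mem_chart_source _ x) hx⟩

end Components

/-! ### Riemannian metrics and their scalar curvature -/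

section Metrics

/-- The bilinear form with matrix `A` in the standard basis. -/
noncomputable def matrixForm (A : Matrix (Fin 3) (Fin 3) ℝ) : Coord 3 →L[ℝ] Coord 3 →L[ℝ] ℝ :=
  ∑ i, ∑ j, A i j • (EuclideanSpace.proj i : Coord 3 →L[ℝ] ℝ).smulRight
    (EuclideanSpace.proj j : Coord 3 →L[ℝ] ℝ)

lemma matrixForm_apply (A : Matrix (Fin 3) (Fin 3) ℝ) (v w : Coord 3) :
    matrixForm A v w = ∑ i, ∑ j, A i j * v i * w j := by
  simp only [matrixForm, _root_.sum_apply, _root_.smul_apply, smul_eq_mul,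
    ContinuousLinearMap.smulRight_apply]
  refine Finset.sum_congr rfl fun i _ => Finset.sum_congr rfl fun j _ => ?_
  simp
  ring

/-- The unit ball of a positive definite form is bounded, by compactness of the unit sphere. -/
lemma isVonNBounded_of_pos {B : Coord 3 →L[ℝ] Coord 3 →L[ℝ] ℝ} (hB : ∀ v, v ≠ 0 → 0 < B v v) :
    Bornology.IsVonNBounded ℝ {v : Coord 3 | B v v < 1} := by
  rw [NormedSpace.isVonNBounded_iff]
  have hc : Continuous fun v : Coord 3 => B v v := by fun_prop
  obtain ⟨v₀, hv₀, hmin⟩ := (isCompact_sphere (0 : Coord 3) 1).exists_isMinOn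
    (NormedSpace.sphere_nonempty.2 zero_le_one) hc.continuousOn
  have hv₀' : ‖v₀‖ = 1 := by simpa using hv₀
  have hpos : 0 < B v₀ v₀ := hB v₀ (norm_pos_iff.1 (by rw [hv₀']; exact one_pos))
  refine (isBounded_iff_forall_norm_le).2 ⟨max 1 (B v₀ v₀)⁻¹, fun v hv => ?_⟩
  by_contra hlt
  rw [not_le, max_lt_iff] at hlt
  have hn : 0 < ‖v‖ := by linarith
  have h1 : B v₀ v₀ ≤ B (‖v‖⁻¹ • v) (‖v‖⁻¹ • v) := hmin (by simp [norm_smul, hn.ne'])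
  simp only [map_smul, _root_.smul_apply, smul_eq_mul] at h1
  have hv : B v v < 1 := hv
  have h2 : B v₀ v₀ * ‖v‖ ^ 2 ≤ B v v := by
    calc B v₀ v₀ * ‖v‖ ^ 2 ≤ ‖v‖⁻¹ * (‖v‖⁻¹ * B v v) * ‖v‖ ^ 2 := by gcongr
      _ = B v v := by field_simp
  have h3 : 1 < B v₀ v₀ * ‖v‖ := by
    rw [← inv_lt_iff_one_lt_mul₀' hpos]
    exact hlt.2
  nlinarith

variable {S : Type*} [TopologicalSpace S] [ChartedSpace (Coord 3) S]
  {e : OpenPartialHomeomorph S (Coord 3)} {G : Coord 3 → Matrix (Fin 3) (Fin 3) ℝ}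

/-- The differential of a chart, as an endomorphism of `ℝ³`. -/
noncomputable def chartDeriv (e : OpenPartialHomeomorph S (Coord 3)) (x : S) :
    Coord 3 →L[ℝ] Coord 3 :=
  mfderiv (𝓡 3) (𝓡 3) e x

/-- The pullback to the domain of the chart `e` of the bilinear form with components `G`. -/
noncomputable def pullbackForm (e : OpenPartialHomeomorph S (Coord 3))
    (G : Coord 3 → Matrix (Fin 3) (Fin 3) ℝ) (x : S) :
    TangentSpace (𝓡 3) x →L[ℝ] TangentSpace (𝓡 3) x →L[ℝ] ℝ :=
  ((matrixForm (G (e x))).bilinearComp (chartDeriv e x) (chartDeriv e x) :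
    Coord 3 →L[ℝ] Coord 3 →L[ℝ] ℝ)

lemma pullbackForm_apply (x : S) (v w : Coord 3) : pullbackForm e G x v w
    = ∑ i, ∑ j, G (e x) i j * chartDeriv e x v i * chartDeriv e x w j :=
  matrixForm_apply _ _ _

lemma mdifferentiable_of_mem_maximalAtlas (he : e ∈ IsManifold.maximalAtlas (𝓡 3) ∞ S) :
    e.MDifferentiable (𝓡 3) (𝓡 3) :=
  ⟨(contMDiffOn_of_mem_maximalAtlas he).mdifferentiableOn (by simp),
    (contMDiffOn_symm_of_mem_maximalAtlas he).mdifferentiableOn (by simp)⟩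

lemma chartComponents_pullbackForm (he : e ∈ IsManifold.maximalAtlas (𝓡 3) ∞ S) {y : Coord 3}
    (hy : y ∈ e.target) : chartComponents (pullbackForm e G) e y = G y := by
  ext i j
  have h : ∀ v : Coord 3, chartDeriv e (e.symm y) (mfderiv (𝓡 3) (𝓡 3) e.symm y v) = v := fun v =>
    congrArg (fun L : Coord 3 →L[ℝ] Coord 3 => L v)
      ((mdifferentiable_of_mem_maximalAtlas he).comp_symm_deriv hy)
  have h1 : chartComponents (pullbackForm e G) e y i j = _ :=
    pullbackForm_apply (e := e) (G := G) (e.symm y)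
      (mfderiv (𝓡 3) (𝓡 3) e.symm y (EuclideanSpace.single i (1 : ℝ) : Coord 3))
      (mfderiv (𝓡 3) (𝓡 3) e.symm y (EuclideanSpace.single j (1 : ℝ) : Coord 3))
  rw [h1, h, h, e.right_inv hy]
  simp

lemma pullbackForm_symm {x : S} (hG : ∀ i j, G (e x) i j = G (e x) j i) (v w : Coord 3) :
    pullbackForm e G x v w = pullbackForm e G x w v := by
  rw [pullbackForm_apply, pullbackForm_apply, Finset.sum_comm]
  refine Finset.sum_congr rfl fun i _ => Finset.sum_congr rfl fun j _ => ?_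
  rw [hG]
  ring

lemma pullbackForm_pos (he : e ∈ IsManifold.maximalAtlas (𝓡 3) ∞ S) {x : S} (hx : x ∈ e.source)
    (hG : ∀ v : Coord 3, v ≠ 0 → 0 < ∑ i, ∑ j, G (e x) i j * v i * v j) {v : Coord 3}
    (hv : v ≠ 0) : 0 < pullbackForm e G x v v := by
  rw [pullbackForm_apply]
  refine hG _ fun h => hv ?_
  have hinj := (mdifferentiable_of_mem_maximalAtlas he).mfderiv_injective hx
  exact hinj (h.trans (map_zero (mfderiv (𝓡 3) (𝓡 3) e x)).symm)

lemma pullbackForm_congr {G' : Coord 3 → Matrix (Fin 3) (Fin 3) ℝ} {x : S}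
    (h : G (e x) = G' (e x)) : pullbackForm e G x = pullbackForm e G' x := by
  unfold pullbackForm
  rw [h]

lemma chartComponents_congr
    {b b' : ∀ x : S, TangentSpace (𝓡 3) x →L[ℝ] TangentSpace (𝓡 3) x →L[ℝ] ℝ} {y : Coord 3}
    (h : b (e.symm y) = b' (e.symm y)) :
    chartComponents b e y = chartComponents b' e y := by
  unfold chartComponents
  rw [h]

variable [IsManifold (𝓡 3) ∞ S]

lemma IsSmoothFormAt.congr
    {b b' : ∀ x : S, TangentSpace (𝓡 3) x →L[ℝ] TangentSpace (𝓡 3) x →L[ℝ] ℝ} {x : S}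
    (h : IsSmoothFormAt b x) (hb : ∀ᶠ z in 𝓝 x, b' z = b z) : IsSmoothFormAt b' x := by
  refine ContMDiffAt.congr_of_eventuallyEq h ?_
  filter_upwards [hb] with z hz
  rw [hz]

lemma isSmoothFormAt_pullbackForm (he : e ∈ IsManifold.maximalAtlas (𝓡 3) ∞ S) {x : S}
    (hx : x ∈ e.source) (hG : ∀ i j, ContDiffAt ℝ ∞ (fun y => G y i j) (e x)) :
    IsSmoothFormAt (pullbackForm e G) x := by
  rw [isSmoothFormAt_iff he hx]
  intro i j
  refine (hG i j).congr_of_eventuallyEq ?_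
  filter_upwards [e.open_target.mem_nhds (e.map_source hx)] with y hy
  rw [chartComponents_pullbackForm he hy]

/-- A smooth positive definite field of symmetric bilinear forms is a Riemannian metric. -/
noncomputable def SmoothMetric.ofForm
    (b : ∀ x : S, TangentSpace (𝓡 3) x →L[ℝ] TangentSpace (𝓡 3) x →L[ℝ] ℝ)
    (hsymm : ∀ (x : S) (v w : Coord 3), b x v w = b x w v)
    (hpos : ∀ (x : S) (v : Coord 3), v ≠ 0 → 0 < b x v v)
    (hsmooth : ∀ x, IsSmoothFormAt b x) : SmoothMetric S where
  inner := b
  symm := hsymm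
  pos := hpos
  isVonNBounded x := isVonNBounded_of_pos (B := b x) (hpos x)
  contMDiff := hsmooth

lemma SmoothMetric.isSmoothFormAt (g : SmoothMetric S) (x : S) : IsSmoothFormAt g.inner x :=
  g.contMDiff x

/-- The components of a Riemannian metric in a smooth chart. -/
lemma SmoothMetric.isMetricOn (g : SmoothMetric S) (he : e ∈ IsManifold.maximalAtlas (𝓡 3) ∞ S) :
    IsMetricOn (chartComponents g.inner e) e.target where
  isOpen := e.open_target
  smooth i j y hy := by
    have h := (isSmoothFormAt_iff he (e.map_target hy)).1 (g.isSmoothFormAt _) i j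
    rw [e.right_inv hy] at h
    exact h.contDiffWithinAt
  symm y hy i j := g.symm _ _ _
  det_ne y hy h0 := by
    obtain ⟨v, hv, hv0⟩ := Matrix.exists_mulVec_eq_zero_iff.2 h0
    have hv' : (WithLp.toLp 2 v : Coord 3) ≠ 0 := fun h => hv (by
      funext i
      exact congrArg (fun u : Coord 3 => u i) h)
    have hs := chartComponents_sum g.inner e y (WithLp.toLp 2 v) (WithLp.toLp 2 v)
    have hz : ∑ i, ∑ j, chartComponents g.inner e y i j * v i * v j = 0 := by
      refine Finset.sum_eq_zero fun i _ => ?_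
      have h1 : ∑ j, chartComponents g.inner e y i j * v j = 0 := congrFun hv0 i
      calc ∑ j, chartComponents g.inner e y i j * v i * v j
          = v i * ∑ j, chartComponents g.inner e y i j * v j := by
            rw [Finset.mul_sum]
            exact Finset.sum_congr rfl fun j _ => by ring
        _ = 0 := by rw [h1, mul_zero]
    have hinj := (mdifferentiable_of_mem_maximalAtlas he).symm.mfderiv_injective (x := y) hy
    refine (g.pos (e.symm y) (mfderiv (𝓡 3) (𝓡 3) e.symm y (WithLp.toLp 2 v : Coord 3)) ?_).ne'
      (hs.trans hz)
    exact fun h => hv' (hinj (h.trans (map_zero (mfderiv (𝓡 3) (𝓡 3) e.symm y)).symm))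

/-- Transition maps are isometries between the coordinate expressions of a metric. -/
lemma SmoothMetric.isIsometryOn (g : SmoothMetric S) {e' : OpenPartialHomeomorph S (Coord 3)}
    (he : e ∈ IsManifold.maximalAtlas (𝓡 3) ∞ S) (he' : e' ∈ IsManifold.maximalAtlas (𝓡 3) ∞ S) :
    IsIsometryOn (chartComponents g.inner e) (chartComponents g.inner e') (overlap e e')
      (overlap e' e) (transition e e') where
  metric := (g.isMetricOn he).mono (isOpen_overlap e e') inter_subset_left
  metric' := (g.isMetricOn he').mono (isOpen_overlap e' e) inter_subset_left
  smooth := transition_smooth he he'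
  mapsTo := transition_mapsTo
  pullback _ hy := chartComponents_transition he he' hy

/-- The scalar curvature of a Riemannian metric, computed in the preferred chart at each point. -/
noncomputable def SmoothMetric.scalar (g : SmoothMetric S) (x : S) : ℝ :=
  scalarCoord (chartComponents g.inner (chartAt (Coord 3) x)) (chartAt (Coord 3) x x)

lemma SmoothMetric.scalar_eq (g : SmoothMetric S) (he : e ∈ IsManifold.maximalAtlas (𝓡 3) ∞ S)
    {y : Coord 3} (hy : y ∈ e.target) :
    g.scalar (e.symm y) = scalarCoord (chartComponents g.inner e) y := by
  have hmem : y ∈ overlap e (chartAt (Coord 3) (e.symm y)) := ⟨hy, mem_chart_source _ _⟩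
  rw [(g.isIsometryOn he (IsManifold.chart_mem_maximalAtlas (e.symm y))).scalarCoord_eq hmem]
  rfl

lemma SmoothMetric.scalar_smooth (g : SmoothMetric S) : ContMDiff (𝓡 3) 𝓘(ℝ, ℝ) ∞ g.scalar := by
  intro x
  have he : chartAt (Coord 3) x ∈ IsManifold.maximalAtlas (𝓡 3) ∞ S :=
    IsManifold.chart_mem_maximalAtlas x
  have hx := mem_chart_source (Coord 3) x
  rw [contMDiffAt_real_iff he hx]
  have ht := (chartAt (Coord 3) x).open_target.mem_nhds ((chartAt (Coord 3) x).map_source hx)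
  refine ((g.isMetricOn he).scalarCoord_smooth.contDiffAt ht).congr_of_eventuallyEq ?_
  filter_upwards [ht] with y hy
  exact g.scalar_eq he hy

lemma SmoothMetric.scalar_congr {g g' : SmoothMetric S} {x : S}
    (h : ∀ᶠ z in 𝓝 x, g.inner z = g'.inner z) : g.scalar x = g'.scalar x := by
  refine scalarCoord_congr ?_
  have hx := mem_chart_source (Coord 3) x
  have hc : Tendsto (chartAt (Coord 3) x).symm (𝓝 (chartAt (Coord 3) x x)) (𝓝 x) := by
    have := (chartAt (Coord 3) x).continuousAt_symm ((chartAt (Coord 3) x).map_source hx)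
    rwa [ContinuousAt, (chartAt (Coord 3) x).left_inv hx] at this
  filter_upwards [hc.eventually h] with y hy
  exact chartComponents_congr hy

end Metrics

/-! ### Metrics with prescribed form on the ends -/

section EndMetric

lemma radialMetric_of_eq_zero {β : ℝ → ℝ} {x : Coord 3} (h : β (‖x‖ ^ 2) = 0) :
    radialMetric β x = 1 := by
  ext i j
  simp [radialMetric, h, Matrix.one_apply]

lemma radialMetric_endProfile_of_le (κ : ℝ) {x : Coord 3} (h0 : 0 < ‖x‖) (h : ‖x‖ ≤ 2) :
    radialMetric (endProfile κ) x = 1 :=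
  radialMetric_of_eq_zero (endProfile_of_le (by positivity) (by nlinarith))

lemma one_quadratic_pos {v : Coord 3} (hv : v ≠ 0) :
    0 < ∑ i, ∑ j, (1 : Matrix (Fin 3) (Fin 3) ℝ) i j * v i * v j := by
  have h : ∑ i, ∑ j, (1 : Matrix (Fin 3) (Fin 3) ℝ) i j * v i * v j = ‖v‖ ^ 2 := by
    rw [norm_sq_coord]
    simp [Matrix.one_apply, Fin.sum_univ_three]
    ring
  rw [h]
  have := norm_pos_iff.2 hv
  positivity

variable {S : Type*} [TopologicalSpace S] [ChartedSpace (Coord 3) S]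
  {ι : Type*} {e : ι → OpenPartialHomeomorph S (Coord 3)}

lemma IsWeakEndSystem.eq_of_mem (h : IsWeakEndSystem e) {i j : ι} {p : S}
    (hi : p ∈ (e i).source) (hj : p ∈ (e j).source) : i = j := by
  by_contra hij
  exact Set.disjoint_left.1 (h.disjoint hij) hi hj

lemma IsWeakEndSystem.mem_target (h : IsWeakEndSystem e) (i : ι) {y : Coord 3} (hy : 1 < ‖y‖) :
    y ∈ (e i).target := by
  rw [h.target i]
  exact hy

/-- The part of the ends outside an open coordinate ball is closed. -/
lemma IsProperEndSystem.isClosed_iUnion [Finite ι] (h : IsProperEndSystem e) {R : ℝ}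
    (hR : 1 < R) : IsClosed (⋃ i, {p | p ∈ (e i).source ∧ R ≤ ‖e i p‖}) :=
  isClosed_iUnion_of_finite fun i => h.closed i R hR

/-- The inner products at `x` which are flat if `x` lies far out on one of the ends. -/
def flatForms (e : ι → OpenPartialHomeomorph S (Coord 3)) (x : S) :
    Set (TangentSpace (𝓡 3) x →L[ℝ] TangentSpace (𝓡 3) x →L[ℝ] ℝ) :=
  {b | (∀ v w : Coord 3, b v w = b w v) ∧ (∀ v : Coord 3, v ≠ 0 → 0 < b v v) ∧
    ∀ i, x ∈ (e i).source → 3 / 2 ≤ ‖e i x‖ → b = pullbackForm (e i) (fun _ => 1) x}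

lemma convex_flatForms (x : S) : Convex ℝ (flatForms e x) := by
  intro b hb c hc r s hr hs hrs
  refine ⟨fun v w => ?_, fun v hv => ?_, fun i hi hi' => ?_⟩
  · have h1 := hb.1 v w
    have h2 := hc.1 v w
    change r * b v w + s * c v w = r * b w v + s * c w v
    rw [h1, h2]
  · have h1 := hb.2.1 v hv
    have h2 := hc.2.1 v hv
    change 0 < r * b v v + s * c v v
    rcases hr.eq_or_lt with h0 | h0
    · have : s = 1 := by linarith
      rw [← h0, this]
      linarith
    · have : 0 ≤ s * c v v := by positivity
      have : 0 < r * b v v := by positivity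
      linarith
  · rw [hb.2.2 i hi hi', hc.2.2 i hi hi']
    refine ContinuousLinearMap.ext fun v => ContinuousLinearMap.ext fun w => ?_
    simp only [_root_.add_apply, _root_.smul_apply, smul_eq_mul]
    rw [← add_mul, hrs, one_mul]

lemma pullbackForm_one_mem_flatForms {e' : OpenPartialHomeomorph S (Coord 3)}
    (he' : e' ∈ IsManifold.maximalAtlas (𝓡 3) ∞ S) {x : S} (hx : x ∈ e'.source)
    (h : ∀ i, x ∈ (e i).source → 3 / 2 ≤ ‖e i x‖ → e i = e') :
    pullbackForm e' (fun _ => 1) x ∈ flatForms e x := by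
  refine ⟨fun v w => ?_, fun v hv => ?_, fun i hi hi' => ?_⟩
  · have hG : ∀ i j, (1 : Matrix (Fin 3) (Fin 3) ℝ) i j = (1 : Matrix (Fin 3) (Fin 3) ℝ) j i :=
      fun i j => by simp only [Matrix.one_apply, eq_comm]
    exact pullbackForm_symm (e := e') (G := fun _ => 1) hG v w
  · exact pullbackForm_pos (G := fun _ => 1) he' hx (fun u hu => one_quadratic_pos hu) hv
  · rw [h i hi hi']

variable [IsManifold (𝓡 3) ∞ S]

/-- Near each point there is a smooth metric which is flat on the ends. -/
lemma IsProperEndSystem.exists_local_flat [Finite ι] (h : IsProperEndSystem e) (x₀ : S) :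
    ∃ e' ∈ IsManifold.maximalAtlas (𝓡 3) ∞ S, ∃ U ∈ 𝓝 x₀, U ⊆ e'.source ∧
      ∀ x ∈ U, pullbackForm e' (fun _ => 1) x ∈ flatForms e x := by
  by_cases hx : ∃ i, x₀ ∈ (e i).source
  · obtain ⟨i, hi⟩ := hx
    refine ⟨e i, h.smooth i, (e i).source, (e i).open_source.mem_nhds hi, subset_rfl,
      fun x hx => pullbackForm_one_mem_flatForms (h.smooth i) hx fun j hj _ => ?_⟩
    rw [h.eq_of_mem hx hj]
  · have hC := (h.isClosed_iUnion (R := 3 / 2) (by norm_num)).isOpen_compl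
    have hch : chartAt (Coord 3) x₀ ∈ IsManifold.maximalAtlas (𝓡 3) ∞ S :=
      IsManifold.chart_mem_maximalAtlas x₀
    refine ⟨chartAt (Coord 3) x₀, hch, (chartAt (Coord 3) x₀).source ∩
      (⋃ i, {p | p ∈ (e i).source ∧ 3 / 2 ≤ ‖e i p‖})ᶜ,
      inter_mem ((chartAt (Coord 3) x₀).open_source.mem_nhds (mem_chart_source _ _))
        (hC.mem_nhds fun hcon => ?_), inter_subset_left,
      fun x hx => pullbackForm_one_mem_flatForms hch hx.1 fun j hj hj' => ?_⟩
    · obtain ⟨i, hi⟩ := mem_iUnion.1 hcon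
      exact hx ⟨i, hi.1⟩
    · have hmem : x ∈ ⋃ i, {p | p ∈ (e i).source ∧ 3 / 2 ≤ ‖e i p‖} := mem_iUnion.2 ⟨j, hj, hj'⟩
      exact absurd hmem hx.2

set_option synthInstance.maxHeartbeats 400000 in
set_option maxHeartbeats 2000000 in
/-- Fields of bilinear forms subject to a pointwise convex condition can be glued with a partition
of unity. -/
lemma exists_form_of_local [T2Space S] [SigmaCompactSpace S]
    (t : ∀ x : S, Set (TangentSpace (𝓡 3) x →L[ℝ] TangentSpace (𝓡 3) x →L[ℝ] ℝ))
    (ht : ∀ x, Convex ℝ (t x))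
    (hloc : ∀ x₀ : S, ∃ U ∈ 𝓝 x₀, ∃ s : ∀ x : S,
      TangentSpace (𝓡 3) x →L[ℝ] TangentSpace (𝓡 3) x →L[ℝ] ℝ,
      (∀ x ∈ U, IsSmoothFormAt s x) ∧ ∀ x ∈ U, s x ∈ t x) :
    ∃ s : ∀ x : S, TangentSpace (𝓡 3) x →L[ℝ] TangentSpace (𝓡 3) x →L[ℝ] ℝ,
      (∀ x, IsSmoothFormAt s x) ∧ ∀ x, s x ∈ t x := by
  have key := exists_contMDiffSection_forall_mem_convex_of_local (n := ⊤) (𝓡 3)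
    (F_fiber := Coord 3 →L[ℝ] Coord 3 →L[ℝ] ℝ)
    (fun x : S => TangentSpace (𝓡 3) x →L[ℝ] TangentSpace (𝓡 3) x →L[ℝ] ℝ) t ht
    (fun x₀ => by
      obtain ⟨U, hU, s, hs, hst⟩ := hloc x₀
      exact ⟨U, hU, s, fun x hx => (hs x hx).contMDiffWithinAt, hst⟩)
  obtain ⟨s, hs⟩ := key
  exact ⟨s, fun x => s.contMDiff x, hs⟩

/-- There is a Riemannian metric which is flat on the ends. -/
theorem IsProperEndSystem.exists_flat_metric [T2Space S] [SigmaCompactSpace S] [Finite ι]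
    (h : IsProperEndSystem e) :
    ∃ g : SmoothMetric S, ∀ i, ∀ p ∈ (e i).source, 3 / 2 ≤ ‖e i p‖ →
      g.inner p = pullbackForm (e i) (fun _ => 1) p := by
  obtain ⟨s, hs, hst⟩ := exists_form_of_local (flatForms e) convex_flatForms fun x₀ => by
    obtain ⟨e', he', U, hU, hUe, hst⟩ := h.exists_local_flat x₀
    exact ⟨U, hU, pullbackForm e' (fun _ => 1), fun x hx =>
      isSmoothFormAt_pullbackForm (G := fun _ => 1) he' (hUe hx) fun _ _ => contDiffAt_const, hst⟩
  exact ⟨SmoothMetric.ofForm s (fun x => (hst x).1) (fun x => (hst x).2.1) hs,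
    fun i p hp hp' => (hst p).2.2 i hp hp'⟩

/-- A metric which is flat on the ends can be replaced there by the radial metric with profile
`endProfile κ`. -/
theorem IsProperEndSystem.exists_end_metric [Finite ι] (h : IsProperEndSystem e)
    {g₀ : SmoothMetric S} (hg₀ : ∀ i, ∀ p ∈ (e i).source, 3 / 2 ≤ ‖e i p‖ →
      g₀.inner p = pullbackForm (e i) (fun _ => 1) p) (κ : ℝ) :
    ∃ g : SmoothMetric S,
      (∀ i, ∀ y : Coord 3, 3 / 2 < ‖y‖ →
        chartComponents g.inner (e i) y = radialMetric (endProfile κ) y) ∧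
      ∀ p, (∀ i, p ∈ (e i).source → ‖e i p‖ < 2) → g.inner p = g₀.inner p := by
  classical
  let b : ∀ x : S, TangentSpace (𝓡 3) x →L[ℝ] TangentSpace (𝓡 3) x →L[ℝ] ℝ := fun x =>
    if hx : ∃ i, x ∈ endRegion (e i) (3 / 2) then
      pullbackForm (e hx.choose) (radialMetric (endProfile κ)) x
    else g₀.inner x
  have hb1 : ∀ i, ∀ x ∈ endRegion (e i) (3 / 2),
      b x = pullbackForm (e i) (radialMetric (endProfile κ)) x := by
    intro i x hx
    have hex : ∃ i, x ∈ endRegion (e i) (3 / 2) := ⟨i, hx⟩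
    have hi : hex.choose = i := h.eq_of_mem hex.choose_spec.1 hx.1
    simp only [b, dif_pos hex]
    rw [hi]
  have hb2 : ∀ x, (∀ i, x ∈ (e i).source → ‖e i x‖ < 2) → b x = g₀.inner x := by
    intro x hx
    by_cases hex : ∃ i, x ∈ endRegion (e i) (3 / 2)
    · obtain ⟨i, hi⟩ := hex
      rw [hb1 i x hi, hg₀ i x hi.1 hi.2.le]
      exact pullbackForm_congr (radialMetric_endProfile_of_le κ
        (by linarith [hi.2] : (0 : ℝ) < ‖e i x‖) (hx i hi.1).le)
    · simp only [b, dif_neg hex]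
  have hcases : ∀ x, (∃ i, x ∈ endRegion (e i) (3 / 2)) ∨
      ∀ i, x ∈ (e i).source → ‖e i x‖ < 2 := by
    intro x
    by_cases hex : ∃ i, x ∈ endRegion (e i) (3 / 2)
    · exact Or.inl hex
    · refine Or.inr fun i hi => ?_
      by_contra hlt
      exact hex ⟨i, hi, by linarith⟩
  have hprof := endProfile_isProfileOn κ
  have hpos : ∀ {y : Coord 3}, 3 / 2 < ‖y‖ → ‖y‖ ^ 2 ∈ Ioi (0 : ℝ) := fun {y} hy => by
    have : 0 < ‖y‖ := by linarith
    exact pow_pos this 2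
  refine ⟨SmoothMetric.ofForm b (fun x v w => ?_) (fun x v hv => ?_) (fun x => ?_),
    fun i y hy => ?_, hb2⟩
  · rcases hcases x with ⟨i, hi⟩ | hx
    · rw [hb1 i x hi]
      exact pullbackForm_symm (radialMetric_symm _) v w
    · rw [hb2 x hx]
      exact g₀.symm x v w
  · rcases hcases x with ⟨i, hi⟩ | hx
    · rw [hb1 i x hi]
      exact pullbackForm_pos (h.smooth i) hi.1
        (fun u hu => radialMetric_pos (hprof.w_pos _ (hpos hi.2)) hu) hv
    · rw [hb2 x hx]
      exact g₀.pos x v hv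
  · by_cases hex : ∃ i, x ∈ endRegion (e i) (3 / 2)
    · obtain ⟨i, hi⟩ := hex
      refine (isSmoothFormAt_pullbackForm (G := radialMetric (endProfile κ)) (h.smooth i) hi.1
        fun k l => (hprof.isMetricOn.smooth k l).contDiffAt
          (hprof.isMetricOn.isOpen.mem_nhds (hpos hi.2))).congr ?_
      filter_upwards [(isOpen_endRegion (e i) (3 / 2)).mem_nhds hi] with z hz
      exact hb1 i z hz
    · refine (g₀.isSmoothFormAt x).congr ?_
      have hC := (h.isClosed_iUnion (R := 2) (by norm_num)).isOpen_compl
      filter_upwards [hC.mem_nhds (x := x) fun hcon => by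
        obtain ⟨i, hi⟩ := mem_iUnion.1 hcon
        exact hex ⟨i, hi.1, by linarith [hi.2]⟩] with z hz
      refine hb2 z fun i hi => ?_
      by_contra hlt
      exact hz (mem_iUnion.2 ⟨i, hi, not_lt.1 hlt⟩)
  · have hyt := h.mem_target i (y := y) (by linarith)
    have hs : (e i).symm y ∈ endRegion (e i) (3 / 2) :=
      ⟨(e i).map_target hyt, by rwa [(e i).right_inv hyt]⟩
    rw [← chartComponents_pullbackForm (G := radialMetric (endProfile κ)) (h.smooth i) hyt]
    exact chartComponents_congr (hb1 i _ hs)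

end EndMetric

/-! ### The geodesic equation in coordinates -/

section GeodesicODE

variable {n : ℕ} {G G' : Coord n → Matrix (Fin n) (Fin n) ℝ} {U U' : Set (Coord n)}
  {φ : Coord n → Coord n} {c v : ℝ → Coord n} {t : ℝ}

/-- The acceleration `-Γᵏᵢⱼ vⁱ vʲ` of a geodesic with position `y` and velocity `v`. -/
noncomputable def geodesicAccel (G : Coord n → Matrix (Fin n) (Fin n) ℝ) (y v : Coord n) :
    Coord n :=
  WithLp.toLp 2 fun k => -∑ i, ∑ j, christoffel G k i j y * v i * v j

lemma geodesicAccel_apply (y v : Coord n) (k : Fin n) :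
    geodesicAccel G y v k = -∑ i, ∑ j, christoffel G k i j y * v i * v j := rfl

/-- The curve `c` with velocity `v` satisfies the geodesic equation at time `t`. -/
structure SolvesGeodesic (G : Coord n → Matrix (Fin n) (Fin n) ℝ) (c v : ℝ → Coord n)
    (t : ℝ) : Prop where
  velocity : HasDerivAt c (v t) t
  accel : HasDerivAt v (geodesicAccel G (c t) (v t)) t

lemma hasDerivAt_coord_iff {f : ℝ → Coord n} {f' : Coord n} :
    HasDerivAt f f' t ↔ ∀ k, HasDerivAt (fun s => f s k) (f' k) t := by
  rw [hasDerivAt_iff_hasFDerivAt, ← hasFDerivWithinAt_univ, hasFDerivWithinAt_euclidean]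
  refine forall_congr' fun k => ?_
  rw [hasDerivAt_iff_hasFDerivAt, hasFDerivWithinAt_univ]
  refine iff_of_eq (congrArg (fun L => HasFDerivAt (fun s => f s k) L t) ?_)
  ext
  simp

lemma hasDerivAt_comp_coord {f : Coord n → ℝ} {c' : Coord n} (hf : DifferentiableAt ℝ f (c t))
    (hc : HasDerivAt c c' t) :
    HasDerivAt (fun s => f (c s)) (∑ i, c' i * pderiv i f (c t)) t := by
  have h := hf.hasFDerivAt.comp_hasDerivAt t hc
  rw [fderiv_eq_sum_pderiv] at h
  exact h

lemma SolvesGeodesic.coord (h : SolvesGeodesic G c v t) (k : Fin n) :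
    HasDerivAt (fun s => v s k) (-∑ i, ∑ j, christoffel G k i j (c t) * v t i * v t j) t :=
  hasDerivAt_coord_iff.1 h.accel k

/-- The geodesic equation is invariant under changes of coordinates. -/
lemma SolvesGeodesic.transform (h : SolvesGeodesic G c v t) (hφ : IsIsometryOn G G' U U' φ)
    (ht : c t ∈ U) :
    SolvesGeodesic G' (fun s => φ (c s)) (fun s => fderiv ℝ φ (c s) (v s)) t := by
  have hU := hφ.metric.isOpen.mem_nhds ht
  have hcU : ∀ᶠ s in 𝓝 t, c s ∈ U := h.velocity.continuousAt hU
  have hJ : ∀ y ∈ U, ∀ u : Coord n, ∀ a,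
      fderiv ℝ φ y u a = ∑ i, jacobianMatrix φ y a i * u i := fun y hy u a => by
    rw [fderiv_coord_apply (hφ.differentiableAt hy), fderiv_eq_sum_pderiv]
    exact Finset.sum_congr rfl fun i _ => mul_comm _ _
  refine ⟨(hφ.differentiableAt ht).hasFDerivAt.comp_hasDerivAt t h.velocity,
    hasDerivAt_coord_iff.2 fun a => ?_⟩
  have h1 : HasDerivAt (fun s => ∑ i, jacobianMatrix φ (c s) a i * v s i)
      (∑ i, ((∑ j, v t j * pderiv j (fun y => jacobianMatrix φ y a i) (c t)) * v t i
        + jacobianMatrix φ (c t) a i *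
          -∑ k, ∑ j, christoffel G i k j (c t) * v t k * v t j)) t :=
    HasDerivAt.fun_sum fun i _ =>
      (hasDerivAt_comp_coord (hφ.differentiableAt_jacobian ht a i) h.velocity).fun_mul (h.coord i)
  refine (h1.congr_of_eventuallyEq ?_).congr_deriv ?_
  · filter_upwards [hcU] with s hs
    exact hJ _ hs _ _
  · have ht' := fun i j => hφ.christoffel_transform ht a i j
    have e1 : ∑ i, jacobianMatrix φ (c t) a i * -∑ k, ∑ j, christoffel G i k j (c t) * v t k * v t j
        = -∑ k, ∑ j, (∑ i, jacobianMatrix φ (c t) a i * christoffel G i k j (c t))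
          * (v t k * v t j) := by
      simp only [mul_neg, Finset.sum_neg_distrib, Finset.mul_sum, Finset.sum_mul]
      rw [Finset.sum_comm]
      congr 1
      refine Finset.sum_congr rfl fun k _ => ?_
      rw [Finset.sum_comm]
      exact Finset.sum_congr rfl fun j _ => Finset.sum_congr rfl fun i _ => by ring
    have e2 : ∑ i, (∑ j, v t j * pderiv j (fun y => jacobianMatrix φ y a i) (c t)) * v t i
        = ∑ k, ∑ j, pderiv k (fun y => jacobianMatrix φ y a j) (c t) * (v t k * v t j) := by
      simp only [Finset.sum_mul]
      rw [Finset.sum_comm]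
      exact Finset.sum_congr rfl fun j _ => Finset.sum_congr rfl fun i _ => by ring
    have e3 : ∑ b, ∑ d, christoffel G' a b d (φ (c t)) * (∑ k, jacobianMatrix φ (c t) b k * v t k)
          * (∑ j, jacobianMatrix φ (c t) d j * v t j)
        = ∑ k, ∑ j, (∑ b, ∑ d, christoffel G' a b d (φ (c t)) * jacobianMatrix φ (c t) b k
          * jacobianMatrix φ (c t) d j) * (v t k * v t j) := by
      simp only [Finset.sum_mul, Finset.mul_sum]
      calc _ = ∑ b, ∑ d, ∑ k, ∑ j, christoffel G' a b d (φ (c t)) * jacobianMatrix φ (c t) b k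
            * jacobianMatrix φ (c t) d j * (v t k * v t j) := by
            refine Finset.sum_congr rfl fun b _ => Finset.sum_congr rfl fun d _ => ?_
            rw [Finset.sum_comm]
            exact Finset.sum_congr rfl fun k _ => Finset.sum_congr rfl fun j _ => by ring
        _ = ∑ b, ∑ k, ∑ d, ∑ j, christoffel G' a b d (φ (c t)) * jacobianMatrix φ (c t) b k
            * jacobianMatrix φ (c t) d j * (v t k * v t j) :=
            Finset.sum_congr rfl fun b _ => Finset.sum_comm
        _ = ∑ k, ∑ b, ∑ j, ∑ d, christoffel G' a b d (φ (c t)) * jacobianMatrix φ (c t) b k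
            * jacobianMatrix φ (c t) d j * (v t k * v t j) := by
            rw [Finset.sum_comm]
            exact Finset.sum_congr rfl fun k _ => Finset.sum_congr rfl fun b _ => Finset.sum_comm
        _ = _ := Finset.sum_congr rfl fun k _ => Finset.sum_comm
    rw [geodesicAccel_apply, Finset.sum_add_distrib, e1, e2]
    simp only [hJ _ ht]
    rw [e3]
    simp only [ht', add_mul, Finset.sum_add_distrib]
    ring

/-- Geodesics have constant speed. -/
lemma SolvesGeodesic.hasDerivAt_speed (h : SolvesGeodesic G c v t) (hG : IsMetricOn G U)
    (ht : c t ∈ U) :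
    HasDerivAt (fun s => ∑ i, ∑ j, G (c s) i j * v s i * v s j) 0 t := by
  have h1 : HasDerivAt (fun s => ∑ i, ∑ j, G (c s) i j * v s i * v s j)
      (∑ i, ∑ j, (((∑ k, v t k * pderiv k (fun y => G y i j) (c t)) * v t i
        + G (c t) i j * -∑ k, ∑ l, christoffel G i k l (c t) * v t k * v t l) * v t j
        + G (c t) i j * v t i * -∑ k, ∑ l, christoffel G j k l (c t) * v t k * v t l)) t :=
    HasDerivAt.fun_sum fun i _ => HasDerivAt.fun_sum fun j _ =>
      ((hasDerivAt_comp_coord (hG.differentiableAt ht i j) h.velocity).fun_mul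
        (h.coord i)).fun_mul (h.coord j)
  refine h1.congr_deriv ?_
  set A := ∑ i, ∑ j, G (c t) i j * (∑ k, ∑ l, christoffel G i k l (c t) * v t k * v t l) * v t j
    with hA
  have e1 : ∑ i, ∑ j, (∑ k, v t k * pderiv k (fun y => G y i j) (c t)) * v t i * v t j
      = A + A := by
    have e2 : ∀ i j, (∑ k, v t k * pderiv k (fun y => G y i j) (c t)) * v t i * v t j
        = ∑ m, G (c t) i m * (∑ k, christoffel G m k j (c t) * v t k * v t j) * v t i
          + ∑ m, G (c t) j m * (∑ k, christoffel G m k i (c t) * v t k * v t i) * v t j := by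
      intro i j
      simp only [hG.pderiv_metric ht, mul_add, Finset.sum_add_distrib, add_mul, Finset.sum_mul,
        Finset.mul_sum]
      congr 1
      · rw [Finset.sum_comm]
        exact Finset.sum_congr rfl fun m _ => Finset.sum_congr rfl fun k _ => by ring
      · rw [Finset.sum_comm]
        exact Finset.sum_congr rfl fun m _ => Finset.sum_congr rfl fun k _ => by ring
    have e3 : ∑ i, ∑ j, ∑ m, G (c t) i m * (∑ k, christoffel G m k j (c t) * v t k * v t j) * v t i
        = A := by
      rw [hA, Finset.sum_comm' (t' := Finset.univ) (s' := fun _ => Finset.univ) (by simp)]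
      rw [Finset.sum_comm]
      refine (Finset.sum_congr rfl fun i _ => Finset.sum_comm).trans ?_
      rw [Finset.sum_comm]
      refine Finset.sum_congr rfl fun m _ => Finset.sum_congr rfl fun i _ => ?_
      rw [hG.symm _ ht i m, ← Finset.sum_mul, ← Finset.mul_sum, Finset.sum_comm]
    simp only [e2, Finset.sum_add_distrib]
    rw [e3, Finset.sum_comm, e3]
  have e4 : ∑ i, ∑ j, G (c t) i j * v t i * (∑ k, ∑ l, christoffel G j k l (c t) * v t k * v t l)
      = A := by
    rw [hA, Finset.sum_comm]
    refine Finset.sum_congr rfl fun j _ => Finset.sum_congr rfl fun i _ => ?_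
    rw [hG.symm _ ht i j]
    ring
  simp only [add_mul, Finset.sum_add_distrib, mul_neg, neg_mul, Finset.sum_neg_distrib]
  rw [e1, e4]
  ring

/-- Affine reparametrization of geodesics. -/
lemma SolvesGeodesic.affine {a b : ℝ} (h : SolvesGeodesic G c v (a * t + b)) :
    SolvesGeodesic G (fun s => c (a * s + b)) (fun s => a • v (a * s + b)) t := by
  have ha : HasDerivAt (fun s : ℝ => a * s + b) a t := by
    simpa using ((hasDerivAt_id t).const_mul a).add_const b
  refine ⟨h.velocity.scomp t ha, ?_⟩
  refine ((h.accel.scomp t ha).const_smul a).congr_deriv ?_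
  ext k
  simp only [geodesicAccel_apply, PiLp.smul_apply, smul_eq_mul, mul_neg, Finset.mul_sum]
  congr 1
  exact Finset.sum_congr rfl fun i _ => Finset.sum_congr rfl fun j _ => by ring

lemma hasDerivAt_ite_le {E : Type*} [NormedAddCommGroup E] [NormedSpace ℝ E] {f g : ℝ → E} {d : E}
    (hf : HasDerivAt f d t) (hg : HasDerivAt g d t) (h : f t = g t) :
    HasDerivAt (fun s => if s ≤ t then f s else g s) d t := by
  have h1 : HasDerivWithinAt (fun s => if s ≤ t then f s else g s) d (Iic t) t :=
    hf.hasDerivWithinAt.congr (fun s hs => if_pos hs) (if_pos le_rfl)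
  have h2 : HasDerivWithinAt (fun s => if s ≤ t then f s else g s) d (Ici t) t := by
    refine hg.hasDerivWithinAt.congr (fun s hs => ?_) ((if_pos le_rfl).trans h)
    rcases (mem_Ici.1 hs).eq_or_lt with rfl | hlt
    · exact (if_pos le_rfl).trans h
    · exact if_neg (not_le.2 hlt)
  have := h1.union h2
  rwa [Iic_union_Ici, hasDerivWithinAt_univ] at this

/-- Two geodesics with the same position and velocity at time `t` can be joined. -/
lemma SolvesGeodesic.glue {c₁ v₁ c₂ v₂ : ℝ → Coord n} (h₁ : ∀ᶠ s in 𝓝 t, SolvesGeodesic G c₁ v₁ s)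
    (h₂ : ∀ᶠ s in 𝓝 t, SolvesGeodesic G c₂ v₂ s) (hc : c₁ t = c₂ t) (hv : v₁ t = v₂ t) :
    ∀ᶠ s in 𝓝 t, SolvesGeodesic G (fun s => if s ≤ t then c₁ s else c₂ s)
      (fun s => if s ≤ t then v₁ s else v₂ s) s := by
  filter_upwards [h₁, h₂] with s hs₁ hs₂
  rcases lt_trichotomy s t with hst | rfl | hst
  · have hn : ∀ᶠ r in 𝓝 s, r ≤ t := (eventually_lt_nhds hst).mono fun _ h => le_of_lt h
    constructor
    · simp only [if_pos hst.le]
      exact hs₁.velocity.congr_of_eventuallyEq (hn.mono fun r hr => if_pos hr)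
    · simp only [if_pos hst.le]
      exact hs₁.accel.congr_of_eventuallyEq (hn.mono fun r hr => if_pos hr)
  · constructor
    · simp only [if_pos le_rfl]
      exact hasDerivAt_ite_le hs₁.velocity (hv ▸ hs₂.velocity) hc
    · simp only [if_pos le_rfl]
      refine hasDerivAt_ite_le hs₁.accel ?_ hv
      rw [hc, hv]
      exact hs₂.accel
  · have hn : ∀ᶠ r in 𝓝 s, ¬ r ≤ t := (eventually_gt_nhds hst).mono fun _ h => not_le.2 h
    constructor
    · simp only [if_neg (not_le.2 hst)]
      exact hs₂.velocity.congr_of_eventuallyEq (hn.mono fun r hr => if_neg hr)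
    · simp only [if_neg (not_le.2 hst)]
      exact hs₂.accel.congr_of_eventuallyEq (hn.mono fun r hr => if_neg hr)

/-- The geodesic equation as a first order system for position and velocity. -/
noncomputable def geodesicField (G : Coord n → Matrix (Fin n) (Fin n) ℝ)
    (z : Coord n × Coord n) : Coord n × Coord n :=
  (z.2, geodesicAccel G z.1 z.2)

lemma IsMetricOn.geodesicField_smooth (hG : IsMetricOn G U) :
    ContDiffOn ℝ ∞ (geodesicField G) (U ×ˢ univ) := by
  refine contDiffOn_snd.prodMk (contDiffOn_euclidean.2 fun k => ?_)
  simp only [geodesicAccel_apply]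
  have hc : ∀ i : Fin n, ContDiffOn ℝ ∞ (fun z : Coord n × Coord n => z.2 i) (U ×ˢ univ) :=
    fun i => contDiffOn_euclidean.1 contDiffOn_snd i
  refine (ContDiffOn.sum fun i _ => ContDiffOn.sum fun j _ => ?_).neg
  exact (((hG.christoffel_smooth k i j).comp contDiffOn_fst fun z hz => hz.1).mul (hc i)).mul (hc j)

/-- Geodesics are smooth. -/
lemma contDiffAt_of_solvesGeodesic (hG : IsMetricOn G U)
    (h : ∀ᶠ s in 𝓝 t, c s ∈ U ∧ SolvesGeodesic G c v s) : ContDiffAt ℝ ∞ c t := by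
  obtain ⟨ε, hε, hball⟩ := Metric.eventually_nhds_iff_ball.1 h
  have hsub : Icc (t - ε / 2) (t + ε / 2) ⊆ Metric.ball t ε := fun s hs => by
    rw [Metric.mem_ball, Real.dist_eq, abs_lt]
    constructor <;> linarith [hs.1, hs.2]
  have key : ContDiffOn ℝ ((⊤ : ℕ∞) : WithTop ℕ∞) (fun s => (c s, v s))
      (Icc (t - ε / 2) (t + ε / 2)) := by
    refine ODE.contDiffOn_enat_Icc_of_hasDerivWithinAt (f := fun _ => geodesicField G)
      (u := U ×ˢ univ) ?_ (fun s hs => ?_) fun s hs => ?_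
    · exact hG.geodesicField_smooth.comp contDiffOn_snd fun z hz => hz.2
    · have := (hball s (hsub hs)).2
      exact (this.velocity.prodMk this.accel).hasDerivWithinAt
    · exact ⟨(hball s (hsub hs)).1, mem_univ _⟩
  have h2 : ContDiffAt ℝ ∞ (fun s => (c s, v s)) t :=
    key.contDiffAt (Icc_mem_nhds (by linarith) (by linarith))
  exact h2.fst

/-- Solutions of a smooth autonomous equation with initial values near a point exist on a common
time interval, and do not leave a given neighbourhood of the point. -/
lemma exists_local_flow {E : Type*} [NormedAddCommGroup E] [NormedSpace ℝ E] [CompleteSpace E]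
    {f : E → E} {x₀ : E} (hf : ContDiffAt ℝ 1 f x₀) {V : Set E} (hV : V ∈ 𝓝 x₀) :
    ∃ r > (0 : ℝ), ∃ ε > (0 : ℝ), ∀ x ∈ Metric.closedBall x₀ r, ∃ α : ℝ → E, α 0 = x ∧
      ∀ t ∈ Ioo (-ε) ε, α t ∈ V ∧ HasDerivAt α (f (α t)) t := by
  obtain ⟨ε, hε, a, r, L, K, hr, hpl⟩ := IsPicardLindelof.of_contDiffAt_one hf
  obtain ⟨α, hα, hcont⟩ :=
    (hpl 0).exists_forall_mem_closedBall_eq_hasDerivWithinAt_continuousOn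
  have hx₀ : x₀ ∈ Metric.closedBall x₀ (r : ℝ) := Metric.mem_closedBall_self r.2
  have h0 : (0 : ℝ) ∈ Icc (0 - ε) (0 + ε) := ⟨by linarith, by linarith⟩
  have hnhds : α ⁻¹' V ∈ 𝓝[Metric.closedBall x₀ (r : ℝ) ×ˢ Icc (0 - ε) (0 + ε)] (x₀, 0) :=
    hcont (x₀, 0) ⟨hx₀, h0⟩ (by rwa [(hα x₀ hx₀).1])
  have hprod : Metric.closedBall x₀ (r : ℝ) ×ˢ Icc (0 - ε) (0 + ε) ∈ 𝓝 (x₀, (0 : ℝ)) :=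
    prod_mem_nhds (Metric.closedBall_mem_nhds x₀ hr) (Icc_mem_nhds (by linarith) (by linarith))
  rw [nhdsWithin_eq_nhds.2 hprod] at hnhds
  obtain ⟨A, hA, B, hB, hAB⟩ := mem_nhds_prod_iff.1 hnhds
  obtain ⟨r', hr', hrA⟩ := Metric.nhds_basis_closedBall.mem_iff.1 hA
  obtain ⟨ε', hε', hεB⟩ := Metric.nhds_basis_ball.mem_iff.1 hB
  refine ⟨min r r', lt_min hr hr', min ε ε', lt_min hε hε', fun x hx => ?_⟩
  have hxr : x ∈ Metric.closedBall x₀ (r : ℝ) :=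
    Metric.closedBall_subset_closedBall (min_le_left _ _) hx
  refine ⟨fun t => α (x, t), (hα x hxr).1, fun t ht => ⟨?_, ?_⟩⟩
  · refine hAB ⟨hrA (Metric.closedBall_subset_closedBall (min_le_right _ _) hx), hεB ?_⟩
    rw [Metric.mem_ball, Real.dist_eq, sub_zero, abs_lt]
    exact ⟨by linarith [ht.1, min_le_right ε ε'], ht.2.trans_le (min_le_right _ _)⟩
  · have h1 : 0 - ε < t := by linarith [ht.1, min_le_left ε ε']
    have h2 : t < 0 + ε := by linarith [ht.2, min_le_left ε ε']
    exact ((hα x hxr).2 t ⟨h1.le, h2.le⟩).hasDerivAt (Icc_mem_nhds h1 h2)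

/-- Geodesics with small initial velocity exist on a common time interval. -/
lemma IsMetricOn.exists_local_geodesic (hG : IsMetricOn G U) {y₀ : Coord n} (hy₀ : y₀ ∈ U) :
    ∃ r > (0 : ℝ), ∃ ε > (0 : ℝ), ∀ y u : Coord n, ‖y - y₀‖ ≤ r → ‖u‖ ≤ r →
      ∃ c v : ℝ → Coord n, c 0 = y ∧ v 0 = u ∧
        ∀ t ∈ Ioo (-ε) ε, c t ∈ U ∧ SolvesGeodesic G c v t := by
  have hV : U ×ˢ (univ : Set (Coord n)) ∈ 𝓝 (y₀, (0 : Coord n)) :=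
    prod_mem_nhds (hG.isOpen.mem_nhds hy₀) univ_mem
  obtain ⟨r, hr, ε, hε, H⟩ := exists_local_flow
    ((hG.geodesicField_smooth.contDiffAt hV).of_le (by simp)) hV
  refine ⟨r, hr, ε, hε, fun y u hy hu => ?_⟩
  obtain ⟨α, hα0, hα⟩ := H (y, u) (by
    rw [Metric.mem_closedBall, dist_eq_norm, Prod.mk_sub_mk, sub_zero, Prod.norm_mk]
    exact max_le hy hu)
  refine ⟨fun t => (α t).1, fun t => (α t).2, congrArg Prod.fst hα0,
    congrArg Prod.snd hα0, fun t ht => ?_⟩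
  obtain ⟨h1, h2⟩ := hα t ht
  exact ⟨h1.1, h2.fst, h2.snd⟩

end GeodesicODE

/-! ### Geodesics on the manifold -/

section Geodesics

variable {S : Type*} [TopologicalSpace S] [ChartedSpace (Coord 3) S]
  {e e' : OpenPartialHomeomorph S (Coord 3)} {t : ℝ}

/-- Equality of tangent vectors, where the fibres are identified with `ℝ³`. -/
lemma mk_tangent_eq {p q : S} (hpq : p = q) {u v : Coord 3} (huv : u = v) :
    (⟨p, u⟩ : TangentBundle (𝓡 3) S) = ⟨q, v⟩ := by
  subst hpq huv
  rfl

/-- The tangent vector whose base point has coordinates `y` and whose components are `d` in the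
chart `e`. -/
noncomputable def chartTangent (e : OpenPartialHomeomorph S (Coord 3)) (y d : Coord 3) :
    TangentBundle (𝓡 3) S :=
  ⟨e.symm y, mfderiv (𝓡 3) (𝓡 3) e.symm y d⟩

/-- Multiplication of a tangent vector by a scalar. -/
noncomputable def tangentSmul (a : ℝ) (w : TangentBundle (𝓡 3) S) : TangentBundle (𝓡 3) S :=
  ⟨w.proj, (a • (w.snd : Coord 3) : Coord 3)⟩

lemma tangentSmul_chartTangent (a : ℝ) (y d : Coord 3) :
    tangentSmul a (chartTangent e y d) = chartTangent e y (a • d) := by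
  have h : ∀ L : Coord 3 →L[ℝ] Coord 3, a • L d = L (a • d) := fun L => (map_smul L a d).symm
  exact congrArg (fun u : Coord 3 => (⟨e.symm y, u⟩ : TangentBundle (𝓡 3) S))
    (h (mfderiv (𝓡 3) (𝓡 3) e.symm y))

lemma tangentSmul_tangentSmul (a b : ℝ) (w : TangentBundle (𝓡 3) S) :
    tangentSmul a (tangentSmul b w) = tangentSmul (a * b) w :=
  congrArg (fun u : Coord 3 => (⟨w.proj, u⟩ : TangentBundle (𝓡 3) S))
    (smul_smul a b (w.snd : Coord 3))

lemma tangentSmul_one (w : TangentBundle (𝓡 3) S) : tangentSmul 1 w = w :=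
  congrArg (fun u : Coord 3 => (⟨w.proj, u⟩ : TangentBundle (𝓡 3) S))
    (one_smul ℝ (w.snd : Coord 3))

lemma chartTangent_transition (he : e ∈ IsManifold.maximalAtlas (𝓡 3) ∞ S)
    (he' : e' ∈ IsManifold.maximalAtlas (𝓡 3) ∞ S) {y : Coord 3} (hy : y ∈ overlap e e')
    (d : Coord 3) :
    chartTangent e y d = chartTangent e' (transition e e' y) (fderiv ℝ (transition e e') y d) := by
  have h := mfderiv_symm_transition he he' hy d
  exact mk_tangent_eq (symm_transition hy).symm h

lemma chartTangent_injective (he : e ∈ IsManifold.maximalAtlas (𝓡 3) ∞ S) {y y' d d' : Coord 3}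
    (hy : y ∈ e.target) (hy' : y' ∈ e.target) (h : chartTangent e y d = chartTangent e y' d') :
    y = y' ∧ d = d' := by
  have h1 : e.symm y = e.symm y' := congrArg TotalSpace.proj h
  obtain rfl : y = y' := e.symm.injOn hy hy' h1
  refine ⟨rfl, ?_⟩
  have h2 : (mfderiv (𝓡 3) (𝓡 3) e.symm y d : Coord 3) = mfderiv (𝓡 3) (𝓡 3) e.symm y d' := by
    have := (TotalSpace.mk.injEq _ _ _ _).mp h
    exact eq_of_heq this.2
  exact (mdifferentiable_of_mem_maximalAtlas he).symm.mfderiv_injective (x := y) hy h2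

lemma exists_chartTangent (he : e ∈ IsManifold.maximalAtlas (𝓡 3) ∞ S)
    {w : TangentBundle (𝓡 3) S} (hw : w.proj ∈ e.source) :
    ∃ d, chartTangent e (e w.proj) d = w := by
  obtain ⟨x, u⟩ := w
  have hy : e x ∈ e.target := e.map_source hw
  obtain ⟨d, hd⟩ := (mdifferentiable_of_mem_maximalAtlas he).symm.mfderiv_surjective (x := e x) hy
    (show Coord 3 from u)
  refine ⟨d, ?_⟩
  exact mk_tangent_eq (e.left_inv hw) hd

variable [IsManifold (𝓡 3) ∞ S] {g : SmoothMetric S} {W W' : ℝ → TangentBundle (𝓡 3) S}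

/-- The squared length of a tangent vector. -/
noncomputable def SmoothMetric.normSq (g : SmoothMetric S) (w : TangentBundle (𝓡 3) S) : ℝ :=
  g.inner w.proj w.snd w.snd

lemma SmoothMetric.normSq_chartTangent (g : SmoothMetric S) (y d : Coord 3) :
    g.normSq (chartTangent e y d) = ∑ i, ∑ j, chartComponents g.inner e y i j * d i * d j :=
  chartComponents_sum g.inner e y d d

/-- Near time `t` the curve `W` in the tangent bundle is the velocity of a geodesic, expressed in
the chart `e`. Keeping track of the velocity makes it possible to join geodesics. -/
def IsGeodesicIn (g : SmoothMetric S) (e : OpenPartialHomeomorph S (Coord 3))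
    (W : ℝ → TangentBundle (𝓡 3) S) (t : ℝ) : Prop :=
  ∃ c v : ℝ → Coord 3, ∀ᶠ s in 𝓝 t, c s ∈ e.target ∧ W s = chartTangent e (c s) (v s) ∧
    SolvesGeodesic (chartComponents g.inner e) c v s

/-- Near time `t` the curve `W` in the tangent bundle is the velocity of a geodesic. -/
def IsGeodesicAt (g : SmoothMetric S) (W : ℝ → TangentBundle (𝓡 3) S) (t : ℝ) : Prop :=
  ∃ e ∈ IsManifold.maximalAtlas (𝓡 3) ∞ S, IsGeodesicIn g e W t

/-- The notion of a geodesic does not depend on the chart. -/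
lemma IsGeodesicAt.isGeodesicIn (h : IsGeodesicAt g W t)
    (he' : e' ∈ IsManifold.maximalAtlas (𝓡 3) ∞ S) (ht : (W t).proj ∈ e'.source) :
    IsGeodesicIn g e' W t := by
  obtain ⟨e, he, c, v, hcv⟩ := h
  obtain ⟨hct, hWt, hst⟩ := hcv.self_of_nhds
  have hov : c t ∈ overlap e e' := by
    refine ⟨hct, ?_⟩
    rw [hWt] at ht
    exact ht
  have hcont := hst.velocity.continuousAt
  refine ⟨fun s => transition e e' (c s), fun s => fderiv ℝ (transition e e') (c s) (v s), ?_⟩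
  filter_upwards [hcv, hcont ((isOpen_overlap e e').mem_nhds hov)] with s hs hos
  refine ⟨(transition_mapsTo hos).1, ?_, hs.2.2.transform (g.isIsometryOn he he') hos⟩
  rw [hs.2.1, chartTangent_transition he he' hos]

lemma IsGeodesicAt.isGeodesicIn_chartAt (h : IsGeodesicAt g W t) :
    IsGeodesicIn g (chartAt (Coord 3) (W t).proj) W t :=
  h.isGeodesicIn (IsManifold.chart_mem_maximalAtlas _) (mem_chart_source _ _)

lemma IsGeodesicAt.congr (h : IsGeodesicAt g W t) (hW : ∀ᶠ s in 𝓝 t, W' s = W s) :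
    IsGeodesicAt g W' t := by
  obtain ⟨e, he, c, v, hcv⟩ := h
  refine ⟨e, he, c, v, ?_⟩
  filter_upwards [hcv, hW] with s hs hs'
  exact ⟨hs.1, hs'.trans hs.2.1, hs.2.2⟩

lemma IsGeodesicAt.affine {a b : ℝ} (h : IsGeodesicAt g W (a * t + b)) :
    IsGeodesicAt g (fun s => tangentSmul a (W (a * s + b))) t := by
  obtain ⟨e, he, c, v, hcv⟩ := h
  have hc : ContinuousAt (fun s : ℝ => a * s + b) t := by fun_prop
  refine ⟨e, he, fun s => c (a * s + b), fun s => a • v (a * s + b), ?_⟩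
  filter_upwards [hc.eventually hcv] with s hs
  refine ⟨hs.1, ?_, hs.2.2.affine⟩
  simp only [hs.2.1, tangentSmul_chartTangent]

/-- Two geodesics with the same velocity at time `t` can be joined there. -/
lemma IsGeodesicAt.glue (h : IsGeodesicAt g W t) (h' : IsGeodesicAt g W' t) (ht : W t = W' t) :
    IsGeodesicAt g (fun s => if s ≤ t then W s else W' s) t := by
  have he : chartAt (Coord 3) (W t).proj ∈ IsManifold.maximalAtlas (𝓡 3) ∞ S :=
    IsManifold.chart_mem_maximalAtlas _
  obtain ⟨c, v, hcv⟩ := h.isGeodesicIn_chartAt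
  obtain ⟨c', v', hcv'⟩ := h'.isGeodesicIn he (by rw [← ht]; exact mem_chart_source _ _)
  have h1 := hcv.self_of_nhds
  have h2 := hcv'.self_of_nhds
  obtain ⟨hc, hv⟩ := chartTangent_injective he h1.1 h2.1 (by rw [← h1.2.1, ← h2.2.1, ht])
  refine ⟨_, he, fun s => if s ≤ t then c s else c' s, fun s => if s ≤ t then v s else v' s, ?_⟩
  filter_upwards [hcv, hcv', SolvesGeodesic.glue (hcv.mono fun _ h => h.2.2)
    (hcv'.mono fun _ h => h.2.2) hc hv] with s hs hs' hg
  refine ⟨?_, ?_, hg⟩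
  · split_ifs
    exacts [hs.1, hs'.1]
  · split_ifs
    exacts [hs.2.1, hs'.2.1]

/-- Joining at time `T` a geodesic which exists before `T` with one which exists after `T`. -/
lemma isGeodesicAt_ite {T : ℝ} (h : t ≤ T → IsGeodesicAt g W t) (h' : T ≤ t → IsGeodesicAt g W' t)
    (hT : W T = W' T) : IsGeodesicAt g (fun s => if s ≤ T then W s else W' s) t := by
  rcases lt_trichotomy t T with hlt | rfl | hlt
  · exact (h hlt.le).congr ((eventually_lt_nhds hlt).mono fun s hs => if_pos (le_of_lt hs))
  · exact (h le_rfl).glue (h' le_rfl) hT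
  · exact (h' hlt.le).congr ((eventually_gt_nhds hlt).mono fun s hs => if_neg (not_le.2 hs))

lemma IsGeodesicAt.hasDerivAt_normSq (h : IsGeodesicAt g W t) :
    HasDerivAt (fun s => g.normSq (W s)) 0 t := by
  obtain ⟨e, he, c, v, hcv⟩ := h
  obtain ⟨hct, hWt, hst⟩ := hcv.self_of_nhds
  refine (hst.hasDerivAt_speed (g.isMetricOn he) hct).congr_of_eventuallyEq ?_
  filter_upwards [hcv] with s hs
  rw [hs.2.1, g.normSq_chartTangent]

lemma normSq_eq_of_isGeodesicAt {a b s : ℝ} (h : ∀ t ∈ Ioo a b, IsGeodesicAt g W t)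
    (hs : s ∈ Ioo a b) (ht : t ∈ Ioo a b) : g.normSq (W s) = g.normSq (W t) := by
  have hd : ∀ t ∈ Ioo a b, HasDerivWithinAt (fun s => g.normSq (W s)) 0 (Ioo a b) t := fun t ht =>
    (h t ht).hasDerivAt_normSq.hasDerivWithinAt
  have := (convex_Ioo a b).norm_image_sub_le_of_norm_hasDerivWithin_le hd
    (C := 0) (fun t _ => by simp) ht hs
  rw [zero_mul, norm_le_zero_iff, sub_eq_zero] at this
  exact this

/-- The curve in the tangent bundle consists of the velocity vectors of its base curve. -/
lemma IsGeodesicAt.velocity (h : IsGeodesicAt g W t) :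
    (⟨(W t).proj, mfderiv 𝓘(ℝ, ℝ) (𝓡 3) (fun s => (W s).proj) t (1 : ℝ)⟩ :
      TangentBundle (𝓡 3) S) = W t := by
  obtain ⟨e, he, c, v, hcv⟩ := h
  obtain ⟨hct, hWt, hst⟩ := hcv.self_of_nhds
  have h1 : (fun s => (W s).proj) =ᶠ[𝓝 t] e.symm ∘ c := by
    filter_upwards [hcv] with s hs
    rw [hs.2.1]
    rfl
  have hc : MDifferentiableAt 𝓘(ℝ, ℝ) (𝓡 3) c t :=
    mdifferentiableAt_iff_differentiableAt.2 hst.velocity.differentiableAt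
  have h2 : (mfderiv 𝓘(ℝ, ℝ) (𝓡 3) (fun s => (W s).proj) t (1 : ℝ) : Coord 3)
      = (mfderiv (𝓡 3) (𝓡 3) e.symm (c t) (v t) : Coord 3) := by
    rw [h1.mfderiv_eq, mfderiv_comp t (mdifferentiableAt_symm he hct) hc, mfderiv_eq_fderiv,
      hst.velocity.hasFDerivAt.fderiv]
    have : ∀ L : Coord 3 →L[ℝ] Coord 3,
        (L.comp (ContinuousLinearMap.toSpanSingleton ℝ (v t))) (1 : ℝ) = L (v t) := fun L => by simp
    exact this _
  exact (mk_tangent_eq (by rw [hWt]; rfl) h2).trans hWt.symm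

lemma isGeodesic_of_isGeodesicAt (h : ∀ t, IsGeodesicAt g W t) :
    IsGeodesic g (fun s => (W s).proj) := by
  refine ⟨fun t => ?_, fun e he t ht k => ?_⟩
  · obtain ⟨e, he, c, v, hcv⟩ := h t
    obtain ⟨hct, hWt, hst⟩ := hcv.self_of_nhds
    have hc : ContDiffAt ℝ ∞ c t :=
      contDiffAt_of_solvesGeodesic (g.isMetricOn he) (hcv.mono fun s hs => ⟨hs.1, hs.2.2⟩)
    have he1 : ContMDiffAt (𝓡 3) (𝓡 3) ∞ e.symm (c t) :=
      contMDiffAt_symm_of_mem_maximalAtlas he hct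
    refine (he1.comp t (contMDiffAt_iff_contDiffAt.2 hc)).congr_of_eventuallyEq ?_
    filter_upwards [hcv] with s hs
    rw [hs.2.1]
    rfl
  · obtain ⟨c, v, hcv⟩ := (h t).isGeodesicIn he ht
    have h1 : ∀ᶠ s in 𝓝 t, e (W s).proj = c s := by
      filter_upwards [hcv] with s hs
      rw [hs.2.1]
      exact e.right_inv hs.1
    have h2 : ∀ᶠ s in 𝓝 t, ∀ k, deriv (fun r => e (W r).proj k) s = v s k := by
      filter_upwards [hcv, h1.eventually_nhds] with s hs hs1 k
      refine HasDerivAt.deriv ((hasDerivAt_coord_iff.1 hs.2.2.velocity k).congr_of_eventuallyEq ?_)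
      filter_upwards [hs1] with r hr
      rw [hr]
    have h3 : deriv (fun s => deriv (fun r => e (W r).proj k) s) t
        = -∑ i, ∑ j, christoffel (chartComponents g.inner e) k i j (c t) * v t i * v t j := by
      refine HasDerivAt.deriv ((hcv.self_of_nhds.2.2.coord k).congr_of_eventuallyEq ?_)
      filter_upwards [h2] with s hs
      exact hs k
    rw [h3]
    simp only [h1.self_of_nhds, h2.self_of_nhds]
    ring

end Geodesics

/-! ### A criterion for geodesic completeness -/

section Completeness

variable {S : Type*} [TopologicalSpace S] [ChartedSpace (Coord 3) S] [IsManifold (𝓡 3) ∞ S]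
  {e : OpenPartialHomeomorph S (Coord 3)} {g : SmoothMetric S} {W : ℝ → TangentBundle (𝓡 3) S}

lemma SmoothMetric.sum_chartComponents_pos (g : SmoothMetric S)
    (he : e ∈ IsManifold.maximalAtlas (𝓡 3) ∞ S) {y d : Coord 3} (hy : y ∈ e.target) (hd : d ≠ 0) :
    0 < ∑ i, ∑ j, chartComponents g.inner e y i j * d i * d j := by
  rw [← chartComponents_sum g.inner e y d d]
  refine g.pos (e.symm y) (mfderiv (𝓡 3) (𝓡 3) e.symm y d) fun h => hd ?_
  exact (mdifferentiable_of_mem_maximalAtlas he).symm.mfderiv_injective (x := y) hy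
    (h.trans (map_zero (mfderiv (𝓡 3) (𝓡 3) e.symm y)).symm)

/-- Near a point, a Riemannian metric is bounded below by a multiple of the Euclidean metric of a
chart. -/
lemma SmoothMetric.exists_lower_bound (g : SmoothMetric S)
    (he : e ∈ IsManifold.maximalAtlas (𝓡 3) ∞ S) {y₀ : Coord 3} (hy₀ : y₀ ∈ e.target) :
    ∃ m > 0, ∀ᶠ y in 𝓝 y₀, ∀ d : Coord 3,
      m * ‖d‖ ^ 2 ≤ ∑ i, ∑ j, chartComponents g.inner e y i j * d i * d j := by
  have hc : ∀ d₀ : Coord 3, ContinuousAt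
      (fun z : Coord 3 × Coord 3 => ∑ i, ∑ j, chartComponents g.inner e z.1 i j * z.2 i * z.2 j)
      (y₀, d₀) := fun d₀ => by
    refine tendsto_finsetSum _ fun i _ => tendsto_finsetSum _ fun j _ => ?_
    have h1 : ContinuousAt (fun y => chartComponents g.inner e y i j) y₀ :=
      ((g.isMetricOn he).differentiableAt hy₀ i j).continuousAt
    have h2 : ContinuousAt (fun z : Coord 3 × Coord 3 => chartComponents g.inner e z.1 i j)
        (y₀, d₀) := ContinuousAt.comp (g := fun y => chartComponents g.inner e y i j)
        (f := Prod.fst) h1 continuousAt_fst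
    have h3 : ∀ k : Fin 3, ContinuousAt (fun z : Coord 3 × Coord 3 => z.2 k) (y₀, d₀) := fun k =>
      (by fun_prop : Continuous fun z : Coord 3 × Coord 3 => z.2 k).continuousAt
    exact (h2.mul (h3 i)).mul (h3 j)
  have hc' : Continuous
      (fun d : Coord 3 => ∑ i, ∑ j, chartComponents g.inner e y₀ i j * d i * d j) := by fun_prop
  obtain ⟨d₀, hd₀, hmin⟩ := (isCompact_sphere (0 : Coord 3) 1).exists_isMinOn
    (NormedSpace.sphere_nonempty.2 zero_le_one) hc'.continuousOn
  have hne : ∀ d ∈ Metric.sphere (0 : Coord 3) 1, d ≠ 0 := fun d hd h => by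
    rw [mem_sphere_zero_iff_norm, h, norm_zero] at hd
    exact zero_ne_one hd
  set m := ∑ i, ∑ j, chartComponents g.inner e y₀ i j * d₀ i * d₀ j with hm
  have hm0 : 0 < m := g.sum_chartComponents_pos he hy₀ (hne _ hd₀)
  refine ⟨m / 2, half_pos hm0, ?_⟩
  have key : ∀ᶠ y in 𝓝 y₀, ∀ d ∈ Metric.sphere (0 : Coord 3) 1,
      m / 2 < ∑ i, ∑ j, chartComponents g.inner e y i j * d i * d j := by
    refine (isCompact_sphere (0 : Coord 3) 1).eventually_forall_of_forall_eventually
      fun d hd => ?_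
    refine (hc d).eventually (lt_mem_nhds ?_)
    have : m ≤ _ := hmin hd
    exact (half_lt_self hm0).trans_le this
  filter_upwards [key] with y hy d
  rcases eq_or_ne d 0 with rfl | hd
  · simp
  · have hn : 0 < ‖d‖ := norm_pos_iff.2 hd
    have h1 := hy (‖d‖⁻¹ • d) (by simp [norm_smul, hn.ne'])
    have h2 : ∑ i, ∑ j, chartComponents g.inner e y i j * (‖d‖⁻¹ • d) i * (‖d‖⁻¹ • d) j
        = (‖d‖ ^ 2)⁻¹ * ∑ i, ∑ j, chartComponents g.inner e y i j * d i * d j := by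
      simp only [PiLp.smul_apply, smul_eq_mul, Finset.mul_sum]
      refine Finset.sum_congr rfl fun i _ => Finset.sum_congr rfl fun j _ => ?_
      field_simp
    rw [h2, ← div_eq_inv_mul, lt_div_iff₀ (by positivity)] at h1
    exact h1.le

/-- Every tangent vector with base point in `U` and squared length at most `E` is the initial
velocity of a geodesic on the time interval `(-δ, δ)`. -/
def HasGeodesics (g : SmoothMetric S) (U : Set S) (E δ : ℝ) : Prop :=
  ∀ w : TangentBundle (𝓡 3) S, w.proj ∈ U → g.normSq w ≤ E →
    ∃ W : ℝ → TangentBundle (𝓡 3) S, W 0 = w ∧ ∀ t ∈ Ioo (-δ) δ, IsGeodesicAt g W t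

lemma SmoothMetric.exists_hasGeodesics_nhds (g : SmoothMetric S) (x₀ : S) (E : ℝ) :
    ∃ U ∈ 𝓝 x₀, ∃ δ > 0, HasGeodesics g U E δ := by
  set e := chartAt (Coord 3) x₀ with he_def
  have he : e ∈ IsManifold.maximalAtlas (𝓡 3) ∞ S := IsManifold.chart_mem_maximalAtlas x₀
  have hx₀ : x₀ ∈ e.source := mem_chart_source _ _
  have hy₀ : e x₀ ∈ e.target := e.map_source hx₀
  obtain ⟨r, hr, ε, hε, H⟩ := (g.isMetricOn he).exists_local_geodesic hy₀
  obtain ⟨m, hm, hbound⟩ := g.exists_lower_bound he hy₀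
  have hball : ∀ᶠ y in 𝓝 (e x₀), ‖y - e x₀‖ ≤ r := by
    filter_upwards [Metric.closedBall_mem_nhds (e x₀) hr] with y hy
    rwa [Metric.mem_closedBall, dist_eq_norm] at hy
  -- `B` bounds the components of the velocity, and `a * B ≤ r`
  set B := Real.sqrt (|E| / m) with hB
  set a := r / (B + 1) with ha
  have hB0 : 0 ≤ B := Real.sqrt_nonneg _
  have ha0 : 0 < a := by positivity
  have haB : a * B ≤ r := by
    rw [ha, div_mul_eq_mul_div, div_le_iff₀ (by positivity)]
    nlinarith
  refine ⟨_, inter_mem (e.open_source.mem_nhds hx₀)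
    ((e.continuousAt hx₀).eventually (hbound.and hball)), a * ε, mul_pos ha0 hε,
    fun w hw hwE => ?_⟩
  obtain ⟨hws, hwb, hwr⟩ := hw
  obtain ⟨d, hd⟩ := exists_chartTangent he hws
  have hdB : ‖d‖ ≤ B := by
    have h1 : m * ‖d‖ ^ 2 ≤ E := by
      refine (hwb d).trans ?_
      rw [← g.normSq_chartTangent, hd]
      exact hwE
    refine Real.le_sqrt_of_sq_le ?_
    rw [le_div_iff₀ hm, mul_comm]
    exact h1.trans (le_abs_self E)
  obtain ⟨c, v, hc0, hv0, hcv⟩ := H (e w.proj) (a • d) hwr (by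
    rw [norm_smul, Real.norm_of_nonneg ha0.le]
    exact (mul_le_mul_of_nonneg_left hdB ha0.le).trans haB)
  have hgeo : ∀ s ∈ Ioo (-ε) ε, IsGeodesicAt g (fun s => chartTangent e (c s) (v s)) s :=
    fun s hs => ⟨e, he, c, v, by
      filter_upwards [Ioo_mem_nhds hs.1 hs.2] with u hu
      exact ⟨(hcv u hu).1, rfl, (hcv u hu).2⟩⟩
  refine ⟨fun s => tangentSmul a⁻¹ (chartTangent e (c (a⁻¹ * s + 0)) (v (a⁻¹ * s + 0))), ?_,
    fun t ht => IsGeodesicAt.affine (hgeo (a⁻¹ * t + 0) ?_)⟩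
  · simp only [mul_zero, add_zero, hc0, hv0, ← tangentSmul_chartTangent, hd,
      tangentSmul_tangentSmul]
    rw [inv_mul_cancel₀ ha0.ne', tangentSmul_one]
  · rw [add_zero, inv_mul_eq_div]
    constructor
    · rw [lt_div_iff₀ ha0]
      linarith [ht.1]
    · rw [div_lt_iff₀ ha0]
      linarith [ht.2]

lemma HasGeodesics.mono {U V : Set S} {E δ δ' : ℝ} (h : HasGeodesics g U E δ) (hV : V ⊆ U)
    (hδ : δ' ≤ δ) : HasGeodesics g V E δ' := fun w hw hE => by
  obtain ⟨W, hW0, hW⟩ := h w (hV hw) hE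
  exact ⟨W, hW0, fun t ht => hW t ⟨by linarith [ht.1], ht.2.trans_le hδ⟩⟩

lemma IsCompact.exists_hasGeodesics {K : Set S} (hK : IsCompact K) (g : SmoothMetric S) (E : ℝ) :
    ∃ δ > 0, HasGeodesics g K E δ := by
  refine hK.induction_on (p := fun K => ∃ δ > 0, HasGeodesics g K E δ) ?_ ?_ ?_ ?_
  · exact ⟨1, one_pos, fun w hw => absurd hw (notMem_empty _)⟩
  · rintro s t hst ⟨δ, hδ, h⟩
    exact ⟨δ, hδ, h.mono hst le_rfl⟩
  · rintro s t ⟨δ, hδ, h⟩ ⟨δ', hδ', h'⟩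
    refine ⟨min δ δ', lt_min hδ hδ', fun w hw hE => ?_⟩
    rcases hw with hw | hw
    · exact h.mono subset_rfl (min_le_left _ _) w hw hE
    · exact h'.mono subset_rfl (min_le_right _ _) w hw hE
  · intro x _
    obtain ⟨U, hU, δ, hδ, h⟩ := g.exists_hasGeodesics_nhds x E
    exact ⟨U, mem_nhdsWithin_of_mem_nhds hU, δ, hδ, h⟩

/-- The function `f` is differentiable at `x` and its differential has norm at most `C` with respect
to `g`. -/
def GradientBound (g : SmoothMetric S) (f : S → ℝ) (C : ℝ) (x : S) : Prop :=
  ∃ e ∈ IsManifold.maximalAtlas (𝓡 3) ∞ S, x ∈ e.source ∧ DifferentiableAt ℝ (f ∘ e.symm) (e x) ∧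
    ∀ d : Coord 3, |fderiv ℝ (f ∘ e.symm) (e x) d|
      ≤ C * Real.sqrt (∑ i, ∑ j, chartComponents g.inner e (e x) i j * d i * d j)

lemma IsGeodesicAt.exists_hasDerivAt {f : S → ℝ} {C t : ℝ} (h : IsGeodesicAt g W t)
    (hf : GradientBound g f C (W t).proj) :
    ∃ f', HasDerivAt (fun s => f (W s).proj) f' t ∧ |f'| ≤ C * Real.sqrt (g.normSq (W t)) := by
  obtain ⟨e, he, hte, hd, hbound⟩ := hf
  obtain ⟨c, v, hcv⟩ := h.isGeodesicIn he hte
  obtain ⟨hct, hWt, hst⟩ := hcv.self_of_nhds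
  have hc : e (W t).proj = c t := by
    rw [hWt]
    exact e.right_inv hct
  rw [hc] at hd hbound
  refine ⟨fderiv ℝ (f ∘ e.symm) (c t) (v t), ?_, ?_⟩
  · refine (hd.hasFDerivAt.comp_hasDerivAt t hst.velocity).congr_of_eventuallyEq ?_
    filter_upwards [hcv] with s hs
    rw [hs.2.1]
    rfl
  · rw [hWt, g.normSq_chartTangent]
    exact hbound _

/-- A geodesic moves at bounded speed as measured by a function of bounded gradient. -/
lemma le_add_of_isGeodesicAt {f : S → ℝ} {C : ℝ} (hC : ∀ x, GradientBound g f C x) {a b s t : ℝ}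
    (h : ∀ t ∈ Ioo a b, IsGeodesicAt g W t) (hs : s ∈ Ioo a b) (ht : t ∈ Ioo a b) (hst : s ≤ t) :
    f (W t).proj ≤ f (W s).proj + C * Real.sqrt (g.normSq (W s)) * (t - s) := by
  choose! f' hf' hbound using fun t (ht : t ∈ Ioo a b) => (h t ht).exists_hasDerivAt (hC (W t).proj)
  have := (convex_Ioo a b).norm_image_sub_le_of_norm_hasDerivWithin_le
    (fun t ht => (hf' t ht).hasDerivWithinAt)
    (C := C * Real.sqrt (g.normSq (W s))) (fun r hr => by
      rw [← normSq_eq_of_isGeodesicAt h hr hs]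
      exact hbound r hr) hs ht
  rw [Real.norm_eq_abs, Real.norm_of_nonneg (sub_nonneg.2 hst)] at this
  linarith [le_abs_self (f (W t).proj - f (W s).proj)]

/-- If geodesics starting in the set reached by `W` exist for the time `δ`, then `W` can be extended
by the time `δ / 2`. -/
lemma exists_extension {U : Set S} {δ a T : ℝ} {E : ℝ} (hδ : 0 < δ) (hU : HasGeodesics g U E δ)
    (h : ∀ t ∈ Ioo a T, IsGeodesicAt g W t)
    (hE : g.normSq (W (T - δ / 2)) ≤ E) (hmem : (W (T - δ / 2)).proj ∈ U) :
    ∃ W' : ℝ → TangentBundle (𝓡 3) S, (∀ t ≤ T - δ / 2, W' t = W t) ∧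
      ∀ t ∈ Ioo a (T + δ / 2), IsGeodesicAt g W' t := by
  obtain ⟨V, hV0, hV⟩ := hU _ hmem hE
  refine ⟨fun s => if s ≤ T - δ / 2 then W s else
    tangentSmul 1 (V (1 * s + (δ / 2 - T))), fun t ht => if_pos ht, fun t ht => ?_⟩
  refine isGeodesicAt_ite (fun ht' => h t ⟨ht.1, by linarith⟩)
    (fun ht' => IsGeodesicAt.affine (hV _ ⟨by linarith, by linarith [ht.2]⟩)) ?_
  rw [tangentSmul_one, ← hV0]
  congr 1
  ring

variable {f : S → ℝ} {C : ℝ}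

/-- A geodesic on a bounded time interval can be extended by one unit of time, if there is a
function of bounded gradient with relatively compact sublevel sets. -/
lemma exists_extension_one (hC0 : 0 ≤ C) (hC : ∀ x, GradientBound g f C x)
    (hcompact : ∀ b, ∃ K, IsCompact K ∧ {x | f x ≤ b} ⊆ K) {a T : ℝ} (ha : a < 0) (hT : 0 < T)
    (h : ∀ t ∈ Ioo a T, IsGeodesicAt g W t) :
    ∃ W' : ℝ → TangentBundle (𝓡 3) S, W' 0 = W 0 ∧ (∀ t ≤ T - 1, W' t = W t) ∧
      ∀ t ∈ Ioo a (T + 1), IsGeodesicAt g W' t := by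
  set E := g.normSq (W 0) with hE
  obtain ⟨K, hK, hfK⟩ := hcompact (f (W 0).proj + C * Real.sqrt E * (T + 1))
  obtain ⟨δ₀, hδ₀, hgeo₀⟩ := hK.exists_hasGeodesics g E
  set δ := min δ₀ (min T 1) with hδ_def
  have hδ : 0 < δ := lt_min hδ₀ (lt_min hT one_pos)
  have hδT : δ ≤ T := (min_le_right _ _).trans (min_le_left _ _)
  have hδ1 : δ ≤ 1 := (min_le_right _ _).trans (min_le_right _ _)
  have hgeo : HasGeodesics g K E δ := hgeo₀.mono subset_rfl (min_le_left _ _)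
  -- within one unit of time geodesics stay in `K`, so that steps of fixed length `δ / 2` suffice
  have key : ∀ k : ℕ, ∃ W' : ℝ → TangentBundle (𝓡 3) S, (∀ t ≤ T - δ / 2, W' t = W t) ∧
      ∀ t ∈ Ioo a (T + min (k * (δ / 2)) 1), IsGeodesicAt g W' t := by
    intro k
    induction k with
    | zero => exact ⟨W, fun _ _ => rfl, by simpa using h⟩
    | succ k ih =>
      obtain ⟨W', hW', hg⟩ := ih
      set τ := min ((k : ℝ) * (δ / 2)) 1 with hτ
      have hτ0 : 0 ≤ τ := le_min (by positivity) zero_le_one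
      have hτ1 : τ ≤ 1 := min_le_right _ _
      have h0 : (0 : ℝ) ∈ Ioo a (T + τ) := ⟨ha, by linarith⟩
      have ht : T + τ - δ / 2 ∈ Ioo a (T + τ) := ⟨by linarith, by linarith⟩
      have hW0 : W' 0 = W 0 := hW' 0 (by linarith)
      have hspeed : g.normSq (W' (T + τ - δ / 2)) = E := by
        rw [normSq_eq_of_isGeodesicAt hg ht h0, hW0]
      have hmem : (W' (T + τ - δ / 2)).proj ∈ K := by
        refine hfK ?_
        have := le_add_of_isGeodesicAt hC hg h0 ht (by linarith)
        rw [hW0] at this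
        refine mem_ofPred_eq ▸ this.trans ?_
        have hCE : 0 ≤ C * Real.sqrt E := mul_nonneg hC0 (Real.sqrt_nonneg _)
        gcongr
        linarith
      obtain ⟨W'', hW'', hg'⟩ := exists_extension hδ hgeo hg hspeed.le hmem
      refine ⟨W'', fun t ht => (hW'' t (by linarith)).trans (hW' t ht),
        fun t ht => hg' t ⟨ht.1, ht.2.trans_le ?_⟩⟩
      have : min (((k + 1 : ℕ) : ℝ) * (δ / 2)) 1 ≤ τ + δ / 2 := by
        rw [hτ, ← min_add_add_right]
        push_cast
        exact min_le_min (by linarith) (by linarith)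
      linarith
  obtain ⟨N, hN⟩ := exists_nat_gt (1 / (δ / 2))
  obtain ⟨W', hW', hg⟩ := key N
  refine ⟨W', hW' 0 (by linarith), fun t ht => hW' t (by linarith), fun t ht => hg t ?_⟩
  rw [div_lt_iff₀ (half_pos hδ)] at hN
  rwa [min_eq_right hN.le]

/-- Geodesics exist for all positive times. -/
lemma exists_forward_geodesic (hC0 : 0 ≤ C) (hC : ∀ x, GradientBound g f C x)
    (hcompact : ∀ b, ∃ K, IsCompact K ∧ {x | f x ≤ b} ⊆ K) (w : TangentBundle (𝓡 3) S) :
    ∃ W : ℝ → TangentBundle (𝓡 3) S, W 0 = w ∧ ∀ t, 0 ≤ t → IsGeodesicAt g W t := by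
  obtain ⟨U, hU, δ, hδ, hgeo⟩ := g.exists_hasGeodesics_nhds w.proj (g.normSq w)
  obtain ⟨V, hV0, hV⟩ := hgeo w (mem_of_mem_nhds hU) le_rfl
  have step : ∀ (n : ℕ) (W : {W : ℝ → TangentBundle (𝓡 3) S //
      W 0 = w ∧ ∀ t ∈ Ioo (-δ) (δ + n), IsGeodesicAt g W t}),
      ∃ W' : {W : ℝ → TangentBundle (𝓡 3) S //
        W 0 = w ∧ ∀ t ∈ Ioo (-δ) (δ + (n + 1 : ℕ)), IsGeodesicAt g W t},
        ∀ t ≤ δ + n - 1, W'.1 t = W.1 t := by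
    rintro n ⟨W, hW0, hW⟩
    obtain ⟨W', h0, hW', hg⟩ := exists_extension_one hC0 hC hcompact (neg_lt_zero.2 hδ)
      (by positivity) hW
    refine ⟨⟨W', h0.trans hW0, ?_⟩, hW'⟩
    push_cast
    rwa [← add_assoc]
  -- successive extensions agree on ever longer intervals, and are joined to a single curve
  choose next hnext using step
  let W : ∀ n : ℕ, {W : ℝ → TangentBundle (𝓡 3) S //
      W 0 = w ∧ ∀ t ∈ Ioo (-δ) (δ + n), IsGeodesicAt g W t} := fun n =>
    Nat.rec ⟨V, hV0, by simpa using hV⟩ next n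
  have hagree : ∀ m n : ℕ, m ≤ n → ∀ t ≤ δ + m - 1, (W n).1 t = (W m).1 t := by
    intro m n hmn t ht
    induction n, hmn using Nat.le_induction with
    | base => rfl
    | succ n hmn ih =>
      refine (hnext n (W n) t (ht.trans ?_)).trans ih
      gcongr
  refine ⟨fun t => (W (⌈t⌉₊ + 1)).1 t, (W (⌈(0 : ℝ)⌉₊ + 1)).2.1, fun t ht => ?_⟩
  have hceil : t ≤ (⌈t⌉₊ : ℝ) := Nat.le_ceil t
  refine ((W (⌈t⌉₊ + 2)).2.2 t ⟨by linarith, by push_cast; linarith⟩).congr ?_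
  filter_upwards [eventually_lt_nhds (lt_add_one t)] with s hs
  refine (hagree (⌈s⌉₊ + 1) (⌈t⌉₊ + 2) ?_ s ?_).symm
  · have : ⌈s⌉₊ ≤ ⌈t⌉₊ + 1 := by
      refine Nat.ceil_le.2 ?_
      push_cast
      linarith
    omega
  · have := Nat.le_ceil s
    push_cast
    linarith

/-- A Riemannian metric is geodesically complete if there is a function of bounded gradient with
relatively compact sublevel sets. -/
theorem isGeodesicallyComplete_of_gradientBound (hC0 : 0 ≤ C) (hC : ∀ x, GradientBound g f C x)
    (hcompact : ∀ b, ∃ K, IsCompact K ∧ {x | f x ≤ b} ⊆ K) : IsGeodesicallyComplete g := by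
  intro w
  obtain ⟨W, hW0, hW⟩ := exists_forward_geodesic hC0 hC hcompact w
  obtain ⟨V, hV0, hV⟩ := exists_forward_geodesic hC0 hC hcompact (tangentSmul (-1) w)
  have hgeo : ∀ t, IsGeodesicAt g
      (fun s => if s ≤ 0 then tangentSmul (-1) (V (-1 * s + 0)) else W s) t := fun t =>
    isGeodesicAt_ite (fun ht => IsGeodesicAt.affine (hV _ (by linarith))) (fun ht => hW t ht) (by
      rw [hW0, mul_zero, add_zero, hV0, tangentSmul_tangentSmul]
      norm_num [tangentSmul_one])
  refine ⟨_, isGeodesic_of_isGeodesicAt hgeo, (hgeo 0).velocity.trans ?_⟩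
  simp [hV0, tangentSmul_tangentSmul, tangentSmul_one]

end Completeness

/-! ### Completeness of the metric -/

section Growth

/-- A continuously differentiable function of `s = r²` growing like `log s`, zero for `r ≤ 2`. -/
noncomputable def growthProfile (s : ℝ) : ℝ :=
  if s ≤ 4 then 0 else Real.log (1 + (s - 4) ^ 2)

lemma growthProfile_of_le {s : ℝ} (hs : s ≤ 4) : growthProfile s = 0 := if_pos hs

lemma growthProfile_of_ge {s : ℝ} (hs : 4 ≤ s) : growthProfile s = Real.log (1 + (s - 4) ^ 2) := by
  rcases hs.eq_or_lt with rfl | h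
  · simp [growthProfile]
  · exact if_neg (not_le.2 h)

lemma hasDerivAt_growthProfile (s : ℝ) :
    HasDerivAt growthProfile (2 * max (s - 4) 0 / (1 + max (s - 4) 0 ^ 2)) s := by
  have hlog : HasDerivAt (fun s => Real.log (1 + (s - 4) ^ 2))
      (2 * (s - 4) / (1 + (s - 4) ^ 2)) s := by
    have h1 : HasDerivAt (fun s : ℝ => 1 + (s - 4) ^ 2) (2 * (s - 4)) s := by
      refine ((((hasDerivAt_id' s).sub_const 4).fun_pow 2).const_add 1).congr_deriv ?_
      norm_num
    exact h1.log (by positivity)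
  rcases lt_trichotomy s 4 with h | rfl | h
  · rw [max_eq_right (by linarith), mul_zero, zero_div]
    refine (hasDerivAt_const s (0 : ℝ)).congr_of_eventuallyEq ?_
    filter_upwards [eventually_lt_nhds h] with r hr
    exact growthProfile_of_le (le_of_lt hr)
  · refine hasDerivAt_ite_le ?_ (hlog.congr_deriv (by norm_num)) (by norm_num)
    exact (hasDerivAt_const (4 : ℝ) (0 : ℝ)).congr_deriv (by norm_num)
  · rw [max_eq_left (by linarith)]
    refine hlog.congr_of_eventuallyEq ?_
    filter_upwards [eventually_gt_nhds h] with r hr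
    exact growthProfile_of_ge (le_of_lt hr)

/-- The gradient of `growthProfile (r²)` is bounded with respect to a metric whose radial part
`(1 + κ² r²)⁻¹ dr²` is that of hyperbolic space. -/
lemma abs_growthProfile_deriv_mul_le {κ s p q : ℝ} (hs : 1 ≤ s)
    (hp : p ^ 2 ≤ s * (1 + κ ^ 2 * s) * q) (hq : 0 ≤ q) :
    |2 * (2 * max (s - 4) 0 / (1 + max (s - 4) 0 ^ 2)) * p|
      ≤ 12 * Real.sqrt (1 + κ ^ 2) * Real.sqrt q := by
  set u := max (s - 4) 0 with hu
  have hu0 : 0 ≤ u := le_max_right _ _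
  have hsq : 0 ≤ Real.sqrt (1 + κ ^ 2) * Real.sqrt q := by positivity
  have hp1 : |p| ≤ s * (Real.sqrt (1 + κ ^ 2) * Real.sqrt q) := by
    rw [← Real.sqrt_mul (by positivity)]
    refine abs_le_of_sq_le_sq' ?_ (by positivity) |> abs_le.2
    rw [mul_pow, Real.sq_sqrt (by positivity)]
    refine hp.trans ?_
    have h1 : s * (1 + κ ^ 2 * s) ≤ s ^ 2 * (1 + κ ^ 2) := by nlinarith
    nlinarith [mul_le_mul_of_nonneg_right h1 hq]
  have hus : u * s ≤ 3 * (1 + u ^ 2) := by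
    rcases le_total s 4 with h | h
    · rw [hu, max_eq_right (by linarith)]
      norm_num
    · have : s = u + 4 := by rw [hu, max_eq_left (by linarith)]; ring
      rw [this]
      nlinarith [sq_nonneg (u - 1)]
  have hd : 0 < 1 + u ^ 2 := by positivity
  rw [abs_mul, abs_of_nonneg (by positivity)]
  calc 2 * (2 * u / (1 + u ^ 2)) * |p|
      ≤ 2 * (2 * u / (1 + u ^ 2)) * (s * (Real.sqrt (1 + κ ^ 2) * Real.sqrt q)) := by gcongr
    _ = 4 * (u * s / (1 + u ^ 2)) * (Real.sqrt (1 + κ ^ 2) * Real.sqrt q) := by ring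
    _ ≤ 4 * 3 * (Real.sqrt (1 + κ ^ 2) * Real.sqrt q) := by
      gcongr
      exact (div_le_iff₀ hd).2 hus
    _ = _ := by ring

variable {S : Type*} [TopologicalSpace S] [ChartedSpace (Coord 3) S]
  {ι : Type*} {e : ι → OpenPartialHomeomorph S (Coord 3)}

open Classical in
/-- A function on the manifold growing like `log r` on the ends, and vanishing inside. -/
noncomputable def growthFunction (e : ι → OpenPartialHomeomorph S (Coord 3)) (p : S) : ℝ :=
  if h : ∃ i, p ∈ (e i).source then growthProfile (‖e h.choose p‖ ^ 2) else 0

lemma IsWeakEndSystem.growthFunction_eq (h : IsWeakEndSystem e) {i : ι} {p : S}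
    (hp : p ∈ (e i).source) : growthFunction e p = growthProfile (‖e i p‖ ^ 2) := by
  have hex : ∃ i, p ∈ (e i).source := ⟨i, hp⟩
  rw [growthFunction, dif_pos hex, h.eq_of_mem hex.choose_spec hp]

lemma IsWeakEndSystem.growthFunction_eq_zero (h : IsWeakEndSystem e) {p : S}
    (hp : ∀ i, p ∈ (e i).source → ‖e i p‖ < 2) : growthFunction e p = 0 := by
  by_cases hex : ∃ i, p ∈ (e i).source
  · obtain ⟨i, hi⟩ := hex
    rw [h.growthFunction_eq hi]
    have := hp i hi
    exact growthProfile_of_le (by nlinarith [norm_nonneg (e i p)])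
  · exact dif_neg hex

lemma IsWeakEndSystem.exists_isCompact_growthFunction_le (h : IsWeakEndSystem e) (b : ℝ) :
    ∃ K, IsCompact K ∧ {p | growthFunction e p ≤ b} ⊆ K := by
  have hb := Real.exp_pos b
  refine ⟨_, h.compact (3 + Real.exp b) (by linarith), fun p hp hcon => ?_⟩
  obtain ⟨i, hi, hR⟩ := mem_iUnion.1 hcon
  have hR : 3 + Real.exp b < ‖e i p‖ := hR
  have hp : growthFunction e p ≤ b := hp
  rw [h.growthFunction_eq hi, growthProfile_of_ge (by nlinarith),
    Real.log_le_iff_le_exp (by positivity)] at hp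
  have h1 : Real.exp b + 1 ≤ ‖e i p‖ ^ 2 - 4 := by nlinarith
  nlinarith

variable [IsManifold (𝓡 3) ∞ S] {g : SmoothMetric S} {κ : ℝ}

lemma IsProperEndSystem.gradientBound [Finite ι] (h : IsProperEndSystem e)
    (hg : ∀ i, ∀ y : Coord 3, 3 / 2 < ‖y‖ →
      chartComponents g.inner (e i) y = radialMetric (endProfile κ) y) (p : S) :
    GradientBound g (growthFunction e) (12 * Real.sqrt (1 + κ ^ 2)) p := by
  by_cases hex : ∃ i, p ∈ endRegion (e i) (3 / 2)
  · obtain ⟨i, hi, hpi⟩ := hex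
    have hpi : 3 / 2 < ‖e i p‖ := hpi
    have hd := hasDerivAt_growthProfile (‖e i p‖ ^ 2)
    have heq : growthFunction e ∘ (e i).symm =ᶠ[𝓝 (e i p)] fun y => growthProfile (‖y‖ ^ 2) := by
      filter_upwards [(e i).open_target.mem_nhds ((e i).map_source hi)] with y hy
      rw [Function.comp_apply, h.growthFunction_eq ((e i).map_target hy), (e i).right_inv hy]
    refine ⟨e i, h.smooth i, hi, (differentiableAt_radial hd).congr_of_eventuallyEq heq,
      fun d => ?_⟩
    have hs0 : 0 < ‖e i p‖ ^ 2 := by positivity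
    have hw := (endProfile_isProfileOn κ).w_pos _ hs0
    rw [heq.fderiv_eq, fderiv_eq_sum_pderiv, hg i _ hpi]
    have hsum : ∑ k, d k * pderiv k (fun y : Coord 3 => growthProfile (‖y‖ ^ 2)) (e i p)
        = 2 * (2 * max (‖e i p‖ ^ 2 - 4) 0 / (1 + max (‖e i p‖ ^ 2 - 4) 0 ^ 2))
          * ∑ k, e i p k * d k := by
      rw [Finset.mul_sum]
      refine Finset.sum_congr rfl fun k _ => ?_
      rw [pderiv_radial hd]
      ring
    rw [hsum]
    have hq : 0 ≤ ∑ k, ∑ l, radialMetric (endProfile κ) (e i p) k l * d k * d l := by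
      rcases eq_or_ne d 0 with rfl | hd0
      · simp
      · exact (radialMetric_pos hw hd0).le
    refine abs_growthProfile_deriv_mul_le (by nlinarith) ?_ hq
    refine (radialMetric_radial_le hw d).trans ?_
    have := endProfile_w_le (κ := κ) hs0
    gcongr
  · have hC := (h.isClosed_iUnion (R := 2) (by norm_num)).isOpen_compl
    have hnear : ∀ᶠ z in 𝓝 p, growthFunction e z = 0 := by
      filter_upwards [hC.mem_nhds (x := p) fun hcon => by
        obtain ⟨i, hi⟩ := mem_iUnion.1 hcon
        exact hex ⟨i, hi.1, by linarith [hi.2]⟩] with z hz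
      refine h.growthFunction_eq_zero fun i hi => ?_
      by_contra hlt
      exact hz (mem_iUnion.2 ⟨i, hi, not_lt.1 hlt⟩)
    have hp := mem_chart_source (Coord 3) p
    set c := chartAt (Coord 3) p with hc
    have hcont : Tendsto c.symm (𝓝 (c p)) (𝓝 p) := by
      have := c.continuousAt_symm (c.map_source hp)
      rwa [ContinuousAt, c.left_inv hp] at this
    have heq : growthFunction e ∘ c.symm =ᶠ[𝓝 (c p)] fun _ => 0 := hcont.eventually hnear
    refine ⟨c, IsManifold.chart_mem_maximalAtlas p, hp,
      (differentiableAt_const (0 : ℝ)).congr_of_eventuallyEq heq, fun d => ?_⟩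
    rw [heq.fderiv_eq]
    simp only [fderiv_fun_const, Pi.zero_apply, _root_.zero_apply, abs_zero]
    positivity

/-- A metric which is radial with profile `endProfile κ` on a proper system of ends is complete. -/
theorem IsProperEndSystem.isGeodesicallyComplete [Finite ι] (h : IsProperEndSystem e)
    (hg : ∀ i, ∀ y : Coord 3, 3 / 2 < ‖y‖ →
      chartComponents g.inner (e i) y = radialMetric (endProfile κ) y) :
    IsGeodesicallyComplete g :=
  isGeodesicallyComplete_of_gradientBound (by positivity) (h.gradientBound hg)
    h.exists_isCompact_growthFunction_le

end Growth

/-! ### Umbilic initial data -/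

section UmbilicData

variable {S : Type*} [TopologicalSpace S] [ChartedSpace (Coord 3) S]

lemma chartComponents_smul
    (b : ∀ x : S, TangentSpace (𝓡 3) x →L[ℝ] TangentSpace (𝓡 3) x →L[ℝ] ℝ) (a : ℝ)
    (e : OpenPartialHomeomorph S (Coord 3)) (y : Coord 3) :
    chartComponents (fun x => a • b x) e y = a • chartComponents b e y := rfl

variable [IsManifold (𝓡 3) ∞ S]

/-- The initial data with extrinsic curvature `-κ g` and vanishing momentum density; the energy
density is determined by the Hamiltonian constraint. -/
noncomputable def umbilicData (g : SmoothMetric S) (κ : ℝ) : InitialData S where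
  g := g
  p x := -κ • g.inner x
  ρ x := (g.scalar x + 6 * κ ^ 2) / (16 * Real.pi)
  J _ := 0
  p_symm x v w := congrArg (fun r : ℝ => -κ * r) (g.symm x v w)
  p_smooth x := by
    have he : chartAt (Coord 3) x ∈ IsManifold.maximalAtlas (𝓡 3) ∞ S :=
      IsManifold.chart_mem_maximalAtlas x
    have hx := mem_chart_source (Coord 3) x
    refine (isSmoothFormAt_iff (b := fun x => -κ • g.inner x) he hx).2 fun i j => ?_
    exact contDiffAt_const.mul ((isSmoothFormAt_iff he hx).1 (g.isSmoothFormAt x) i j)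
  ρ_smooth := (g.scalar_smooth.add contMDiff_const).div_const _
  J_smooth := Bundle.contMDiff_zeroSection ℝ _
  hamiltonian e he y hy := by
    have hG := g.isMetricOn he
    have hP := chartComponents_smul g.inner (-κ) e y
    rw [hG.normSqCoord_smul hy hP, hG.traceCoord_smul hy hP, g.scalar_eq he hy]
    have := Real.pi_pos
    field_simp
    push_cast
    ring
  momentum e he y hy a := by
    rw [(g.isMetricOn he).momentumDiv_smul hy
      fun y _ => chartComponents_smul g.inner (-κ) e y]
    have h0 : ∀ L : Coord 3 →L[ℝ] Coord 3, (L 0) a = 0 := fun L => by simp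
    have := h0 (mfderiv (𝓡 3) (𝓡 3) e (e.symm y))
    exact (mul_eq_zero_of_right _ this).symm

variable (g : SmoothMetric S) (κ : ℝ)

lemma umbilicData_hasMeanCurvature : (umbilicData g κ).HasMeanCurvature (-3 * κ) :=
  fun e he y hy => by
    rw [umbilicData, (g.isMetricOn he).traceCoord_smul hy (chartComponents_smul g.inner (-κ) e y)]
    push_cast
    ring

variable {g κ}

lemma umbilicData_isPhysicallyReasonable (hg : IsGeodesicallyComplete g)
    (hscal : ∀ x, -6 * κ ^ 2 ≤ g.scalar x) : (umbilicData g κ).IsPhysicallyReasonable where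
  complete := hg
  energy x := by
    have h0 : ∀ B : Coord 3 →L[ℝ] Coord 3 →L[ℝ] ℝ, Real.sqrt (B 0 0) = 0 := fun B => by simp
    refine (h0 (g.inner x)).trans_le (div_nonneg ?_ (by positivity))
    linarith [hscal x]

/-- The restriction of a chart to the part of its domain mapped to `{|x| > R}`. -/
noncomputable def endChart (e : OpenPartialHomeomorph S (Coord 3)) (R : ℝ) :
    OpenPartialHomeomorph S (Coord 3) :=
  e.trans (OpenPartialHomeomorph.ofSet (outside R) (isOpen_outside R))

variable {ι : Type*} {e : ι → OpenPartialHomeomorph S (Coord 3)}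

lemma umbilicData_isSchwarzschildCMCEnd {e : OpenPartialHomeomorph S (Coord 3)}
    (he : e.target = outside 1) (hκ : 0 < κ)
    (hg : ∀ y : Coord 3, 3 / 2 < ‖y‖ →
      chartComponents g.inner e y = radialMetric (endProfile κ) y) :
    (umbilicData g κ).IsSchwarzschildCMCEnd (-3 * κ) (endChart e (κ ^ 2 * softMin 9 + 3)) := by
  have h9 := eight_le_softMin_nine
  set R := κ ^ 2 * softMin 9 + 3 with hR
  have hm : 0 < κ ^ 2 * softMin 9 := by positivity
  have hM : 0 < κ ^ 2 * softMin 9 / 2 := by positivity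
  have hMR : 2 * (κ ^ 2 * softMin 9 / 2) < R := by linarith
  refine ⟨κ ^ 2 * softMin 9 / 2, R, umbilicHeight (κ ^ 2 * softMin 9 / 2) κ R,
    umbilicNormal (κ ^ 2 * softMin 9 / 2) κ, ?_, hMR, umbilic_isCMCHypersurface hM hMR,
    umbilicHeight_reachesNullInfinity hM hκ hMR, fun x hx => ?_⟩
  · refine trans_target_eq fun x hx => ?_
    rw [he]
    have hx : R < ‖x‖ := hx
    exact lt_trans (by linarith) hx
  · have hx3 : 3 < ‖x‖ := by linarith
    have hβ : endProfile κ (‖x‖ ^ 2) = 2 * (κ ^ 2 * softMin 9 / 2)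
        / (‖x‖ ^ 2 * Real.sqrt (‖x‖ ^ 2)) - κ ^ 2 := by
      rw [endProfile_of_ge (by nlinarith)]
      ring
    have hgx : chartComponents g.inner (endChart e R) x = radialMetric (endProfile κ) x :=
      hg x (by linarith)
    have hpx : chartComponents (umbilicData g κ).p (endChart e R) x
        = -κ • radialMetric (endProfile κ) x := by
      rw [← hgx]
      exact chartComponents_smul g.inner (-κ) _ x
    refine ⟨hgx.trans (umbilic_inducedMetric hM hMR hx hβ).symm,
      hpx.trans (umbilic_extrinsicCurvature hM hMR hx hβ).symm, ?_⟩
    rw [hpx, show (umbilicData g κ).g = g from rfl, hgx]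
    congr 1
    ring

lemma umbilicData_isAsymptoticallyNull [Finite ι] (h : IsProperEndSystem e) (hκ : 0 < κ)
    (hg : ∀ i, ∀ y : Coord 3, 3 / 2 < ‖y‖ →
      chartComponents g.inner (e i) y = radialMetric (endProfile κ) y) :
    (umbilicData g κ).IsAsymptoticallyNull (-3 * κ) := by
  have h9 := eight_le_softMin_nine
  have hm : 0 < κ ^ 2 * softMin 9 := by positivity
  set R := κ ^ 2 * softMin 9 + 3 with hR
  obtain ⟨n, ⟨σ⟩⟩ := Finite.exists_equiv_fin ι
  refine ⟨(⋃ i, endRegion (e i) R)ᶜ, n, fun k => endChart (e (σ.symm k)) R,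
    ⟨h.compact R (by linarith), fun k => ?_, fun k l hkl => ?_, ?_⟩, fun k =>
    umbilicData_isSchwarzschildCMCEnd (h.target _) hκ (hg _)⟩
  · exact trans_mem_maximalAtlas (h.smooth _) contDiffOn_id contDiffOn_id
  · exact (h.disjoint (σ.symm.injective.ne hkl)).mono inter_subset_left inter_subset_left
  · rw [compl_compl]
    exact σ.symm.surjective.iUnion_comp fun i => endRegion (e i) R

/-- If the scalar curvature of the metric in the interior is at least `-6κ²`, so is that of the
metric with profile `endProfile κ` on the ends. -/
lemma IsProperEndSystem.scalar_ge [Finite ι] (h : IsProperEndSystem e) {g₀ : SmoothMetric S}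
    (hg : ∀ i, ∀ y : Coord 3, 3 / 2 < ‖y‖ →
      chartComponents g.inner (e i) y = radialMetric (endProfile κ) y)
    (hg' : ∀ p, (∀ i, p ∈ (e i).source → ‖e i p‖ < 2) → g.inner p = g₀.inner p)
    (hκ : ∀ p ∈ (⋃ i, endRegion (e i) 2)ᶜ, -6 * κ ^ 2 ≤ g₀.scalar p) (p : S) :
    -6 * κ ^ 2 ≤ g.scalar p := by
  by_cases hex : ∃ i, p ∈ endRegion (e i) (3 / 2)
  · obtain ⟨i, hi, hpi⟩ := hex
    have hpi : 3 / 2 < ‖e i p‖ := hpi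
    have hs0 : 0 < ‖e i p‖ ^ 2 := by positivity
    have hev : ∀ᶠ y in 𝓝 (e i p),
        chartComponents g.inner (e i) y = radialMetric (endProfile κ) y := by
      filter_upwards [(isOpen_outside (3 / 2)).mem_nhds hpi] with y hy
      exact hg i y hy
    have := g.scalar_eq (h.smooth i) ((e i).map_source hi)
    rw [(e i).left_inv hi] at this
    rw [this, scalarCoord_congr hev, (endProfile_isProfileOn κ).scalar_radial hs0]
    exact endProfile_scalar hs0
  · have hC := (h.isClosed_iUnion (R := 2) (by norm_num)).isOpen_compl
    have hp : p ∈ (⋃ i, {p | p ∈ (e i).source ∧ 2 ≤ ‖e i p‖})ᶜ := fun hcon => by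
      obtain ⟨i, hi⟩ := mem_iUnion.1 hcon
      exact hex ⟨i, hi.1, by linarith [hi.2]⟩
    rw [SmoothMetric.scalar_congr (g' := g₀)]
    · refine hκ p fun hcon => hp ?_
      obtain ⟨i, hi⟩ := mem_iUnion.1 hcon
      exact mem_iUnion.2 ⟨i, hi.1, le_of_lt hi.2⟩
    · filter_upwards [hC.mem_nhds hp] with z hz
      refine hg' z fun i hi => ?_
      by_contra hlt
      exact hz (mem_iUnion.2 ⟨i, hi, not_lt.1 hlt⟩)

end UmbilicData

theorem theorem6 {S : Type*} [TopologicalSpace S] [T2Space S] [SecondCountableTopology S]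
    [ChartedSpace (Coord 3) S] [IsManifold (𝓡 3) ∞ S] (hS : IsAsymptoticallyFlat S) :
    ∃ (d : InitialData S) (H : ℝ), H ≠ 0 ∧ d.IsPhysicallyReasonable ∧ d.HasMeanCurvature H ∧
      d.IsAsymptoticallyNull H := by
  have : LocallyCompactSpace S := ChartedSpace.locallyCompactSpace (Coord 3) S
  obtain ⟨_, _, _, hweak⟩ := exists_weakEndSystem S hS
  obtain ⟨ι, _, e, he⟩ := hweak.exists_proper
  obtain ⟨g₀, hg₀⟩ := he.exists_flat_metric
  obtain ⟨B, hB⟩ := (he.compact 2 one_lt_two).exists_bound_of_continuousOn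
    g₀.scalar_smooth.continuous.continuousOn
  -- the constant `κ` outweighs the negative scalar curvature of `g₀` in the interior
  set κ := 1 + |B| with hκ
  have hκ0 : 0 < κ := by positivity
  obtain ⟨g, hg, hg'⟩ := he.exists_end_metric hg₀ κ
  have hscal := he.scalar_ge hg hg' fun p hp => by
    have h1 := (abs_le.1 (hB p hp)).1
    have h2 := le_abs_self B
    nlinarith [abs_nonneg B]
  exact ⟨umbilicData g κ, -3 * κ, by simp [hκ0.ne'],
    umbilicData_isPhysicallyReasonable (he.isGeodesicallyComplete hg) hscal,
    umbilicData_hasMeanCurvature g κ, umbilicData_isAsymptoticallyNull he hκ0 hg⟩
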